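/- **Reflection positivity for Levin–Wen models.** *Category.* Let $\mathscr C$ be a unitary fusion category, with adjoint $f\mapsto f^\dagger$. Let $\mathrm{Irr}$ be a set of representatives of its simple objects. Every $j\in\mathrm{Irr}$ has a dual $j^-$ (write $j^+=j$), with a standard solution $R_j:1\to j\otimes j^-$, $R_j':1\to j^-\otimes j$ of the conjugate equations, $R_j^\dagger R_j=R_j'^\dagger R_j'=d(j)$ (the quantum dimension). Put $\mu=\sum_j d(j)^2$, $A^+=\bigoplus_j j$ and $A^-=\bigoplus_j j^-$ (orthogonal direct sums). The space $\hom(1,X)$ has the inner product $x^\dagger y$. Fix bases of the spaces $\hom(j\otimes i^{\pm},i'^{\pm})$ with $y_ay_b^\dagger=\delta_{ab}\,d(i')^{-1}$. Let $\theta_{\mathscr C}$ be the modular conjugation (horizontal reflection: the transpose, through the duality, of the adjoint), so $\theta_{\mathscr C}:\hom(X\otimes Y,Z)\to\hom(Y^-\otimes X^-,Z^-)$ and $\theta_{\mathscr C}:\hom(1,X_1\otimes\cdots\otimes X_n)\to\hom(1,X_n^-\otimes\cdots\otimes X_1^-)$. Let $\rho:\hom(1,X_1\otimes\cdots\otimes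 X_n)\to\hom(1,X_2\otimes\cdots\otimes X_n\otimes X_1)$ be the rotation that bends the first leg over the top. *Graph.* Let $\Gamma_+$ be a finite oriented graph embedded in a surface $M_+$ in the half space $x_1\ge0$, meeting $\partial M_+\subset P=\{x_1=0\}$ exactly in the boundary points of $\Gamma_+$, and let $\theta_P$ be the reflection in $P$. Let $M=M_+\cup\theta_P(M_+)$ (closed, oriented) and $\Gamma=\Gamma_+\cup\theta_P(\Gamma_+)$, where $\theta_P$ reverses the orientation of the edges. An edge of $\Gamma_+$ ending on $P$ has one end at a vertex and forms one edge of $\Gamma$ together with its mirror image. Let $V,E$ be the vertices and edges of $\Gamma$; $V_\pm$ the vertices in $M_\pm$, where $M_-=\theta_P(M_+)$; $E_\pm$ the edges meeting $M_\pm$; so $E_0=E_+\cap E_-$ are the edges crossing $P$. Plaquettes are the components of $M\setminus\Gamma$. The embedding is cellular, so that it is given by the anti-clockwise order $\kappa_v$ of the half-edges at each vertex $v$ (from an arbitrary first one, with the mirrored order at $\theta_P(v)$), and no edge has the same plaquette on both sides. Let $\varepsilon_v(e)=+$ at the source of $e$ and $-$ at its target. *Spaces.* For $v$ of degree $n$ put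 $\mathcal H_v=\hom(1,A^{\varepsilon_1}\otimes\cdots\otimes A^{\varepsilon_n})$, where $\varepsilon_k=\varepsilon_v(\kappa_v(k))$. For $e\in E$ put $\mathcal H_e=L^2(\mathrm{Irr})$ with orthonormal basis $\delta_j$. Let $\mathcal H=\bigotimes_{v\in V}\mathcal H_v\otimes\bigotimes_{e\in E}\mathcal H_e$, and define $\mathcal H_\pm$ likewise from $V_\pm,E_\pm$. Let $\iota:\mathcal H\to\mathcal H_-\boxtimes\mathcal H_+$ be the linear map that sends a product basis vector to the tensor product of its restrictions to the two halves (the labels of the edges in $E_0$ are copied to both). Let $\theta:\mathcal H_+\to\mathcal H_-$ be the antilinear map that applies $\theta_{\mathscr C}:\mathcal H_v\to\mathcal H_{\theta_P(v)}$ at each vertex and carries the label of $e$ to $\theta_P(e)$. *Hamiltonian.* For $v\in V$, $H_v$ is the projection onto the states whose leg at each half-edge of an edge $e$ at $v$ lies in the summand $j^{\pm}$ of $A^{\pm}$ given by the label $j$ of $e$. For a plaquette $p$ with boundary $v_1,e_1,\dots,v_m,e_m$ (clockwise, $e_k$ joining $v_k$ to $v_{k+1}$, $e_0=e_m$) and $j\in\mathrm{Irr}$,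 contracting a loop labelled by $j$ with $\partial p$ is the operator $$H_{p,j}=\sum_{j_k,\,j_k'\in\mathrm{Irr}}\ \sum_{y_1,\dots,y_m}\ \prod_{k=1}^m d(j_k)^{s}\,d(j_k')^{t}\ \prod_{k=1}^m |\delta_{j_k'}\rangle\langle\delta_{j_k}|_{e_k}\ \prod_{k=1}^m\rho_{v_k}^{1-\kappa_{v_k}^{-1}(e_k)}\,C_{v_k,\,y_k,\,\theta_{\mathscr C}(y_{k-1})}\,\rho_{v_k}^{\kappa_{v_k}^{-1}(e_k)-1},$$ where $y_k$ runs over the basis of $\hom(j\otimes j_k^{\varepsilon},j_k'^{\,\varepsilon})$ with $\varepsilon=\varepsilon_{v_k}(e_k)$, $y_0=y_m$, and $C_{y,z}(x)=(y\otimes1\otimes z)(1_j\otimes x\otimes1_{j^-})R_j$. Put $H_p=\sum_j\frac{d(j)^{r}}{\mu}H_{p,j}$ and $$H=\lambda_{\mathfrak P}\sum_{p}(1-H_p)+\lambda_V\sum_{v\in V}(1-H_v),\qquad \lambda_{\mathfrak P},\lambda_V\ge0 .$$ The real exponents $r,s,t$ fix the normalisation; loop insertion has $(s,t)=(0,1)$,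 the unitarily normalised version has $(s,t)=(\tfrac12,\tfrac12)$, and $r=1$ makes $H_p$ idempotent in both cases. **Theorem.** For all real $r,s,t$ (in particular for $(r,s,t)=(2,0,1)$, $(1,0,1)$ and $(1,\tfrac12,\tfrac12)$), $H$ has the RP property: for all $h_+,\Omega_+\in\mathcal H_+$ and all $\beta\ge0$, $$\big\langle e^{-\beta H}\,\iota^*(\theta(h_+)\boxtimes h_+),\ \iota^*(\theta(\Omega_+)\boxtimes\Omega_+)\big\rangle_{\mathcal H}\ \ge 0 .$$ -/

import Mathlib

open CategoryTheory MonoidalCategory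
open scoped ComplexOrder TensorProduct

noncomputable section

namespace LevinWen

universe v u

/-! ## Unitary fusion categories -/

/-- A unitary fusion category: a `ℂ`-linear abelian semisimple rigid monoidal category with
finite-dimensional morphism spaces, finitely many isomorphism classes of simple objects and simple
unit, together with a positive definite antilinear involution `dag` (the adjoint `f ↦ f†`) that is
compatible with the tensor product and for which the structure isomorphisms are unitary.
(`f ≫ dag f` is the endomorphism `f† f`.) -/
class UnitaryFusionCategory (C : Type u) [Category.{v} C] [Abelian C] [Linear ℂ C]
    [MonoidalCategory C] [MonoidalPreadditive C] [MonoidalLinear ℂ C] where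
  dag : ∀ {X Y : C}, (X ⟶ Y) → (Y ⟶ X)
  dag_dag : ∀ {X Y : C} (f : X ⟶ Y), dag (dag f) = f
  dag_comp : ∀ {X Y Z : C} (f : X ⟶ Y) (g : Y ⟶ Z), dag (f ≫ g) = dag g ≫ dag f
  dag_add : ∀ {X Y : C} (f g : X ⟶ Y), dag (f + g) = dag f + dag g
  dag_smul : ∀ {X Y : C} (c : ℂ) (f : X ⟶ Y), dag (c • f) = star c • dag f
  dag_tensor : ∀ {X Y X' Y' : C} (f : X ⟶ Y) (g : X' ⟶ Y'), dag (f ⊗ₘ g) = dag f ⊗ₘ dag g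
  dag_associator : ∀ X Y Z : C, dag (α_ X Y Z).hom = (α_ X Y Z).inv
  dag_leftUnitor : ∀ X : C, dag (λ_ X).hom = (λ_ X).inv
  dag_rightUnitor : ∀ X : C, dag (ρ_ X).hom = (ρ_ X).inv
  /-- `f† f` is a positive element of the algebra of endomorphisms of the source of `f`. -/
  dag_pos : ∀ {X Y : C} (f : X ⟶ Y), ∃ g : X ⟶ X, f ≫ dag f = g ≫ dag g
  dag_definite : ∀ {X Y : C} (f : X ⟶ Y), f ≫ dag f = 0 → f = 0
  finite_hom : ∀ X Y : C, FiniteDimensional ℂ (X ⟶ Y)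
  simple_unit : Simple (𝟙_ C)
  semisimple : ∀ X : C, ∃ (n : ℕ) (S : Fin n → C) (b : Limits.Bicone S),
    (∀ k, Simple (S k)) ∧ Nonempty b.IsBilimit ∧ Nonempty (X ≅ b.pt)
  finitely_many_simples :
    ∃ (n : ℕ) (S : Fin n → C), ∀ Y : C, Simple Y → ∃ k, Nonempty (Y ≅ S k)
  rigid : ∀ X : C, ∃ Y : C, Nonempty (ExactPairing X Y)

open UnitaryFusionCategory

section Algebra

variable {C : Type u} [Category.{v} C] [Abelian C] [Linear ℂ C] [MonoidalCategory C]
  [MonoidalPreadditive C] [MonoidalLinear ℂ C] [UnitaryFusionCategory C]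

theorem exists_scalar (f : 𝟙_ C ⟶ 𝟙_ C) : ∃ c : ℂ, c • 𝟙 (𝟙_ C) = f :=
  haveI : Simple (𝟙_ C) := simple_unit
  haveI : FiniteDimensional ℂ (𝟙_ C ⟶ 𝟙_ C) := finite_hom _ _
  endomorphism_simple_eq_smul_id ℂ f

/-- The identification of the endomorphisms of the unit object with `ℂ`. -/
def scalar (f : 𝟙_ C ⟶ 𝟙_ C) : ℂ := Classical.choose (exists_scalar f)

/-- The Hilbert space structure on `hom(1, X)`: the inner product `⟨x, y⟩ = x† y`. -/
def homInner {X : C} (x y : 𝟙_ C ⟶ X) : ℂ := scalar (y ≫ dag x)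

/-- An orthonormal basis of the Hilbert space `hom(1, X)`. -/
structure HomONB (X : C) where
  n : ℕ
  vec : Fin n → (𝟙_ C ⟶ X)
  orthonormal : ∀ a b, homInner (vec a) (vec b) = if a = b then 1 else 0
  span_eq_top : Submodule.span ℂ (Set.range vec) = ⊤

variable (C) in
/-- The simple objects of the category, with their duals.

`Irr` labels representatives `obj true j` (written `j` or `j⁺`) of the simple objects, and
`obj false j` is the dual object `j⁻` of `j`; the duality is given by a standard solution
`R : 1 ⟶ j ⊗ j⁻`, `R' : 1 ⟶ j⁻ ⊗ j` of the conjugate equations (the evaluations are `R'†` and `R†`),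
normalised so that both circles have the same value, the quantum dimension.
`A true` is the orthogonal direct sum `A = ⨁ j`, and `A false` is its dual `A⁻ = ⨁ j⁻`. -/
structure SimpleObjects where
  Irr : Type
  [fintypeIrr : Fintype Irr]
  obj : Bool → Irr → C
  simple : ∀ j, Simple (obj true j)
  pairwise_not_iso : ∀ i j, Nonempty (obj true i ≅ obj true j) → i = j
  complete : ∀ Y : C, Simple Y → ∃ j, Nonempty (Y ≅ obj true j)
  R : ∀ j, 𝟙_ C ⟶ obj true j ⊗ obj false j
  R' : ∀ j, 𝟙_ C ⟶ obj false j ⊗ obj true j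
  conjugate : ∀ j, (λ_ (obj true j)).inv ≫ R j ▷ obj true j ≫ (α_ _ _ _).hom ≫
    obj true j ◁ dag (R' j) ≫ (ρ_ (obj true j)).hom = 𝟙 _
  conjugate' : ∀ j, (λ_ (obj false j)).inv ≫ R' j ▷ obj false j ≫ (α_ _ _ _).hom ≫
    obj false j ◁ dag (R j) ≫ (ρ_ (obj false j)).hom = 𝟙 _
  standard : ∀ j, R j ≫ dag (R j) = R' j ≫ dag (R' j)
  A : Bool → C
  incl : ∀ s j, obj s j ⟶ A s
  incl_isometry : ∀ s j, incl s j ≫ dag (incl s j) = 𝟙 _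
  incl_orthogonal : ∀ s i j, i ≠ j → incl s i ≫ dag (incl s j) = 0
  incl_total : ∀ s, ∑ j, dag (incl s j) ≫ incl s j = 𝟙 (A s)

attribute [instance] SimpleObjects.fintypeIrr

namespace SimpleObjects

variable (S : SimpleObjects C)

/-- The quantum dimension `d(j)`, the value of a circle labelled by `j`. -/
def dim (j : S.Irr) : ℝ := (scalar (S.R j ≫ dag (S.R j))).re

/-- The global dimension `μ = ∑ d(j)²`. -/
def globalDim : ℝ := ∑ j, S.dim j ^ 2

/-- The co-evaluation `1 ⟶ j^s ⊗ j^(-s)`. -/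
def cap : ∀ (s : Bool) (j : S.Irr), 𝟙_ C ⟶ S.obj s j ⊗ S.obj (!s) j
  | true, j => S.R j
  | false, j => S.R' j

/-- The co-evaluation `1 ⟶ j^(-s) ⊗ j^s`. -/
def cup : ∀ (s : Bool) (j : S.Irr), 𝟙_ C ⟶ S.obj (!s) j ⊗ S.obj s j
  | true, j => S.R' j
  | false, j => S.R j

/-- The co-evaluation `1 ⟶ A^s ⊗ A^(-s)`. -/
def capA (s : Bool) : 𝟙_ C ⟶ S.A s ⊗ S.A (!s) :=
  ∑ j, S.cap s j ≫ (S.incl s j ⊗ₘ S.incl (!s) j)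

/-- The co-evaluation `1 ⟶ A^(-s) ⊗ A^s`. -/
def cupA (s : Bool) : 𝟙_ C ⟶ S.A (!s) ⊗ S.A s :=
  ∑ j, S.cup s j ≫ (S.incl (!s) j ⊗ₘ S.incl s j)

/-- The modular conjugation (horizontal reflection)
`hom(j ⊗ X, X') → hom(X⁻ ⊗ j⁻, X'⁻)` for `X = i^(-s)`, `X' = i'^(-s)`: the transpose, through the
duality, of the adjoint of `y`. -/
def conjFusion {s : Bool} {j i i' : S.Irr} (y : S.obj true j ⊗ S.obj (!s) i ⟶ S.obj (!s) i') :
    S.obj s i ⊗ S.obj false j ⟶ S.obj s i' :=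
  (ρ_ (S.obj s i ⊗ S.obj false j)).inv ≫
  (S.obj s i ⊗ S.obj false j) ◁ S.cup s i' ≫
  (S.obj s i ⊗ S.obj false j) ◁ (dag y ▷ S.obj s i') ⊗≫
  S.obj s i ◁ dag (S.R' j) ▷ (S.obj (!s) i ⊗ S.obj s i') ⊗≫
  dag (S.cap s i) ▷ S.obj s i' ≫
  (λ_ (S.obj s i')).hom

/-- Orthonormal bases of the fusion spaces `hom(j ⊗ i^s, i'^s)`, for the inner product given by the
categorical trace. Thus `y_a y_b† = δ_ab d(i')⁻¹`, which is the normalisation in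
`1_j ⊗ 1_(i^s) = ∑_i' d(i') ∑_y y† y`. -/
structure FusionONB where
  N : S.Irr → S.Irr → S.Irr → Bool → ℕ
  y : ∀ {j i i' : S.Irr} {s : Bool}, Fin (N j i i' s) → (S.obj true j ⊗ S.obj s i ⟶ S.obj s i')
  orthonormal : ∀ {j i i' : S.Irr} {s : Bool} (a b : Fin (N j i i' s)),
    dag (y a) ≫ y b = (if a = b then ((S.dim i')⁻¹ : ℂ) else 0) • 𝟙 (S.obj s i')
  span_eq_top : ∀ j i i' s, Submodule.span ℂ (Set.range (y (j := j) (i := i) (i' := i') (s := s))) = ⊤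

/-! ### Operators on `hom(1, A^(s₁) ⊗ ⋯ ⊗ A^(sₙ))` -/

section Tens

variable {E : Type*}

/-- The object `A^(s₁) ⊗ (A^(s₂) ⊗ (⋯ ⊗ 1))` for a list of half-edges with signs `s₁, s₂, …`. -/
def tens : List (E × Bool) → C
  | [] => 𝟙_ C
  | h :: L => S.A h.2 ⊗ tens L

def tensSnoc : ∀ (L : List (E × Bool)) (h : E × Bool), S.tens (L ++ [h]) ≅ S.tens L ⊗ S.A h.2
  | [], h => ρ_ (S.A h.2) ≪≫ (λ_ (S.A h.2)).symm
  | g :: L, h => whiskerLeftIso (S.A g.2) (tensSnoc L h) ≪≫ (α_ (S.A g.2) (S.tens L) (S.A h.2)).symm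

/-- The projection of `A^(s₁) ⊗ ⋯ ⊗ A^(sₙ)` onto the summand on which the leg at a half-edge of `e`
is labelled by `l e`. -/
def projLegs (l : E → S.Irr) : ∀ L : List (E × Bool), S.tens L ⟶ S.tens L
  | [] => 𝟙 (𝟙_ C)
  | h :: L => (dag (S.incl h.2 (l h.1)) ≫ S.incl h.2 (l h.1)) ⊗ₘ projLegs l L

/-- One step of rotation of a list. -/
def rot : List (E × Bool) → List (E × Bool)
  | [] => []
  | g :: L => L ++ [g]

def rotN : ℕ → List (E × Bool) → List (E × Bool)
  | 0, L => L
  | k + 1, L => rotN k (rot L)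

/-- The rotation `ρ(x) = (∪ ⊗ 1)(1 ⊗ x ⊗ 1)∩`: the first leg is bent over the vertex and becomes the
last one. -/
def rho : ∀ L : List (E × Bool), (𝟙_ C ⟶ S.tens L) → (𝟙_ C ⟶ S.tens (rot L))
  | [], x => x
  | g :: L, x =>
    S.cupA g.2 ≫ S.A (!g.2) ◁ ((λ_ (S.A g.2)).inv ≫ x ▷ S.A g.2) ≫
      S.A (!g.2) ◁ (α_ (S.A g.2) (S.tens L) (S.A g.2)).hom ≫
      (α_ (S.A (!g.2)) (S.A g.2) (S.tens L ⊗ S.A g.2)).inv ≫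
      dag (S.cupA g.2) ▷ (S.tens L ⊗ S.A g.2) ≫ (λ_ (S.tens L ⊗ S.A g.2)).hom ≫
      (S.tensSnoc L g).inv

/-- The inverse rotation `ρ⁻¹`: the last leg is bent back over the vertex and becomes the first. -/
def rhoInv : ∀ L : List (E × Bool), (𝟙_ C ⟶ S.tens (rot L)) → (𝟙_ C ⟶ S.tens L)
  | [], x => x
  | g :: L, x =>
    S.capA g.2 ≫
      S.A g.2 ◁ ((λ_ (S.A (!g.2))).inv ≫ (x ≫ (S.tensSnoc L g).hom) ▷ S.A (!g.2)) ≫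
      S.A g.2 ◁ ((α_ (S.tens L) (S.A g.2) (S.A (!g.2))).hom ≫
        S.tens L ◁ dag (S.capA g.2) ≫ (ρ_ (S.tens L)).hom)

/-- `ρ^k`. -/
def rhoN : ∀ (k : ℕ) (L : List (E × Bool)), (𝟙_ C ⟶ S.tens L) → (𝟙_ C ⟶ S.tens (rotN k L))
  | 0, _, x => x
  | k + 1, L, x => rhoN k (rot L) (S.rho L x)

/-- `ρ^(-k)`. -/
def rhoInvN : ∀ (k : ℕ) (L : List (E × Bool)), (𝟙_ C ⟶ S.tens (rotN k L)) → (𝟙_ C ⟶ S.tens L)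
  | 0, _, x => x
  | k + 1, L, x => S.rhoInv L (rhoInvN k (rot L) x)

/-- `y ⊗ 1 : X ⊗ (A^(s₁) ⊗ ⋯) ⟶ A^(s₁) ⊗ ⋯`, with `y = Y h` for the first half-edge `h`. -/
def absorbFirst {X : C} (Y : ∀ h : E × Bool, X ⊗ S.A h.2 ⟶ S.A h.2) :
    ∀ L : List (E × Bool), X ⊗ S.tens L ⟶ S.tens L
  | [] => 0
  | h :: L => (α_ X (S.A h.2) (S.tens L)).inv ≫ Y h ▷ S.tens L

/-- `1 ⊗ z : (⋯ ⊗ A^(sₙ)) ⊗ X ⟶ ⋯ ⊗ A^(sₙ)`, with `z = Z g` for the last half-edge `g`. -/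
def absorbLast {X : C} (Z : ∀ g : E × Bool, S.A g.2 ⊗ X ⟶ S.A g.2) :
    ∀ L : List (E × Bool), S.tens L ⊗ X ⟶ S.tens L
  | [] => 0
  | [g] => (ρ_ (S.A g.2)).hom ▷ X ≫ Z g ≫ (ρ_ (S.A g.2)).inv
  | g :: g' :: L => (α_ (S.A g.2) (S.tens (g' :: L)) X).hom ≫ S.A g.2 ◁ absorbLast Z (g' :: L)

/-- `C_{y,z}(x) = (y ⊗ 1 ⊗ z)(1_j ⊗ x ⊗ 1_{j⁻}) ∩_j`, with `y = Y h`, `z = Z g` for the first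
half-edge `h` and the last half-edge `g` of the list (which has at least two elements whenever this
is used). -/
def fuse (j : S.Irr) (Y : ∀ h : E × Bool, S.obj true j ⊗ S.A h.2 ⟶ S.A h.2)
    (Z : ∀ g : E × Bool, S.A g.2 ⊗ S.obj false j ⟶ S.A g.2) (L : List (E × Bool))
    (x : 𝟙_ C ⟶ S.tens L) : 𝟙_ C ⟶ S.tens L :=
  S.R j ≫ S.obj true j ◁ ((λ_ (S.obj false j)).inv ≫ x ▷ S.obj false j) ≫
    S.obj true j ◁ S.absorbLast Z L ≫ S.absorbFirst Y L

/-- `ρ^(-k) C_{y,z} ρ^k`, where `k` is the position of the half-edge `h` in the list, so that `ρ^k`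
moves the leg at `h` to the first place. -/
def cornerOp [DecidableEq E] (j : S.Irr) (Y : ∀ h : E × Bool, S.obj true j ⊗ S.A h.2 ⟶ S.A h.2)
    (Z : ∀ g : E × Bool, S.A g.2 ⊗ S.obj false j ⟶ S.A g.2) (L : List (E × Bool)) (h : E × Bool)
    (x : 𝟙_ C ⟶ S.tens L) : 𝟙_ C ⟶ S.tens L :=
  S.rhoInvN (L.idxOf h) L (S.fuse j Y Z (rotN (L.idxOf h) L) (S.rhoN (L.idxOf h) L x))

end Tens

end SimpleObjects

end Algebra

/-! ## Graphs in closed oriented surfaces -/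

/-- An oriented graph (cellularly) embedded in a closed oriented surface, as a ribbon graph.
The half-edges of an edge `e` are `(e, true)`, at the source of `e`, and `(e, false)`, at the target;
so the Boolean is the sign `ε`. `base h` is the vertex at which `h` is attached, and `link v` lists
the half-edges at `v` anti-clockwise, starting from an arbitrary one (the order `κ_v`). -/
structure RibbonGraph (V E : Type*) where
  base : E × Bool → V
  link : V → List (E × Bool)
  nodup_link : ∀ v, (link v).Nodup
  mem_link : ∀ v h, h ∈ link v ↔ base h = v

/-- The other half of the same edge. -/
def opp {E : Type*} (h : E × Bool) : E × Bool := (h.1, !h.2)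

namespace RibbonGraph

variable {V E : Type*} (G : RibbonGraph V E)

open Classical in
/-- Clockwise walk around a plaquette: if `h` is the half-edge along which the walk leaves a vertex,
`G.next h` is the one along which it leaves the following vertex, that is, the anti-clockwise
successor of `opp h` around the vertex where `opp h` is attached. -/
def next (h : E × Bool) : E × Bool := (G.link (G.base (opp h))).formPerm (opp h)

open Classical in
/-- The plaquettes: each is given by the set of half-edges along which the clockwise walk around its
boundary leaves the vertices. -/
def plaquettes [Fintype E] : Finset (Finset (E × Bool)) :=
  Finset.univ.image fun h => Finset.univ.filter fun h' => ∃ n : ℕ, G.next^[n] h = h'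

/-- No plaquette is on both sides of an edge: the edges met in a walk around the boundary of a
plaquette are distinct. -/
def IsRegular [Fintype E] : Prop := ∀ p ∈ G.plaquettes, ∀ h ∈ p, opp h ∉ p

end RibbonGraph

/-! ## The Levin-Wen model on a closed surface -/

/-- Labels of the product basis of `(⨂_v H_v) ⊗ (⨂_e L²(I))`, if `H_v` has dimension `n v`. -/
structure Config {V : Type*} (n : V → ℕ) (E I : Type*) where
  vert : ∀ v, Fin (n v)
  edge : E → I

def Config.equiv {V : Type*} (n : V → ℕ) (E I : Type*) :
    Config n E I ≃ (∀ v, Fin (n v)) × (E → I) where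
  toFun c := (c.vert, c.edge)
  invFun c := ⟨c.1, c.2⟩
  left_inv _ := rfl
  right_inv _ := rfl

open Classical in
instance {V : Type*} [Fintype V] (n : V → ℕ) (E I : Type*) [Fintype E] [Fintype I] :
    Fintype (Config n E I) :=
  Fintype.ofEquiv _ (Config.equiv n E I).symm

instance {V : Type*} (n : V → ℕ) (E I : Type*) : DecidableEq (Config n E I) := Classical.decEq _

section Model

variable {C : Type u} [Category.{v} C] [Abelian C] [Linear ℂ C] [MonoidalCategory C]
  [MonoidalPreadditive C] [MonoidalLinear ℂ C] [UnitaryFusionCategory C]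
  (S : SimpleObjects C) {V E : Type*} [Fintype V] [Fintype E] (G : RibbonGraph V E)
  (β : ∀ v, HomONB (S.tens (G.link v)))

/-- The Hilbert space `(⨂_v H_v) ⊗ (⨂_e L²(Irr))`, `H_v = hom(1, A^(s₁) ⊗ ⋯ ⊗ A^(sₙ))`, written in
the product of the orthonormal bases `β v` of `H_v` and `δ_j` of `L²(Irr)`. -/
abbrev Space := EuclideanSpace ℂ (Config (fun v => (β v).n) E S.Irr)

open Classical in
/-- The vertex term `H_v = ∑_j⃗ P_{v,j⃗} ∏_k P_{κ_v(k), j_k}`, by its matrix elements: it is diagonal in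
the edge labels `l`, and acts on `H_v` by the projection onto the summand with these labels. -/
def vertexMatrix (v : V) :
    Matrix (Config (fun v => (β v).n) E S.Irr) (Config (fun v => (β v).n) E S.Irr) ℂ :=
  fun c' c =>
    if c'.edge = c.edge ∧ ∀ w, w ≠ v → c'.vert w = c.vert w then
      homInner ((β v).vec (c'.vert v)) ((β v).vec (c.vert v) ≫ S.projLegs c.edge (G.link v))
    else 0

section Plaquette

variable {S} (Φ : S.FusionONB) (p : Finset (E × Bool)) (j : S.Irr) (l l' : E → S.Irr)
  (a : ∀ h : {h : E × Bool // h ∈ p}, Fin (Φ.N j (l h.1.1) (l' h.1.1) h.1.2))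

open Classical in
/-- The basis vector `y_h` of `hom(j ⊗ j_h^ε, j'_h^ε)` chosen by `a` for the half-edge `h` of `p`,
extended by zero to `hom(j ⊗ A^ε, A^ε)`. -/
def leftFusion (h : E × Bool) : S.obj true j ⊗ S.A h.2 ⟶ S.A h.2 :=
  if hp : h ∈ p then
    S.obj true j ◁ dag (S.incl h.2 (l h.1)) ≫ Φ.y (a ⟨h, hp⟩) ≫ S.incl h.2 (l' h.1)
  else 0

open Classical in
/-- The reflected vector `θ(y_h)` at the other end `g = opp h` of the same edge, extended by zero to
`hom(A^ε ⊗ j⁻, A^ε)`. -/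
def rightFusion (g : E × Bool) : S.A g.2 ⊗ S.obj false j ⟶ S.A g.2 :=
  if hp : opp g ∈ p then
    dag (S.incl g.2 (l g.1)) ▷ S.obj false j ≫ S.conjFusion (Φ.y (a ⟨opp g, hp⟩)) ≫
      S.incl g.2 (l' g.1)
  else 0

open Classical in
/-- The action on `H_v`: the product of the operators `ρ^(1-κ⁻¹(h)) C_{y_h, θ(y_g)} ρ^(κ⁻¹(h)-1)`
over the half-edges `h` at `v` along which the walk around `p` leaves `v` (`g` being the half-edge of
the walk that precedes `h`). It is the identity if `v` is not on the boundary of `p`. -/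
def plaquetteVertexOp (v : V) (x : 𝟙_ C ⟶ S.tens (G.link v)) : 𝟙_ C ⟶ S.tens (G.link v) :=
  (G.link v).foldr
    (fun h x => if h ∈ p then
      S.cornerOp j (leftFusion Φ p j l l' a) (rightFusion Φ p j l l' a) (G.link v) h x else x) x

end Plaquette

variable {S} (Φ : S.FusionONB)

open Classical in
/-- The plaquette operator `H_{p,j}`, contraction of a loop labelled by `j` with the boundary of `p`,
by its matrix elements. It takes the label `l e` of a boundary edge to `l' e`, with weight
`d(l e)^s d(l' e)^t`, leaves the other edge labels unchanged, and acts on the vertices by the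
`C_{y,z}`, summed over the bases of the fusion spaces `hom(j ⊗ (l e)^ε, (l' e)^ε)`. -/
def loopMatrix (s t : ℝ) (p : Finset (E × Bool)) (j : S.Irr) :
    Matrix (Config (fun v => (β v).n) E S.Irr) (Config (fun v => (β v).n) E S.Irr) ℂ :=
  fun c' c =>
    if ∀ e, (e, true) ∉ p → (e, false) ∉ p → c'.edge e = c.edge e then
      ((∏ h ∈ p, S.dim (c.edge h.1) ^ s * S.dim (c'.edge h.1) ^ t : ℝ) : ℂ) *
      ∑ a : ∀ h : {h : E × Bool // h ∈ p}, Fin (Φ.N j (c.edge h.1.1) (c'.edge h.1.1) h.1.2),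
        ∏ v, homInner ((β v).vec (c'.vert v))
          (plaquetteVertexOp G Φ p j c.edge c'.edge a v ((β v).vec (c.vert v)))
    else 0

/-- The plaquette term `H_p = ∑_j (d(j)^r / μ) H_{p,j}`. -/
def plaquetteMatrix (r s t : ℝ) (p : Finset (E × Bool)) :
    Matrix (Config (fun v => (β v).n) E S.Irr) (Config (fun v => (β v).n) E S.Irr) ℂ :=
  ∑ j, ((S.dim j ^ r / S.globalDim : ℝ) : ℂ) • loopMatrix G β Φ s t p j

open Classical in
/-- The Levin-Wen Hamiltonian `λ_P ∑_p (1 - H_p) + λ_V ∑_v (1 - H_v)`. -/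
def hamiltonian (r s t lamP lamV : ℝ) : Space S G β →L[ℂ] Space S G β :=
  Matrix.toEuclideanCLM (𝕜 := ℂ)
    ((lamP : ℂ) • ∑ p ∈ G.plaquettes, (1 - plaquetteMatrix G β Φ r s t p) +
      (lamV : ℂ) • ∑ v, (1 - vertexMatrix S G β v))

end Model

/-! ## Reflection-symmetric graphs -/

/-- The part of a reflection-symmetric graph in `M₊`: `V` are its vertices, `E₀` the edges that end on
the boundary of `M₊` (that is, cross the mirror), `E₁` the other edges.
Its half-edges are the `inl e`, one for each `e : E₀`, and the `inr (e, true)`, `inr (e, false)`, at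
the source and the target of `e : E₁`. An edge `e : E₀` has its source in `M₊` if `dir e = true`,
and its target in `M₊` if `dir e = false`. -/
structure HalfGraph (V E₀ E₁ : Type*) where
  base : E₀ ⊕ E₁ × Bool → V
  link : V → List (E₀ ⊕ E₁ × Bool)
  nodup_link : ∀ v, (link v).Nodup
  mem_link : ∀ v d, d ∈ link v ↔ base d = v
  dir : E₀ → Bool

namespace HalfGraph

variable {V E₀ E₁ : Type*} (Γ : HalfGraph V E₀ E₁)

/-- The sign `ε` of a half-edge in `M₊`. -/
def sgn : E₀ ⊕ E₁ × Bool → Bool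
  | .inl e => Γ.dir e
  | .inr (_, s) => s

/-- A half-edge in `M₊`, as a half-edge of the doubled graph. The edges of the doubled graph are the
`inl e` for `e : E₀`, and two copies `inr (e, true)` in `M₊`, `inr (e, false)` in `M₋` of `e : E₁`. -/
def up : E₀ ⊕ E₁ × Bool → (E₀ ⊕ E₁ × Bool) × Bool :=
  fun d => (d.map id (fun q => (q.1, true)), Γ.sgn d)

/-- The mirror image in `M₋` of a half-edge in `M₊`; the reflection reverses the orientation. -/
def down : E₀ ⊕ E₁ × Bool → (E₀ ⊕ E₁ × Bool) × Bool :=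
  fun d => (d.map id (fun q => (q.1, false)), !Γ.sgn d)

def upList : List (E₀ ⊕ E₁ × Bool) → List ((E₀ ⊕ E₁ × Bool) × Bool)
  | [] => []
  | d :: L => Γ.up d :: upList L

/-- The mirror image of a list; the reflection turns anti-clockwise into clockwise. -/
def downList : List (E₀ ⊕ E₁ × Bool) → List ((E₀ ⊕ E₁ × Bool) × Bool)
  | [] => []
  | d :: L => downList L ++ [Γ.down d]

def doubleBase : (E₀ ⊕ E₁ × Bool) × Bool → V × Bool
  | (.inl e, s) => (Γ.base (.inl e), s == Γ.dir e)
  | (.inr (e, true), s) => (Γ.base (.inr (e, s)), true)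
  | (.inr (e, false), s) => (Γ.base (.inr (e, !s)), false)

def doubleLink : V × Bool → List ((E₀ ⊕ E₁ × Bool) × Bool)
  | (v, true) => Γ.upList (Γ.link v)
  | (v, false) => Γ.downList (Γ.link v)


theorem mem_upList (L : List (E₀ ⊕ E₁ × Bool)) (h : (E₀ ⊕ E₁ × Bool) × Bool) :
    h ∈ Γ.upList L ↔ ∃ d ∈ L, Γ.up d = h := by
  induction L with
  | nil => simp [upList]
  | cons d L ih => simp [upList, ih, eq_comm]

theorem mem_downList (L : List (E₀ ⊕ E₁ × Bool)) (h : (E₀ ⊕ E₁ × Bool) × Bool) :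
    h ∈ Γ.downList L ↔ ∃ d ∈ L, Γ.down d = h := by
  induction L with
  | nil => simp [downList]
  | cons d L ih => simp [downList, ih, eq_comm, or_comm]

theorem up_injective : Function.Injective Γ.up := by
  rintro (e | ⟨e, s⟩) (e' | ⟨e', s'⟩) h <;> simp_all [up, sgn]

theorem down_injective : Function.Injective Γ.down := by
  rintro (e | ⟨e, s⟩) (e' | ⟨e', s'⟩) h <;> simp_all [down, sgn]

theorem nodup_upList {L : List (E₀ ⊕ E₁ × Bool)} (h : L.Nodup) : (Γ.upList L).Nodup := by
  induction L with
  | nil => simp [upList]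
  | cons d L ih =>
    rw [List.nodup_cons] at h
    refine List.nodup_cons.2 ⟨fun hd => ?_, ih h.2⟩
    obtain ⟨d', hd', he⟩ := (Γ.mem_upList L _).1 hd
    exact h.1 (Γ.up_injective he ▸ hd')

theorem nodup_downList {L : List (E₀ ⊕ E₁ × Bool)} (h : L.Nodup) : (Γ.downList L).Nodup := by
  induction L with
  | nil => simp [downList]
  | cons d L ih =>
    rw [List.nodup_cons] at h
    refine List.nodup_append.2 ⟨ih h.2, by simp, ?_⟩
    intro x hx y hy hxy
    obtain ⟨d', hd', he⟩ := (Γ.mem_downList L _).1 hx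
    have : Γ.down d' = Γ.down d := by rw [he, hxy]; simpa using hy
    exact h.1 (Γ.down_injective this ▸ hd')

/-- The doubled graph `Γ = Γ₊ ∪ θ(Γ₊)`. Its vertices are the `(v, true)` in `M₊` and their mirror
images `(v, false)` in `M₋`. -/
def double : RibbonGraph (V × Bool) (E₀ ⊕ E₁ × Bool) where
  base := Γ.doubleBase
  link := Γ.doubleLink
  nodup_link := by
    rintro ⟨v, _ | _⟩
    · exact Γ.nodup_downList (Γ.nodup_link v)
    · exact Γ.nodup_upList (Γ.nodup_link v)
  mem_link := by
    rintro ⟨v, _ | _⟩ h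
    · refine (Γ.mem_downList _ _).trans ?_
      simp only [Γ.mem_link]
      rcases h with ⟨e | ⟨e, _ | _⟩, s⟩
      · simp [down, sgn, doubleBase]
        cases Γ.dir e <;> cases s <;> simp
      · simp [down, sgn, doubleBase]
      · simp [down, sgn, doubleBase]
    · refine (Γ.mem_upList _ _).trans ?_
      simp only [Γ.mem_link]
      rcases h with ⟨e | ⟨e, _ | _⟩, s⟩
      · simp [up, sgn, doubleBase]
        cases Γ.dir e <;> cases s <;> simp
      · simp [up, sgn, doubleBase]
      · simp [up, sgn, doubleBase]

end HalfGraph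

/-! ## The reflection -/

section Reflection

variable {C : Type u} [Category.{v} C] [Abelian C] [Linear ℂ C] [MonoidalCategory C]
  [MonoidalPreadditive C] [MonoidalLinear ℂ C] [UnitaryFusionCategory C]
  (S : SimpleObjects C) {V E₀ E₁ : Type*} (Γ : HalfGraph V E₀ E₁)

/-- The co-evaluation `1 ⟶ X ⊗ X⁻` for `X = A^(s₁) ⊗ ⋯ ⊗ A^(sₙ)`, `X⁻ = A^(-sₙ) ⊗ ⋯ ⊗ A^(-s₁)`. -/
def mirrorCap : ∀ L : List (E₀ ⊕ E₁ × Bool),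
    𝟙_ C ⟶ S.tens (Γ.upList L) ⊗ S.tens (Γ.downList L)
  | [] => (λ_ (𝟙_ C)).inv
  | d :: L =>
    S.capA (Γ.sgn d) ≫
      S.A (Γ.sgn d) ◁ ((λ_ (S.A (!Γ.sgn d))).inv ≫ mirrorCap L ▷ S.A (!Γ.sgn d) ≫
        (α_ (S.tens (Γ.upList L)) (S.tens (Γ.downList L)) (S.A (!Γ.sgn d))).hom ≫
        S.tens (Γ.upList L) ◁ (S.tensSnoc (Γ.downList L) (Γ.down d)).inv) ≫
      (α_ (S.A (Γ.sgn d)) (S.tens (Γ.upList L)) (S.tens (Γ.downList L ++ [Γ.down d]))).inv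

/-- The modular conjugation (horizontal reflection) `hom(1, X) → hom(1, X⁻)` at the legs of a
vertex: the transpose, through the duality, of the adjoint of `x`. -/
def conjVertex (L : List (E₀ ⊕ E₁ × Bool)) (x : 𝟙_ C ⟶ S.tens (Γ.upList L)) :
    𝟙_ C ⟶ S.tens (Γ.downList L) :=
  mirrorCap S Γ L ≫ dag x ▷ S.tens (Γ.downList L) ≫ (λ_ (S.tens (Γ.downList L))).hom

variable [Fintype V] [Fintype E₀] [Fintype E₁] (β : ∀ v, HomONB (S.tens (Γ.double.link v)))

/-- The Hilbert space `𝓗_s` of the half of the graph in `M₊` (`s = true`) or in `M₋` (`s = false`),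
written in the same bases as `𝓗`. The edges crossing the mirror belong to both halves. The edge set
of each half is identified with `E₀ ⊕ E₁`. -/
abbrev HalfSpace (s : Bool) :=
  EuclideanSpace ℂ (Config (fun v : V => (β (v, s)).n) (E₀ ⊕ E₁) S.Irr)

/-- The restriction of a basis label of `𝓗` to one half. -/
def restrictConfig (s : Bool) (c : Config (fun v => (β v).n) (E₀ ⊕ E₁ × Bool) S.Irr) :
    Config (fun v : V => (β (v, s)).n) (E₀ ⊕ E₁) S.Irr :=
  ⟨fun v => c.vert (v, s), fun e => c.edge (e.map id (fun q => (q, s)))⟩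

open Classical in
/-- The embedding `ι : 𝓗 → 𝓗₋ ⊠ 𝓗₊`, the linear extension of its values on the product basis. -/
def iota : Space S Γ.double β →ₗ[ℂ] HalfSpace S Γ β false ⊗[ℂ] HalfSpace S Γ β true :=
  (EuclideanSpace.basisFun (Config (fun v => (β v).n) (E₀ ⊕ E₁ × Bool) S.Irr) ℂ).toBasis.constr ℂ
    fun c => EuclideanSpace.single (restrictConfig S Γ β false c) (1 : ℂ) ⊗ₜ[ℂ]
      EuclideanSpace.single (restrictConfig S Γ β true c) (1 : ℂ)

open Classical in
/-- The reflection `θ : 𝓗₊ → 𝓗₋`, the antilinear extension of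
`(⨂_v β_v) ⊗ (⨂_e δ_(l e)) ↦ (⨂_v θ(β_v)) ⊗ (⨂_e δ_(l e))`. -/
def reflection (h : HalfSpace S Γ β true) : HalfSpace S Γ β false :=
  WithLp.toLp 2 fun c' => ∑ b : ∀ v, Fin (β (v, true)).n, star (h ⟨b, c'.edge⟩) *
    ∏ v, homInner ((β (v, false)).vec (c'.vert v))
      (conjVertex S Γ (Γ.link v) ((β (v, true)).vec (b v)))

end Reflection

end LevinWen

end

/-! Fix the labels `i` of the edges that cross the mirror. A vector of the Hilbert space then
becomes a family of matrices `F_i`, with rows indexed by the left half and columns by the right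
half, and the reflection becomes complex conjugation followed by an isometry `Θ` (`sideReflection`).
Let `K` be the cone of all `F` with `F_i = Θ P_i`, `P_i` positive semidefinite (`reflectionCone`).
The vectors `ι*(θ(h) ⊠ h)` lie in `K`, with `P_i` of rank at most one (`iota_adjoint_mem`). Since
`Θ` is an isometry, two members of `K` have inner product `∑ tr(P_i Q_i) ≥ 0`. It thus suffices that
the semigroup preserves `K`.

Up to a constant, `-H` is `T = T₀ + B' ⊗ 1 + 1 ⊗ B`, where `T₀` collects the plaquettes that cross
the mirror and `B'`, `B` collect the terms on either side. The matrix of a crossing plaquette is a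
nonnegative weight times a sum of products `Q' ⊗ Q` with `Q' Θ = Θ Q̄`, so it sends `Θ P` to a
nonnegative combination of `Θ Q̄ P Qᵀ` and preserves `K`. The one-sided part need not preserve `K`,
but `T + c + c⁻¹ B' ⊗ B = T₀ + c⁻¹ (c + B') ⊗ (c + B)` does for every `c > 0`. Exponentiating and
letting `c → ∞` gives the claim, as `K` is closed (`exp_toEuclideanCLM_mem_reflectionCone`). The
exponents `r, s, t` enter only through real powers of the dimensions, which stay nonnegative.

There remain the isometry of `Θ` and the relations `Q' Θ = Θ Q̄`. The first is antiunitarity of the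
modular conjugation, which follows from the equality of left and right traces by a norm estimate
(`homInner_conj`). For the second, `IsConj` is a calculus that computes conjugates of diagrams piece
by piece. A corner operator `ρ^(-k) C ρ^k` with `k ≥ 1` turns out to be an insertion of `R'_j`
between two neighbouring legs (`rhoInvN_fuse_rhoN`), whose mirror image is again an insertion; the
corner `k = 0` is mirrored to itself (`conjVertex_fuse`).

On the side of the graph, the reflection inverts the walk around plaquettes. It therefore fixes
every plaquette that crosses the mirror and exchanges the others between the two sides. Regularity
prevents two corners of a plaquette from being neighbours at a vertex, so that their operators
commute and the reversal of their order by the reflection does no harm (`loopOp_perm`). -/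

noncomputable section

namespace LevinWen

universe v u

open UnitaryFusionCategory

/-! ### The adjoint and the Hilbert spaces `hom(1, X)` -/

section Dagger

variable {C : Type u} [Category.{v} C] [Abelian C] [Linear ℂ C] [MonoidalCategory C]
  [MonoidalPreadditive C] [MonoidalLinear ℂ C] [UnitaryFusionCategory C]

attribute [simp] dag_dag dag_comp dag_add dag_smul dag_tensor dag_associator dag_leftUnitor
  dag_rightUnitor

@[simp] theorem dag_id (X : C) : dag (𝟙 X) = 𝟙 X := by
  have h := dag_comp (dag (𝟙 X)) (𝟙 X)
  simpa using h.symm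

@[simp] theorem dag_zero (X Y : C) : dag (0 : X ⟶ Y) = 0 := by
  simpa using dag_smul (0 : ℂ) (0 : X ⟶ Y)

@[simp] theorem dag_sum {ι : Type*} (s : Finset ι) {X Y : C} (f : ι → (X ⟶ Y)) :
    dag (∑ i ∈ s, f i) = ∑ i ∈ s, dag (f i) := by
  classical
  induction s using Finset.induction_on with
  | empty => simp
  | insert a s ha ih => rw [Finset.sum_insert ha, dag_add, ih, Finset.sum_insert ha]

@[simp] theorem dag_associator_inv (X Y Z : C) : dag (α_ X Y Z).inv = (α_ X Y Z).hom := by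
  rw [← dag_associator, dag_dag]

@[simp] theorem dag_leftUnitor_inv (X : C) : dag (λ_ X).inv = (λ_ X).hom := by
  rw [← dag_leftUnitor, dag_dag]

@[simp] theorem dag_whiskerLeft (X : C) {Y Z : C} (f : Y ⟶ Z) : dag (X ◁ f) = X ◁ dag f := by
  rw [← id_tensorHom, dag_tensor, dag_id, id_tensorHom]

@[simp] theorem dag_whiskerRight {Y Z : C} (f : Y ⟶ Z) (X : C) : dag (f ▷ X) = dag f ▷ X := by
  rw [← tensorHom_id, dag_tensor, dag_id, tensorHom_id]

theorem scalar_smul_id (f : 𝟙_ C ⟶ 𝟙_ C) : scalar f • 𝟙 (𝟙_ C) = f :=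
  Classical.choose_spec (exists_scalar f)

theorem id_unit_ne_zero : 𝟙 (𝟙_ C) ≠ 0 :=
  haveI : Simple (𝟙_ C) := simple_unit
  id_nonzero (𝟙_ C)

theorem scalar_eq {f : 𝟙_ C ⟶ 𝟙_ C} {c : ℂ} (h : f = c • 𝟙 (𝟙_ C)) : scalar f = c :=
  smul_left_injective ℂ id_unit_ne_zero ((scalar_smul_id f).trans h)

theorem scalar_injective : Function.Injective (scalar : (𝟙_ C ⟶ 𝟙_ C) → ℂ) := fun f g h => by
  rw [← scalar_smul_id f, h, scalar_smul_id]

@[simp] theorem scalar_smul (c : ℂ) (f : 𝟙_ C ⟶ 𝟙_ C) : scalar (c • f) = c * scalar f :=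
  scalar_eq (by rw [mul_smul, scalar_smul_id])

@[simp] theorem scalar_add (f g : 𝟙_ C ⟶ 𝟙_ C) : scalar (f + g) = scalar f + scalar g :=
  scalar_eq (by rw [add_smul, scalar_smul_id, scalar_smul_id])

@[simp] theorem scalar_zero : scalar (0 : 𝟙_ C ⟶ 𝟙_ C) = 0 := scalar_eq (zero_smul _ _).symm

@[simp] theorem scalar_dag (f : 𝟙_ C ⟶ 𝟙_ C) : scalar (dag f) = star (scalar f) :=
  scalar_eq (by conv_lhs => rw [← scalar_smul_id f, dag_smul, dag_id])

theorem homInner_add_right {X : C} (x y z : 𝟙_ C ⟶ X) :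
    homInner x (y + z) = homInner x y + homInner x z := by
  simp [homInner]

theorem homInner_smul_right {X : C} (c : ℂ) (x y : 𝟙_ C ⟶ X) :
    homInner x (c • y) = c * homInner x y := by
  simp [homInner]

theorem homInner_zero_right {X : C} (x : 𝟙_ C ⟶ X) : homInner x 0 = 0 := by
  simp [homInner]

theorem homInner_symm {X : C} (x y : 𝟙_ C ⟶ X) : star (homInner x y) = homInner y x := by
  rw [homInner, homInner, ← scalar_dag, dag_comp, dag_dag]

theorem homInner_sum_right {ι : Type*} (s : Finset ι) {X : C} (x : 𝟙_ C ⟶ X)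
    (y : ι → (𝟙_ C ⟶ X)) : homInner x (∑ i ∈ s, y i) = ∑ i ∈ s, homInner x (y i) := by
  classical
  induction s using Finset.induction_on with
  | empty => simp [homInner_zero_right]
  | insert a s ha ih => rw [Finset.sum_insert ha, homInner_add_right, ih, Finset.sum_insert ha]

theorem homInner_sub_right {X : C} (x y z : 𝟙_ C ⟶ X) :
    homInner x (y - z) = homInner x y - homInner x z := by
  rw [eq_sub_iff_add_eq, ← homInner_add_right, sub_add_cancel]

theorem homInner_sub_left {X : C} (x y z : 𝟙_ C ⟶ X) :
    homInner (x - y) z = homInner x z - homInner y z := by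
  rw [← homInner_symm, homInner_sub_right, star_sub, homInner_symm, homInner_symm]

/-- By `dag_pos`, `x† x` equals `g† g` for an endomorphism `g` of the unit, and such a `g` is a
number. -/
theorem scalar_comp_dag_nonneg {X : C} (x : 𝟙_ C ⟶ X) : 0 ≤ scalar (x ≫ dag x) := by
  obtain ⟨g, hg⟩ := dag_pos x
  have : g ≫ dag g = (star (scalar g) * scalar g) • 𝟙 (𝟙_ C) := by
    conv_lhs => rw [← scalar_smul_id g]
    simp [smul_smul, mul_comm]
  rw [hg, scalar_eq this]
  exact star_mul_self_nonneg _

theorem homInner_self_nonneg {X : C} (x : 𝟙_ C ⟶ X) : 0 ≤ homInner x x :=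
  scalar_comp_dag_nonneg x

theorem eq_zero_of_homInner_self {X : C} {x : 𝟙_ C ⟶ X} (h : homInner x x = 0) : x = 0 :=
  dag_definite x (scalar_injective (h.trans scalar_zero.symm))

namespace HomONB

variable {X : C} (B : HomONB X)

/-- Expansion in an orthonormal basis. -/
theorem sum_homInner_smul (x : 𝟙_ C ⟶ X) : ∑ a, homInner (B.vec a) x • B.vec a = x := by
  have hx : x ∈ Submodule.span ℂ (Set.range B.vec) := by rw [B.span_eq_top]; trivial
  induction hx using Submodule.span_induction with
  | mem x hx =>
    obtain ⟨b, rfl⟩ := hx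
    simp [B.orthonormal]
  | zero => simp [homInner_zero_right]
  | add x y _ _ hx hy =>
    simp only [homInner_add_right, add_smul, Finset.sum_add_distrib, hx, hy]
  | smul c x _ hx =>
    simp only [homInner_smul_right, mul_smul, ← Finset.smul_sum, hx]

theorem sum_homInner_mul (x y : 𝟙_ C ⟶ X) :
    ∑ a, homInner x (B.vec a) * homInner (B.vec a) y = homInner x y := by
  conv_rhs => rw [← B.sum_homInner_smul y, homInner_sum_right]
  simp only [homInner_smul_right, mul_comm]

end HomONB

end Dagger

end LevinWen

end

noncomputable section

namespace LevinWen

universe v u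

open UnitaryFusionCategory

/-! ### Modular conjugation and its antiunitarity -/

section Duality

variable {C : Type u} [Category.{v} C] [Abelian C] [Linear ℂ C] [MonoidalCategory C]
  [MonoidalPreadditive C] [MonoidalLinear ℂ C] [UnitaryFusionCategory C]

/-- A standard solution `cap : 1 ⟶ X ⊗ Y`, `cup : 1 ⟶ Y ⊗ X` of the conjugate equations: left and
right traces agree on the endomorphisms of `X` and of `Y`. -/
structure DualPair (X Y : C) where
  cap : 𝟙_ C ⟶ X ⊗ Y
  cup : 𝟙_ C ⟶ Y ⊗ X
  zig : (λ_ X).inv ≫ cap ▷ X ≫ (α_ X Y X).hom ≫ X ◁ dag cup ≫ (ρ_ X).hom = 𝟙 X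
  zag : (λ_ Y).inv ≫ cup ▷ Y ≫ (α_ Y X Y).hom ≫ Y ◁ dag cap ≫ (ρ_ Y).hom = 𝟙 Y
  balanced : ∀ f : X ⟶ X, cap ≫ f ▷ Y ≫ dag cap = cup ≫ Y ◁ f ≫ dag cup
  balanced' : ∀ f : Y ⟶ Y, cup ≫ f ▷ X ≫ dag cup = cap ≫ X ◁ f ≫ dag cap

namespace DualPair

variable {X Y : C} (D : DualPair X Y)

theorem zig_dag : (ρ_ X).inv ≫ X ◁ D.cup ≫ (α_ X Y X).inv ≫ dag D.cap ▷ X ≫ (λ_ X).hom = 𝟙 X := by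
  have h := congrArg dag D.zig
  simpa using h

@[simps]
def swap : DualPair Y X where
  cap := D.cup
  cup := D.cap
  zig := D.zag
  zag := D.zig
  balanced := D.balanced'
  balanced' := D.balanced

/-- The modular conjugation `hom(1, X) → hom(1, Y)`. -/
def conj (x : 𝟙_ C ⟶ X) : 𝟙_ C ⟶ Y := D.cap ≫ dag x ▷ Y ≫ (λ_ Y).hom

/-- The modular conjugation with the dual on the left. -/
def conjLeft (x : 𝟙_ C ⟶ X) : 𝟙_ C ⟶ Y := D.cup ≫ Y ◁ dag x ≫ (ρ_ Y).hom

/-- Once `x` has been slid past the cup, the remaining strand is straightened by the adjoint of a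
conjugate equation. -/
theorem conj_conj (x : 𝟙_ C ⟶ X) : D.swap.conj (D.conj x) = x := by
  calc D.swap.conj (D.conj x)
    _ = 𝟙 _ ⊗≫ (𝟙_ C ◁ D.cup ≫ x ▷ (Y ⊗ X)) ⊗≫ dag D.cap ▷ X ⊗≫ 𝟙 _ := by
      simp only [conj, dag_comp, dag_dag, dag_whiskerRight, dag_leftUnitor, swap_cap]; monoidal
    _ = 𝟙 _ ⊗≫ (x ▷ 𝟙_ C ≫ X ◁ D.cup) ⊗≫ dag D.cap ▷ X ⊗≫ 𝟙 _ := by rw [whisker_exchange]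
    _ = x ≫ ((ρ_ X).inv ≫ X ◁ D.cup ≫ (α_ X Y X).inv ≫ dag D.cap ▷ X ≫ (λ_ X).hom) := by monoidal
    _ = x := by rw [D.zig_dag, Category.comp_id]

/-- Both sides evaluate the same closed diagram, `w` next to `x` under `dag cup`. Thus `conjLeft` is
the antilinear adjoint of the conjugation in the other direction. -/
theorem homInner_conjLeft (x : 𝟙_ C ⟶ X) (w : 𝟙_ C ⟶ Y) :
    homInner (D.conjLeft x) w = homInner (D.swap.conj w) x := by
  rw [homInner, homInner]
  congr 1
  calc w ≫ dag (D.conjLeft x)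
    _ = 𝟙 _ ⊗≫ (w ▷ 𝟙_ C ≫ Y ◁ x) ⊗≫ dag D.cup := by
      simp only [conjLeft, dag_comp, dag_dag, dag_whiskerLeft, dag_rightUnitor]; monoidal
    _ = 𝟙 _ ⊗≫ (𝟙_ C ◁ x ≫ w ▷ X) ⊗≫ dag D.cup := by rw [whisker_exchange]
    _ = x ≫ dag (D.swap.conj w) := by
      simp only [conj, dag_comp, dag_dag, dag_whiskerRight, dag_leftUnitor, swap_cap]; monoidal

/-- The two norms are the right and the left trace of the endomorphism `x x†` of `X`. -/
theorem homInner_conj_self (x : 𝟙_ C ⟶ X) :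
    homInner (D.conj x) (D.conj x) = homInner (D.conjLeft x) (D.conjLeft x) := by
  rw [homInner, homInner]
  congr 1
  have h := D.balanced (dag x ≫ x)
  simp only [conj, conjLeft, dag_comp, dag_dag, dag_whiskerRight, dag_leftUnitor, dag_whiskerLeft,
    dag_rightUnitor, comp_whiskerRight, whiskerLeft_comp, Category.assoc] at h ⊢
  simpa using h

/-- By adjointness and `conj_conj`, both cross terms are `⟨x, x⟩`, while the two squares coincide by
balancedness. -/
theorem conj_sub_conjLeft (x : 𝟙_ C ⟶ X) :
    homInner (D.conj x - D.conjLeft x) (D.conj x - D.conjLeft x) =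
      2 * (homInner (D.conj x) (D.conj x) - homInner x x) := by
  have h1 : homInner (D.conjLeft x) (D.conj x) = homInner x x := by
    rw [homInner_conjLeft, conj_conj]
  have h2 : homInner (D.conj x) (D.conjLeft x) = homInner x x := by
    rw [← homInner_symm, h1, homInner_symm]
  rw [homInner_sub_left, homInner_sub_right, homInner_sub_right, h1, h2, ← homInner_conj_self]
  ring

theorem homInner_self_le_conj (x : 𝟙_ C ⟶ X) : homInner x x ≤ homInner (D.conj x) (D.conj x) := by
  have h := homInner_self_nonneg (D.conj x - D.conjLeft x)
  rw [conj_sub_conjLeft] at h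
  have h2 : (0 : ℂ) ≤ 2⁻¹ := by
    rw [Complex.le_def]; norm_num
  have := mul_nonneg h2 h
  rw [← mul_assoc, inv_mul_cancel₀ two_ne_zero, one_mul] at this
  exact sub_nonneg.1 this

/-- The conjugations in the two directions are inverse to each other and neither decreases the norm,
so both preserve it. -/
theorem homInner_conj_self_eq (x : 𝟙_ C ⟶ X) :
    homInner (D.conj x) (D.conj x) = homInner x x := by
  refine le_antisymm ?_ (D.homInner_self_le_conj x)
  simpa only [conj_conj] using D.swap.homInner_self_le_conj (D.conj x)

/-- Full rotation is trivial. -/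
theorem conj_eq_conjLeft (x : 𝟙_ C ⟶ X) : D.conj x = D.conjLeft x := by
  refine sub_eq_zero.1 (eq_zero_of_homInner_self ?_)
  rw [conj_sub_conjLeft, homInner_conj_self_eq, sub_self, mul_zero]

/-- The modular conjugation is antiunitary. -/
theorem homInner_conj (x y : 𝟙_ C ⟶ X) : homInner (D.conj x) (D.conj y) = homInner y x := by
  rw [conj_eq_conjLeft, homInner_conjLeft, conj_conj]

end DualPair

end Duality

end LevinWen

end

noncomputable section

namespace LevinWen

universe v u

open UnitaryFusionCategory

/-! ### Dualities of tensor products, unitarily isomorphic objects and direct sums -/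

section Constructions

variable {C : Type u} [Category.{v} C] [Abelian C] [Linear ℂ C] [MonoidalCategory C]
  [MonoidalPreadditive C] [MonoidalLinear ℂ C] [UnitaryFusionCategory C]

namespace DualPair

/-- The equality of left and right traces on `End X` implies that on `End Y`. -/
def ofBalanced {X Y : C} (cap : 𝟙_ C ⟶ X ⊗ Y) (cup : 𝟙_ C ⟶ Y ⊗ X)
    (zig : (λ_ X).inv ≫ cap ▷ X ≫ (α_ X Y X).hom ≫ X ◁ dag cup ≫ (ρ_ X).hom = 𝟙 X)
    (zag : (λ_ Y).inv ≫ cup ▷ Y ≫ (α_ Y X Y).hom ≫ Y ◁ dag cap ≫ (ρ_ Y).hom = 𝟙 Y)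
    (balanced : ∀ f : X ⟶ X, cap ≫ f ▷ Y ≫ dag cap = cup ≫ Y ◁ f ≫ dag cup) :
    DualPair X Y where
  cap := cap
  cup := cup
  zig := zig
  zag := zag
  balanced := balanced
  balanced' f := by
    -- `g` is the transpose of `f`: moving `f` across the cup and across the cap turns it into `g`,
    -- so the two traces of `f` become those of `g`.
    let g : X ⟶ X := (ρ_ X).inv ≫ X ◁ (cup ≫ f ▷ X) ≫ (α_ X Y X).inv ≫ dag cap ▷ X ≫ (λ_ X).hom
    have h1 : cup ≫ Y ◁ g = cup ≫ f ▷ X := by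
      calc cup ≫ Y ◁ g
        _ = 𝟙 _ ⊗≫ (cup ▷ 𝟙_ C ≫ (Y ⊗ X) ◁ (cup ≫ f ▷ X)) ⊗≫ Y ◁ dag cap ▷ X ⊗≫ 𝟙 _ := by
          simp only [g]; monoidal
        _ = 𝟙 _ ⊗≫ (𝟙_ C ◁ (cup ≫ f ▷ X) ≫ cup ▷ (Y ⊗ X)) ⊗≫ Y ◁ dag cap ▷ X ⊗≫ 𝟙 _ := by
          rw [whisker_exchange]
        _ = (cup ≫ f ▷ X) ≫
            ((λ_ Y).inv ≫ cup ▷ Y ≫ (α_ Y X Y).hom ≫ Y ◁ dag cap ≫ (ρ_ Y).hom) ▷ X := by monoidal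
        _ = cup ≫ f ▷ X := by rw [zag]; simp
    have h2 : g ▷ Y ≫ dag cap = X ◁ f ≫ dag cap := by
      calc g ▷ Y ≫ dag cap
        _ = 𝟙 _ ⊗≫ X ◁ (cup ≫ f ▷ X) ▷ Y ⊗≫ (dag cap ▷ (X ⊗ Y) ≫ 𝟙_ C ◁ dag cap) ⊗≫ 𝟙 _ := by
          simp only [g]; monoidal
        _ = 𝟙 _ ⊗≫ X ◁ (cup ≫ f ▷ X) ▷ Y ⊗≫ ((X ⊗ Y) ◁ dag cap ≫ dag cap ▷ 𝟙_ C) ⊗≫ 𝟙 _ := by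
          rw [whisker_exchange]
        _ = 𝟙 _ ⊗≫ X ◁ (cup ▷ Y) ⊗≫ X ◁ (f ▷ (X ⊗ Y) ≫ Y ◁ dag cap) ⊗≫ dag cap ⊗≫ 𝟙 _ := by
          monoidal
        _ = 𝟙 _ ⊗≫ X ◁ (cup ▷ Y) ⊗≫ X ◁ (Y ◁ dag cap ≫ f ▷ 𝟙_ C) ⊗≫ dag cap ⊗≫ 𝟙 _ := by
          rw [whisker_exchange]
        _ = X ◁ ((λ_ Y).inv ≫ cup ▷ Y ≫ (α_ Y X Y).hom ≫ Y ◁ dag cap ≫ (ρ_ Y).hom) ≫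
            X ◁ f ≫ dag cap := by monoidal
        _ = X ◁ f ≫ dag cap := by rw [zag]; simp
    rw [← h2, balanced g, reassoc_of% h1]

variable (C) in
/-- The unit object is self-dual. -/
@[simps! cap cup]
def unit : DualPair (𝟙_ C) (𝟙_ C) :=
  ofBalanced (λ_ (𝟙_ C)).inv (λ_ (𝟙_ C)).inv (by simp only [dag_leftUnitor_inv]; monoidal)
    (by simp only [dag_leftUnitor_inv]; monoidal)
    (fun f => by simp only [dag_leftUnitor_inv]; monoidal)

section Prod

variable {X Y U W : C} (D : DualPair X Y) (E : DualPair U W)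

/-- Nested co-evaluations. -/
def prodCap : 𝟙_ C ⟶ (X ⊗ U) ⊗ (W ⊗ Y) :=
  D.cap ≫ X ◁ ((λ_ Y).inv ≫ E.cap ▷ Y ≫ (α_ U W Y).hom) ≫ (α_ X U (W ⊗ Y)).inv

/-- Sliding the inner cap past the evaluation of `D` separates the nested zigzag into one for `X`
and one for `U`. -/
theorem prodCap_zig : (λ_ (X ⊗ U)).inv ≫ D.prodCap E ▷ (X ⊗ U) ≫ (α_ _ _ _).hom ≫
    (X ⊗ U) ◁ dag (E.swap.prodCap D.swap) ≫ (ρ_ (X ⊗ U)).hom = 𝟙 _ := by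
  calc _
    _ = 𝟙 _ ⊗≫ D.cap ▷ (X ⊗ U) ⊗≫ X ◁ (E.cap ▷ (Y ⊗ X) ≫ (U ⊗ W) ◁ dag D.cup) ▷ U ⊗≫
        X ◁ U ◁ dag E.cup ⊗≫ 𝟙 _ := by
      simp only [prodCap, swap_cap, dag_comp, dag_whiskerLeft, dag_whiskerRight, dag_associator,
        dag_leftUnitor_inv, dag_associator_inv]
      monoidal
    _ = 𝟙 _ ⊗≫ D.cap ▷ (X ⊗ U) ⊗≫ X ◁ (𝟙_ C ◁ dag D.cup ≫ E.cap ▷ 𝟙_ C) ▷ U ⊗≫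
        X ◁ U ◁ dag E.cup ⊗≫ 𝟙 _ := by rw [whisker_exchange]
    _ = ((λ_ X).inv ≫ D.cap ▷ X ≫ (α_ X Y X).hom ≫ X ◁ dag D.cup ≫ (ρ_ X).hom) ▷ U ≫
        X ◁ ((λ_ U).inv ≫ E.cap ▷ U ≫ (α_ U W U).hom ≫ U ◁ dag E.cup ≫ (ρ_ U).hom) := by
      monoidal
    _ = 𝟙 _ := by rw [D.zig, E.zig]; simp

/-- The trace is taken in stages. The right partial trace over `U` leaves `p` on `X`, to which
`D.balanced` applies; by the exchange law the result is the right trace of `q`, the left partial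
trace over `X`, and `E.balanced` finishes. -/
theorem prodCap_balanced (f : X ⊗ U ⟶ X ⊗ U) :
    D.prodCap E ≫ f ▷ (W ⊗ Y) ≫ dag (D.prodCap E) =
      E.swap.prodCap D.swap ≫ (W ⊗ Y) ◁ f ≫ dag (E.swap.prodCap D.swap) := by
  let p : X ⟶ X := (ρ_ X).inv ≫ X ◁ E.cap ≫ (α_ _ _ _).inv ≫ f ▷ W ≫ (α_ _ _ _).hom ≫
    X ◁ dag E.cap ≫ (ρ_ X).hom
  let q : U ⟶ U := (λ_ U).inv ≫ D.cup ▷ U ≫ (α_ _ _ _).hom ≫ Y ◁ f ≫ (α_ _ _ _).inv ≫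
    dag D.cup ▷ U ≫ (λ_ U).hom
  calc _
    _ = D.cap ≫ p ▷ Y ≫ dag D.cap := by
      simp only [prodCap, p, dag_comp, dag_whiskerLeft, dag_whiskerRight, dag_associator,
        dag_leftUnitor_inv, dag_associator_inv]
      monoidal
    _ = D.cup ≫ Y ◁ p ≫ dag D.cup := D.balanced p
    _ = 𝟙 _ ⊗≫ (D.cup ▷ 𝟙_ C ≫ (Y ⊗ X) ◁ E.cap) ⊗≫ Y ◁ f ▷ W ⊗≫
        ((Y ⊗ X) ◁ dag E.cap ≫ dag D.cup ▷ 𝟙_ C) ⊗≫ 𝟙 _ := by simp only [p]; monoidal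
    _ = 𝟙 _ ⊗≫ (𝟙_ C ◁ E.cap ≫ D.cup ▷ (U ⊗ W)) ⊗≫ Y ◁ f ▷ W ⊗≫
        (dag D.cup ▷ (U ⊗ W) ≫ 𝟙_ C ◁ dag E.cap) ⊗≫ 𝟙 _ := by
      rw [whisker_exchange, whisker_exchange]
    _ = E.cap ≫ q ▷ W ≫ dag E.cap := by simp only [q]; monoidal
    _ = E.cup ≫ W ◁ q ≫ dag E.cup := E.balanced q
    _ = _ := by
      simp only [prodCap, q, swap_cap, dag_comp, dag_whiskerLeft, dag_whiskerRight, dag_associator,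
        dag_leftUnitor_inv, dag_associator_inv]
      monoidal

@[simps]
def prod : DualPair (X ⊗ U) (W ⊗ Y) where
  cap := D.prodCap E
  cup := E.swap.prodCap D.swap
  zig := D.prodCap_zig E
  zag := E.swap.prodCap_zig D.swap
  balanced := D.prodCap_balanced E
  balanced' := E.swap.prodCap_balanced D.swap

end Prod

/-- Transport of a duality along a unitary isomorphism. -/
@[simps! cap cup]
def transport {X Y Y' : C} (D : DualPair X Y) (e : Y ≅ Y') (he : dag e.hom = e.inv) :
    DualPair X Y' :=
  ofBalanced (D.cap ≫ X ◁ e.hom) (D.cup ≫ e.hom ▷ X)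
    (by
      rw [← D.zig]
      have : X ◁ e.hom ▷ X ≫ X ◁ e.inv ▷ X = 𝟙 _ := by
        rw [← whiskerLeft_comp, ← comp_whiskerRight, e.hom_inv_id]; simp
      simp [he, reassoc_of% this])
    (by
      have h1 : (λ_ Y').inv ≫ (D.cup ≫ e.hom ▷ X) ▷ Y' ≫ (α_ Y' X Y').hom ≫
          Y' ◁ dag (D.cap ≫ X ◁ e.hom) ≫ (ρ_ Y').hom =
          𝟙 _ ⊗≫ D.cup ▷ Y' ⊗≫ (e.hom ▷ (X ⊗ Y') ≫ Y' ◁ X ◁ e.inv) ⊗≫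
            Y' ◁ dag D.cap ⊗≫ 𝟙 _ := by
        simp only [dag_comp, dag_whiskerLeft, he]; monoidal
      rw [h1, ← whisker_exchange]
      calc _
        _ = 𝟙 _ ⊗≫ (D.cup ▷ Y' ≫ (Y ⊗ X) ◁ e.inv) ⊗≫ (e.hom ▷ (X ⊗ Y) ≫ Y' ◁ dag D.cap) ⊗≫ 𝟙 _ := by
          monoidal
        _ = 𝟙 _ ⊗≫ (𝟙_ C ◁ e.inv ≫ D.cup ▷ Y) ⊗≫ (Y ◁ dag D.cap ≫ e.hom ▷ 𝟙_ C) ⊗≫ 𝟙 _ := by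
          rw [whisker_exchange, whisker_exchange]
        _ = e.inv ≫ ((λ_ Y).inv ≫ D.cup ▷ Y ≫ (α_ Y X Y).hom ≫ Y ◁ dag D.cap ≫ (ρ_ Y).hom) ≫
            e.hom := by monoidal
        _ = 𝟙 _ := by rw [D.zag]; simp)
    (fun f => by
      have h1 : X ◁ e.hom ≫ f ▷ Y' ≫ X ◁ e.inv = f ▷ Y := by
        rw [← whisker_exchange, ← whiskerLeft_comp_assoc, e.hom_inv_id]; simp
      have h2 : e.hom ▷ X ≫ Y' ◁ f ≫ e.inv ▷ X = Y ◁ f := by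
        rw [whisker_exchange, ← comp_whiskerRight_assoc, e.hom_inv_id]; simp
      simp only [dag_comp, dag_whiskerLeft, dag_whiskerRight, he, Category.assoc]
      rw [reassoc_of% h1, reassoc_of% h2, D.balanced])

section Sum

variable {ι : Type*} [Fintype ι] {x y : ι → C} (D : ∀ j, DualPair (x j) (y j)) {A B : C}
  (i : ∀ j, x j ⟶ A) (k : ∀ j, y j ⟶ B)

/-- The co-evaluation of a direct sum. -/
def sumCap : 𝟙_ C ⟶ A ⊗ B := ∑ j, (D j).cap ≫ (i j ⊗ₘ k j)

variable {i k}

/-- Orthogonality of the `k j` removes the mixed terms, and the zigzag of the `j`-th summand leaves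
the projection `dag (i j) ≫ i j`; these projections sum to the identity. -/
theorem sumCap_zig (k_isometry : ∀ j, k j ≫ dag (k j) = 𝟙 _)
    (k_orthogonal : ∀ j l, j ≠ l → k j ≫ dag (k l) = 0) (i_total : ∑ j, dag (i j) ≫ i j = 𝟙 A) :
    (λ_ A).inv ≫ sumCap D i k ▷ A ≫ (α_ A B A).hom ≫ A ◁ dag (sumCap (fun j => (D j).swap) k i) ≫
      (ρ_ A).hom = 𝟙 A := by
  classical
  have key : ∀ j l, (λ_ A).inv ≫ ((D j).cap ≫ (i j ⊗ₘ k j)) ▷ A ≫ (α_ A B A).hom ≫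
      A ◁ dag ((D l).cup ≫ (k l ⊗ₘ i l)) ≫ (ρ_ A).hom =
      if j = l then dag (i j) ≫ i j else 0 := by
    intro j l
    have h1 : (λ_ A).inv ≫ ((D j).cap ≫ (i j ⊗ₘ k j)) ▷ A ≫ (α_ A B A).hom ≫
        A ◁ dag ((D l).cup ≫ (k l ⊗ₘ i l)) ≫ (ρ_ A).hom =
        𝟙 _ ⊗≫ (D j).cap ▷ A ⊗≫ (x j) ◁ ((k j ≫ dag (k l)) ▷ A ≫ y l ◁ dag (i l)) ⊗≫
          (i j ▷ (y l ⊗ x l) ≫ A ◁ dag (D l).cup) ⊗≫ 𝟙 _ := by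
      simp only [dag_comp, dag_tensor]
      simp only [MonoidalCategory.tensorHom_def]
      calc _
        _ = 𝟙 _ ⊗≫ (D j).cap ▷ A ⊗≫ ((i j ▷ (y j ⊗ A)) ≫ A ◁ ((k j ≫ dag (k l)) ▷ A ≫
            y l ◁ dag (i l))) ⊗≫ A ◁ dag (D l).cup ⊗≫ 𝟙 _ := by monoidal
        _ = _ := by rw [← whisker_exchange]; monoidal
    rw [h1]
    split_ifs with hjl
    · subst hjl
      rw [k_isometry, ← whisker_exchange (i j)]
      calc _
        _ = 𝟙 _ ⊗≫ ((D j).cap ▷ A ≫ (x j ⊗ y j) ◁ dag (i j)) ⊗≫ x j ◁ dag (D j).cup ⊗≫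
            i j ⊗≫ 𝟙 _ := by monoidal
        _ = 𝟙 _ ⊗≫ (𝟙_ C ◁ dag (i j) ≫ (D j).cap ▷ x j) ⊗≫ x j ◁ dag (D j).cup ⊗≫
            i j ⊗≫ 𝟙 _ := by rw [whisker_exchange]
        _ = dag (i j) ≫ ((λ_ _).inv ≫ (D j).cap ▷ x j ≫ (α_ _ _ _).hom ≫
            x j ◁ dag (D j).cup ≫ (ρ_ _).hom) ≫ i j := by monoidal
        _ = _ := by rw [(D j).zig, Category.id_comp]
    · rw [k_orthogonal j l hjl]
      simp [monoidalComp]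
  calc _
    _ = ∑ j, ∑ l, (λ_ A).inv ≫ ((D j).cap ≫ (i j ⊗ₘ k j)) ▷ A ≫ (α_ A B A).hom ≫
      A ◁ dag ((D l).cup ≫ (k l ⊗ₘ i l)) ≫ (ρ_ A).hom := by
      simp only [sumCap, dag_sum, whiskerLeft_sum, sum_whiskerRight, Preadditive.sum_comp,
        Preadditive.comp_sum, swap_cap]
      exact Finset.sum_comm
    _ = _ := by simp only [key, Finset.sum_ite_eq, Finset.mem_univ, if_true, i_total]

/-- Only the diagonal blocks of `f` contribute to the trace, so that balancedness can be checked on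
the summands. -/
theorem sumCap_trace (k_isometry : ∀ j, k j ≫ dag (k j) = 𝟙 _)
    (k_orthogonal : ∀ j l, j ≠ l → k j ≫ dag (k l) = 0) (f : A ⟶ A) :
    sumCap D i k ≫ f ▷ B ≫ dag (sumCap D i k) =
      ∑ j, (D j).cap ≫ (i j ≫ f ≫ dag (i j)) ▷ y j ≫ dag (D j).cap := by
  classical
  have key : ∀ j l, ((D j).cap ≫ (i j ⊗ₘ k j)) ≫ f ▷ B ≫ dag ((D l).cap ≫ (i l ⊗ₘ k l)) =
      if j = l then (D j).cap ≫ (i j ≫ f ≫ dag (i j)) ▷ y j ≫ dag (D j).cap else 0 := by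
    intro j l
    have h1 : ((D j).cap ≫ (i j ⊗ₘ k j)) ≫ f ▷ B ≫ dag ((D l).cap ≫ (i l ⊗ₘ k l)) =
        (D j).cap ≫ ((i j ≫ f ≫ dag (i l)) ⊗ₘ (k j ≫ dag (k l))) ≫ dag (D l).cap := by
      rw [dag_comp, dag_tensor, ← tensorHom_id]
      simp only [Category.assoc, tensorHom_comp_tensorHom_assoc, Category.id_comp]
    rw [h1]
    split_ifs with hjl
    · subst hjl
      rw [k_isometry, tensorHom_id]
    · rw [k_orthogonal j l hjl]; simp
  calc _
    _ = ∑ j, ∑ l, ((D j).cap ≫ (i j ⊗ₘ k j)) ≫ f ▷ B ≫ dag ((D l).cap ≫ (i l ⊗ₘ k l)) := by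
      simp only [sumCap, dag_sum, Preadditive.sum_comp, Preadditive.comp_sum]
      first | done | exact Finset.sum_comm
    _ = _ := by simp only [key, Finset.sum_ite_eq, Finset.mem_univ, if_true]

theorem sumCap_trace' (k_isometry : ∀ j, k j ≫ dag (k j) = 𝟙 _)
    (k_orthogonal : ∀ j l, j ≠ l → k j ≫ dag (k l) = 0) (f : A ⟶ A) :
    sumCap (fun j => (D j).swap) k i ≫ B ◁ f ≫ dag (sumCap (fun j => (D j).swap) k i) =
      ∑ j, (D j).cup ≫ y j ◁ (i j ≫ f ≫ dag (i j)) ≫ dag (D j).cup := by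
  classical
  have key : ∀ j l, ((D j).cup ≫ (k j ⊗ₘ i j)) ≫ B ◁ f ≫ dag ((D l).cup ≫ (k l ⊗ₘ i l)) =
      if j = l then (D j).cup ≫ y j ◁ (i j ≫ f ≫ dag (i j)) ≫ dag (D j).cup else 0 := by
    intro j l
    have h1 : ((D j).cup ≫ (k j ⊗ₘ i j)) ≫ B ◁ f ≫ dag ((D l).cup ≫ (k l ⊗ₘ i l)) =
        (D j).cup ≫ ((k j ≫ dag (k l)) ⊗ₘ (i j ≫ f ≫ dag (i l))) ≫ dag (D l).cup := by
      rw [dag_comp, dag_tensor, ← id_tensorHom]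
      simp only [Category.assoc, tensorHom_comp_tensorHom_assoc, Category.id_comp]
    rw [h1]
    split_ifs with hjl
    · subst hjl
      rw [k_isometry, id_tensorHom]
    · rw [k_orthogonal j l hjl]; simp
  calc _
    _ = ∑ j, ∑ l, ((D j).cup ≫ (k j ⊗ₘ i j)) ≫ B ◁ f ≫ dag ((D l).cup ≫ (k l ⊗ₘ i l)) := by
      simp only [sumCap, dag_sum, Preadditive.sum_comp, Preadditive.comp_sum, swap_cap]
      first | done | exact Finset.sum_comm
    _ = _ := by simp only [key, Finset.sum_ite_eq, Finset.mem_univ, if_true]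

/-- The duality of an orthogonal direct sum. -/
@[simps! cap cup]
def sum (i_isometry : ∀ j, i j ≫ dag (i j) = 𝟙 _)
    (i_orthogonal : ∀ j l, j ≠ l → i j ≫ dag (i l) = 0) (i_total : ∑ j, dag (i j) ≫ i j = 𝟙 A)
    (k_isometry : ∀ j, k j ≫ dag (k j) = 𝟙 _)
    (k_orthogonal : ∀ j l, j ≠ l → k j ≫ dag (k l) = 0) (k_total : ∑ j, dag (k j) ≫ k j = 𝟙 B) :
    DualPair A B :=
  ofBalanced (sumCap D i k) (sumCap (fun j => (D j).swap) k i)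
    (sumCap_zig D k_isometry k_orthogonal i_total)
    (sumCap_zig (fun j => (D j).swap) i_isometry i_orthogonal k_total)
    (fun f => by
      rw [sumCap_trace D k_isometry k_orthogonal, sumCap_trace' D k_isometry k_orthogonal]
      exact Finset.sum_congr rfl fun j _ => (D j).balanced _)

end Sum

end DualPair

namespace SimpleObjects

variable (S : SimpleObjects C)

/-- The duality of the simple objects. -/
@[simps! cap cup]
def simplePair (j : S.Irr) : DualPair (S.obj true j) (S.obj false j) :=
  DualPair.ofBalanced (S.R j) (S.R' j) (S.conjugate j) (S.conjugate' j) (fun f => by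
    have := S.simple j
    have : FiniteDimensional ℂ (S.obj true j ⟶ S.obj true j) := finite_hom _ _
    -- By Schur's lemma the two traces only have to agree on the identity, where they are the values
    -- of the two circles.
    obtain ⟨c, rfl⟩ := endomorphism_simple_eq_smul_id ℂ f
    simp [S.standard])

def objPair : ∀ (s : Bool) (j : S.Irr), DualPair (S.obj s j) (S.obj (!s) j)
  | true, j => S.simplePair j
  | false, j => (S.simplePair j).swap

theorem objPair_cap (s : Bool) (j : S.Irr) : (S.objPair s j).cap = S.cap s j := by cases s <;> rfl

theorem objPair_cup (s : Bool) (j : S.Irr) : (S.objPair s j).cup = S.cup s j := by cases s <;> rfl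

/-- The duality of `A^s` and `A^(-s)`. -/
def pairA (s : Bool) : DualPair (S.A s) (S.A (!s)) :=
  DualPair.sum (S.objPair s) (i := S.incl s) (k := S.incl (!s)) (S.incl_isometry _)
    (S.incl_orthogonal _) (S.incl_total _) (S.incl_isometry _) (S.incl_orthogonal _)
    (S.incl_total _)

theorem pairA_cap (s : Bool) : (S.pairA s).cap = S.capA s := by
  simp [pairA, DualPair.sumCap, capA, objPair_cap]

theorem pairA_cup (s : Bool) : (S.pairA s).cup = S.cupA s := by
  simp [pairA, DualPair.sumCap, cupA, objPair_cup]

end SimpleObjects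

end Constructions

end LevinWen

end

noncomputable section

namespace LevinWen

universe v u

open UnitaryFusionCategory

/-! ### A calculus of conjugate morphisms -/

section Conjugation

variable {C : Type u} [Category.{v} C] [Abelian C] [Linear ℂ C] [MonoidalCategory C]
  [MonoidalPreadditive C] [MonoidalLinear ℂ C] [UnitaryFusionCategory C]

/-- `f'` is the modular conjugate of `f`, the transpose of the adjoint of `f`. -/
def IsConj {X X' Y Y' : C} (D : DualPair X X') (D' : DualPair Y Y') (f : X ⟶ Y) (f' : X' ⟶ Y') :
    Prop :=
  D'.cap ≫ dag f ▷ Y' = D.cap ≫ X ◁ f'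

namespace IsConj

variable {X X' Y Y' Z Z' U U' W W' : C} {D : DualPair X X'} {D' : DualPair Y Y'}
  {D'' : DualPair Z Z'} {E : DualPair U U'} {E' : DualPair W W'} {f : X ⟶ Y} {f' : X' ⟶ Y'}
  {g : Y ⟶ Z} {g' : Y' ⟶ Z'} {k : U ⟶ W} {k' : U' ⟶ W'}

/-- In the adjoint of the relation, `f` is bent around: a zigzag of `D'` is inserted after `f`, the
relation is applied under it, and a zigzag of `D` is removed. -/
theorem symm (h : IsConj D D' f f') : IsConj D.swap D'.swap f' f := by
  have h' : f ▷ Y' ≫ dag D'.cap = X ◁ dag f' ≫ dag D.cap := by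
    simpa using congrArg dag h
  refine Eq.symm (?_ : D.cup ≫ X' ◁ f = D'.cup ≫ dag f' ▷ Y)
  calc D.cup ≫ X' ◁ f
    _ = D.cup ≫ X' ◁ (f ≫ ((ρ_ Y).inv ≫ Y ◁ D'.cup ≫ (α_ Y Y' Y).inv ≫ dag D'.cap ▷ Y ≫
        (λ_ Y).hom)) := by rw [D'.zig_dag, Category.comp_id]
    _ = 𝟙 _ ⊗≫ D.cup ⊗≫ X' ◁ (f ▷ 𝟙_ C ≫ Y ◁ D'.cup) ⊗≫ X' ◁ dag D'.cap ▷ Y ⊗≫ 𝟙 _ := by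
      monoidal
    _ = 𝟙 _ ⊗≫ D.cup ⊗≫ X' ◁ (X ◁ D'.cup ≫ f ▷ (Y' ⊗ Y)) ⊗≫ X' ◁ dag D'.cap ▷ Y ⊗≫ 𝟙 _ := by
      rw [whisker_exchange]
    _ = 𝟙 _ ⊗≫ D.cup ⊗≫ X' ◁ X ◁ D'.cup ⊗≫ X' ◁ (f ▷ Y' ≫ dag D'.cap) ▷ Y ⊗≫ 𝟙 _ := by
      monoidal
    _ = 𝟙 _ ⊗≫ D.cup ⊗≫ X' ◁ X ◁ D'.cup ⊗≫ X' ◁ (X ◁ dag f' ≫ dag D.cap) ▷ Y ⊗≫ 𝟙 _ := by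
      rw [h']
    _ = 𝟙 _ ⊗≫ (D.cup ▷ 𝟙_ C ≫ (X' ⊗ X) ◁ (D'.cup ≫ dag f' ▷ Y)) ⊗≫ X' ◁ dag D.cap ▷ Y ⊗≫
        𝟙 _ := by monoidal
    _ = 𝟙 _ ⊗≫ (𝟙_ C ◁ (D'.cup ≫ dag f' ▷ Y) ≫ D.cup ▷ (X' ⊗ Y)) ⊗≫ X' ◁ dag D.cap ▷ Y ⊗≫
        𝟙 _ := by rw [whisker_exchange]
    _ = (D'.cup ≫ dag f' ▷ Y) ≫ ((λ_ X').inv ≫ D.cup ▷ X' ≫ (α_ X' X X').hom ≫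
        X' ◁ dag D.cap ≫ (ρ_ X').hom) ▷ Y := by monoidal
    _ = D'.cup ≫ dag f' ▷ Y := by rw [D.zag]; simp

/-- Adjoint and transpose each reverse composition, so conjugation preserves its order; only the
transpose reverses tensor products, which is why left and right whiskerings are exchanged below. -/
theorem comp (h : IsConj D D' f f') (h₂ : IsConj D' D'' g g') : IsConj D D'' (f ≫ g) (f' ≫ g') := by
  unfold IsConj at *
  rw [dag_comp, comp_whiskerRight, reassoc_of% h₂, whisker_exchange, reassoc_of% h, whiskerLeft_comp]

variable (D) in
theorem id : IsConj D D (𝟙 X) (𝟙 X') := by simp [IsConj]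

variable (D D') in
theorem zero : IsConj D D' (0 : X ⟶ Y) 0 := by
  simp [IsConj]

theorem whiskerLeft (D : DualPair X X') (h : IsConj E E' k k') :
    IsConj (D.prod E) (D.prod E') (X ◁ k) (k' ▷ X') := by
  unfold IsConj at *
  calc _
    _ = 𝟙 _ ⊗≫ D.cap ⊗≫ X ◁ (E'.cap ≫ dag k ▷ W') ▷ X' ⊗≫ 𝟙 _ := by
      simp only [DualPair.prod_cap, DualPair.prodCap, dag_whiskerLeft]; monoidal
    _ = 𝟙 _ ⊗≫ D.cap ⊗≫ X ◁ (E.cap ≫ U ◁ k') ▷ X' ⊗≫ 𝟙 _ := by rw [h]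
    _ = _ := by simp only [DualPair.prod_cap, DualPair.prodCap]; monoidal

theorem whiskerRight (h : IsConj D D' f f') (E : DualPair U U') :
    IsConj (D.prod E) (D'.prod E) (f ▷ U) (U' ◁ f') := by
  unfold IsConj at *
  calc _
    _ = 𝟙 _ ⊗≫ D'.cap ⊗≫ (Y ◁ E.cap ≫ dag f ▷ (U ⊗ U')) ▷ Y' ⊗≫ 𝟙 _ := by
      simp only [DualPair.prod_cap, DualPair.prodCap, dag_whiskerRight]; monoidal
    _ = 𝟙 _ ⊗≫ D'.cap ⊗≫ (dag f ▷ 𝟙_ C ≫ X ◁ E.cap) ▷ Y' ⊗≫ 𝟙 _ := by rw [whisker_exchange]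
    _ = 𝟙 _ ⊗≫ (D'.cap ≫ dag f ▷ Y') ⊗≫ X ◁ E.cap ▷ Y' ⊗≫ 𝟙 _ := by monoidal
    _ = 𝟙 _ ⊗≫ (D.cap ≫ X ◁ f') ⊗≫ X ◁ E.cap ▷ Y' ⊗≫ 𝟙 _ := by rw [h]
    _ = 𝟙 _ ⊗≫ D.cap ⊗≫ X ◁ (𝟙_ C ◁ f' ≫ E.cap ▷ Y') ⊗≫ 𝟙 _ := by monoidal
    _ = 𝟙 _ ⊗≫ D.cap ⊗≫ X ◁ (E.cap ▷ X' ≫ (U ⊗ U') ◁ f') ⊗≫ 𝟙 _ := by rw [whisker_exchange]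
    _ = _ := by simp only [DualPair.prod_cap, DualPair.prodCap]; monoidal

theorem tensorHom (h : IsConj D D' f f') (h₂ : IsConj E E' k k') :
    IsConj (D.prod E) (D'.prod E') (f ⊗ₘ k) (k' ⊗ₘ f') := by
  rw [MonoidalCategory.tensorHom_def, tensorHom_def']
  exact (h.whiskerRight E).comp (whiskerLeft D' h₂)

theorem iso_inv (e : X ≅ Y) (e' : X' ≅ Y') (h : IsConj D D' e.hom e'.hom) :
    IsConj D' D e.inv e'.inv := by
  unfold IsConj at *
  have h1 : dag e.hom ≫ dag e.inv = 𝟙 Y := by rw [← dag_comp, e.inv_hom_id, dag_id]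
  calc D.cap ≫ dag e.inv ▷ X'
    _ = D.cap ≫ X ◁ e'.hom ≫ X ◁ e'.inv ≫ dag e.inv ▷ X' := by
      rw [← whiskerLeft_comp_assoc, e'.hom_inv_id]; simp
    _ = D'.cap ≫ (dag e.hom ≫ dag e.inv) ▷ Y' ≫ Y ◁ e'.inv := by
      rw [← reassoc_of% h, whisker_exchange]; simp
    _ = D'.cap ≫ Y ◁ e'.inv := by rw [h1]; simp

theorem associator (D : DualPair X X') (E : DualPair U U') (F : DualPair W W') :
    IsConj ((D.prod E).prod F) (D.prod (E.prod F)) (α_ X U W).hom (α_ W' U' X').inv := by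
  simp only [IsConj, DualPair.prod_cap, DualPair.prodCap, dag_associator]
  monoidal

theorem associator_inv (D : DualPair X X') (E : DualPair U U') (F : DualPair W W') :
    IsConj (D.prod (E.prod F)) ((D.prod E).prod F) (α_ X U W).inv (α_ W' U' X').hom :=
  iso_inv (α_ X U W) (α_ W' U' X').symm (associator D E F)

theorem leftUnitor (D : DualPair X X') :
    IsConj ((DualPair.unit C).prod D) D (λ_ X).hom (ρ_ X').hom := by
  simp only [IsConj, DualPair.prod_cap, DualPair.prodCap, dag_leftUnitor, DualPair.unit_cap]
  monoidal

theorem leftUnitor_inv (D : DualPair X X') :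
    IsConj D ((DualPair.unit C).prod D) (λ_ X).inv (ρ_ X').inv :=
  iso_inv (λ_ X) (ρ_ X') (leftUnitor D)

theorem rightUnitor (D : DualPair X X') :
    IsConj (D.prod (DualPair.unit C)) D (ρ_ X).hom (λ_ X').hom := by
  simp only [IsConj, DualPair.prod_cap, DualPair.prodCap, dag_rightUnitor, DualPair.unit_cap]
  monoidal

theorem rightUnitor_inv (D : DualPair X X') :
    IsConj D (D.prod (DualPair.unit C)) (ρ_ X).inv (λ_ X').inv :=
  iso_inv (ρ_ X) (λ_ X') (rightUnitor D)

theorem transport (D : DualPair X X') (e : X' ≅ Y') (he : dag e.hom = e.inv) :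
    IsConj D (D.transport e he) (𝟙 X) e.hom := by
  simp [IsConj]

theorem transport_inv (D : DualPair X X') (e : X' ≅ Y') (he : dag e.hom = e.inv) :
    IsConj (D.transport e he) D (𝟙 X) e.inv :=
  iso_inv (Iso.refl X) e (transport D e he)

/-- The co-evaluation is its own conjugate. -/
theorem cap (D : DualPair X Y) : IsConj (DualPair.unit C) (D.prod D.swap) D.cap D.cap := by
  calc _
    _ = D.cap ≫ ((ρ_ X).inv ≫ X ◁ D.cup ≫ (α_ X Y X).inv ≫ dag D.cap ▷ X ≫ (λ_ X).hom) ▷ Y ≫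
        (λ_ (X ⊗ Y)).inv := by
      simp only [DualPair.prod_cap, DualPair.prodCap, DualPair.swap_cap]; monoidal
    _ = _ := by
      rw [D.zig_dag, DualPair.unit_cap]; monoidal

theorem conj (D : DualPair X Y) (x : 𝟙_ C ⟶ X) : IsConj (DualPair.unit C) D x (D.conj x) := by
  simp only [IsConj, DualPair.conj, DualPair.unit_cap]
  monoidal

/-- For a vector the source duality is that of the unit and drops out. This turns a chain of
`IsConj` rules back into an identity for `conj`. -/
theorem eq_conj {D : DualPair X Y} {x : 𝟙_ C ⟶ X} {x' : 𝟙_ C ⟶ Y}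
    (h : IsConj (DualPair.unit C) D x x') : x' = D.conj x := by
  unfold IsConj at h
  rw [DualPair.conj, reassoc_of% h, DualPair.unit_cap]
  monoidal

end IsConj

/-- By the conjugate equation every vector of `hom(1, X ⊗ Y)` is the cap followed by a map on the
dual leg. A mate therefore satisfies `IsConj` by construction. -/
theorem DualPair.cap_mate {X X' Y : C} (D : DualPair X X') (w : 𝟙_ C ⟶ X ⊗ Y) :
    D.cap ≫ X ◁ ((ρ_ X').inv ≫ X' ◁ w ≫ (α_ X' X Y).inv ≫ dag D.cup ▷ Y ≫ (λ_ Y).hom) = w := by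
  calc _
    _ = 𝟙 _ ⊗≫ (D.cap ▷ 𝟙_ C ≫ (X ⊗ X') ◁ w) ⊗≫ X ◁ dag D.cup ▷ Y ⊗≫ 𝟙 _ := by monoidal
    _ = 𝟙 _ ⊗≫ (𝟙_ C ◁ w ≫ D.cap ▷ (X ⊗ Y)) ⊗≫ X ◁ dag D.cup ▷ Y ⊗≫ 𝟙 _ := by
      rw [whisker_exchange]
    _ = w ≫ ((λ_ X).inv ≫ D.cap ▷ X ≫ (α_ X X' X).hom ≫ X ◁ dag D.cup ≫ (ρ_ X).hom) ▷ Y := by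
      monoidal
    _ = w := by rw [D.zig]; simp

@[ext]
theorem DualPair.ext {X Y : C} {D E : DualPair X Y} (h : D.cap = E.cap) (h' : D.cup = E.cup) :
    D = E := by
  cases D; cases E; congr

namespace SimpleObjects

variable (S : SimpleObjects C)

theorem pairA_false_swap : (S.pairA false).swap = S.pairA true := by
  ext
  · rw [DualPair.swap_cap, pairA_cup, pairA_cap]; rfl
  · rw [DualPair.swap_cup, pairA_cap, pairA_cup]; rfl

theorem pairA_true_swap : (S.pairA true).swap = S.pairA false := by
  rw [← pairA_false_swap]; rfl

/-- In the sum that defines `capA`, orthogonality of the inclusions selects the term `j`. -/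
theorem isConj_incl (s : Bool) (j : S.Irr) :
    IsConj (S.objPair s j) (S.pairA s) (S.incl s j) (S.incl (!s) j) := by
  classical
  have key : ∀ l, (S.cap s l ≫ (S.incl s l ⊗ₘ S.incl (!s) l)) ≫ dag (S.incl s j) ▷ S.A (!s) =
      if l = j then S.cap s j ≫ S.obj s j ◁ S.incl (!s) j else 0 := by
    intro l
    rw [Category.assoc, ← tensorHom_id, tensorHom_comp_tensorHom]
    split_ifs with h
    · subst h
      rw [S.incl_isometry, Category.comp_id, id_tensorHom]
    · rw [S.incl_orthogonal _ _ _ h]; simp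
  rw [IsConj, pairA_cap, objPair_cap, capA, Preadditive.sum_comp]
  simp only [key, Finset.sum_ite_eq', Finset.mem_univ, if_true]

theorem isConj_dag_incl (s : Bool) (j : S.Irr) :
    IsConj (S.pairA s) (S.objPair s j) (dag (S.incl s j)) (dag (S.incl (!s) j)) := by
  classical
  have key : ∀ l, (S.cap s l ≫ (S.incl s l ⊗ₘ S.incl (!s) l)) ≫ S.A s ◁ dag (S.incl (!s) j) =
      if l = j then S.cap s j ≫ S.incl s j ▷ S.obj (!s) j else 0 := by
    intro l
    rw [Category.assoc, ← id_tensorHom, tensorHom_comp_tensorHom]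
    split_ifs with h
    · subst h
      rw [S.incl_isometry, Category.comp_id, tensorHom_id]
    · rw [S.incl_orthogonal _ _ _ h]; simp
  rw [IsConj, dag_dag, pairA_cap, objPair_cap, capA, Preadditive.sum_comp]
  simp only [key, Finset.sum_ite_eq', Finset.mem_univ, if_true]

/-- The diagram in `conjFusion` is the mate of `cup ≫ dag y` for the nested duality of `j ⊗ X`, so
`DualPair.cap_mate` applies. -/
theorem isConj_conjFusion {s : Bool} {j i i' : S.Irr}
    (y : S.obj true j ⊗ S.obj (!s) i ⟶ S.obj (!s) i') :
    IsConj ((S.simplePair j).prod (S.objPair s i).swap) (S.objPair s i').swap y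
      (S.conjFusion y) := by
  have h : S.conjFusion y = (ρ_ (S.obj s i ⊗ S.obj false j)).inv ≫
      (S.obj s i ⊗ S.obj false j) ◁ (S.cup s i' ≫ dag y ▷ S.obj s i') ≫ (α_ _ _ _).inv ≫
      dag ((S.simplePair j).prod (S.objPair s i).swap).cup ▷ S.obj s i' ≫
        (λ_ (S.obj s i')).hom := by
    simp only [conjFusion, DualPair.prod_cup, DualPair.prodCap, DualPair.swap_cap, dag_comp,
      DualPair.swap_cup, objPair_cap, simplePair_cup,
      dag_whiskerLeft, dag_whiskerRight, dag_associator, dag_leftUnitor_inv, dag_associator_inv]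
    monoidal
  rw [IsConj, h, DualPair.cap_mate, DualPair.swap_cap, objPair_cup]

end SimpleObjects

end Conjugation

end LevinWen

end

noncomputable section

namespace LevinWen

universe v u

open UnitaryFusionCategory

/-! ### Corner operators as insertions between neighbouring legs -/

section Rotation

variable {C : Type u} [Category.{v} C] [Abelian C] [Linear ℂ C] [MonoidalCategory C]
  [MonoidalPreadditive C] [MonoidalLinear ℂ C] [UnitaryFusionCategory C]

namespace DualPair

variable {A A' : C} (D : DualPair A A') {X : C}

/-- The map `A' ⟶ X` that corresponds to `x : 1 ⟶ A ⊗ X`. -/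
def mate (x : 𝟙_ C ⟶ A ⊗ X) : A' ⟶ X :=
  (ρ_ A').inv ≫ A' ◁ x ≫ (α_ A' A X).inv ≫ dag D.cup ▷ X ≫ (λ_ X).hom

theorem cap_comp_mate (x : 𝟙_ C ⟶ A ⊗ X) : D.cap ≫ A ◁ D.mate x = x := D.cap_mate x

/-- Bending the first leg over the top. -/
def rotate (x : 𝟙_ C ⟶ A ⊗ X) : 𝟙_ C ⟶ X ⊗ A :=
  D.cup ≫ A' ◁ ((λ_ A).inv ≫ x ▷ A) ≫ A' ◁ (α_ A X A).hom ≫ (α_ A' A (X ⊗ A)).inv ≫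
    dag D.cup ▷ (X ⊗ A) ≫ (λ_ (X ⊗ A)).hom

/-- Bending the last leg back over the top. -/
def rotateInv (x : 𝟙_ C ⟶ X ⊗ A) : 𝟙_ C ⟶ A ⊗ X :=
  D.cap ≫ A ◁ ((λ_ A').inv ≫ x ▷ A') ≫ A ◁ ((α_ X A A').hom ≫ X ◁ dag D.cap ≫ (ρ_ X).hom)

theorem rotate_eq (x : 𝟙_ C ⟶ A ⊗ X) : D.rotate x = D.cup ≫ D.mate x ▷ A := by
  simp only [rotate, mate]; monoidal

theorem mate_comp {Y : C} (x : 𝟙_ C ⟶ A ⊗ X) (T : X ⟶ Y) :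
    D.mate (x ≫ A ◁ T) = D.mate x ≫ T := by
  calc D.mate (x ≫ A ◁ T)
    _ = 𝟙 _ ⊗≫ A' ◁ x ⊗≫ ((A' ⊗ A) ◁ T ≫ dag D.cup ▷ Y) ⊗≫ 𝟙 _ := by simp only [mate]; monoidal
    _ = 𝟙 _ ⊗≫ A' ◁ x ⊗≫ (dag D.cup ▷ X ≫ 𝟙_ C ◁ T) ⊗≫ 𝟙 _ := by rw [whisker_exchange]
    _ = _ := by simp only [mate]; monoidal

/-- Rotation bends only the first leg, so operators on the other legs pass through it. -/
theorem rotate_comp {Y : C} (x : 𝟙_ C ⟶ A ⊗ X) (T : X ⟶ Y) :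
    D.rotate (x ≫ A ◁ T) = D.rotate x ≫ T ▷ A := by
  rw [rotate_eq, rotate_eq, mate_comp]; simp

theorem rotateInv_rotate (x : 𝟙_ C ⟶ A ⊗ X) : D.rotateInv (D.rotate x) = x := by
  calc D.rotateInv (D.rotate x)
    _ = D.cap ≫ A ◁ (𝟙 _ ⊗≫ D.cup ▷ A' ⊗≫ (D.mate x ▷ (A ⊗ A') ≫ X ◁ dag D.cap) ⊗≫ 𝟙 _) := by
      rw [rotate_eq]; simp only [rotateInv]; monoidal
    _ = D.cap ≫ A ◁ (𝟙 _ ⊗≫ D.cup ▷ A' ⊗≫ (A' ◁ dag D.cap ≫ D.mate x ▷ 𝟙_ C) ⊗≫ 𝟙 _) := by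
      rw [whisker_exchange]
    _ = D.cap ≫ A ◁ (((λ_ A').inv ≫ D.cup ▷ A' ≫ (α_ A' A A').hom ≫ A' ◁ dag D.cap ≫
        (ρ_ A').hom) ≫ D.mate x) := by monoidal
    _ = x := by rw [D.zag, Category.id_comp, cap_comp_mate]

section Fuse

variable {J J' : C} (Dj : DualPair J J') (z : A ⊗ J' ⟶ A)

/-- The right mate of `z : A ⊗ J' ⟶ A`. -/
def fusionMate : A' ⟶ J ⊗ A' :=
  (λ_ A').inv ≫ Dj.cap ▷ A' ≫ (α_ J J' A').hom ≫ J ◁ (((λ_ J').inv ≫ D.cup ▷ J' ≫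
    (α_ A' A J').hom ≫ A' ◁ z) ▷ A' ≫ (α_ A' A A').hom ≫ A' ◁ dag D.cap ≫ (ρ_ A').hom)

/-- The left and right mates of `z` agree. -/
theorem cap_fusionMate : D.cap ≫ A ◁ D.fusionMate Dj z =
    D.cap ≫ A ◁ ((λ_ A').inv ≫ Dj.cup ▷ A' ≫ (α_ J' J A').hom) ≫ (α_ A J' (J ⊗ A')).inv ≫
      z ▷ (J ⊗ A') := by
  -- The two sides are the left and the right conjugate of one vector `x` for the duality `P`; the
  -- triviality of the full rotation identifies them.
  let P : DualPair ((A ⊗ J') ⊗ A') (A ⊗ (J ⊗ A')) := (D.prod Dj.swap).prod D.swap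
  let x : 𝟙_ C ⟶ (A ⊗ J') ⊗ A' := D.cap ≫ dag z ▷ A'
  have h1 : P.conjLeft x = D.cap ≫ A ◁ D.fusionMate Dj z := by
    simp only [P, x, conjLeft, prod_cup, prodCap, swap_cap, swap_cup, fusionMate, dag_comp,
      dag_whiskerRight, dag_dag]
    monoidal
  have h2 : P.conj x = D.cap ≫ A ◁ ((λ_ A').inv ≫ Dj.cup ▷ A' ≫ (α_ J' J A').hom) ≫
      (α_ A J' (J ⊗ A')).inv ≫ z ▷ (J ⊗ A') := by
    calc P.conj x
      _ = 𝟙 _ ⊗≫ D.cap ⊗≫ A ◁ Dj.cup ▷ A' ⊗≫ ((A ⊗ J') ◁ D.cup ≫ z ▷ (A' ⊗ A)) ▷ (J ⊗ A') ⊗≫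
          dag D.cap ▷ A ▷ (J ⊗ A') ⊗≫ 𝟙 _ := by
        simp only [P, x, conj, prodCap, swap_cap, dag_comp, dag_whiskerRight, dag_dag, prod_cap]
        monoidal
      _ = 𝟙 _ ⊗≫ D.cap ⊗≫ A ◁ Dj.cup ▷ A' ⊗≫ (z ▷ 𝟙_ C ≫ A ◁ D.cup) ▷ (J ⊗ A') ⊗≫
          dag D.cap ▷ A ▷ (J ⊗ A') ⊗≫ 𝟙 _ := by rw [whisker_exchange]
      _ = 𝟙 _ ⊗≫ D.cap ⊗≫ A ◁ Dj.cup ▷ A' ⊗≫ (z ≫ ((ρ_ A).inv ≫ A ◁ D.cup ≫ (α_ A A' A).inv ≫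
          dag D.cap ▷ A ≫ (λ_ A).hom)) ▷ (J ⊗ A') := by monoidal
      _ = _ := by rw [D.zig_dag]; monoidal
  rw [← h1, ← h2, conj_eq_conjLeft]

/-- Contraction of a `J`-loop at the outer legs of a rotated vector is the insertion of `J' ⊗ J`
between the corresponding legs of the original one. -/
theorem rotateInv_fuse_rotate (T : J ⊗ X ⟶ X) (x : 𝟙_ C ⟶ A ⊗ X) :
    D.rotateInv (Dj.cap ≫ J ◁ ((λ_ J').inv ≫ D.rotate x ▷ J') ≫ J ◁ ((α_ X A J').hom ≫ X ◁ z) ≫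
      (α_ J X A).inv ≫ T ▷ A) =
    x ≫ A ◁ ((λ_ X).inv ≫ Dj.cup ▷ X ≫ (α_ J' J X).hom) ≫ (α_ A J' (J ⊗ X)).inv ≫
      z ▷ (J ⊗ X) ≫ A ◁ T := by
  have h1 : D.rotateInv (Dj.cap ≫ J ◁ ((λ_ J').inv ≫ D.rotate x ▷ J') ≫
      J ◁ ((α_ X A J').hom ≫ X ◁ z) ≫ (α_ J X A).inv ≫ T ▷ A) =
      (D.cap ≫ A ◁ D.fusionMate Dj z) ≫ A ◁ (J ◁ D.mate x ≫ T) := by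
    have e : T ▷ (A ⊗ A') ≫ X ◁ dag D.cap = (J ⊗ X) ◁ dag D.cap ≫ T ▷ 𝟙_ C :=
      (whisker_exchange _ _).symm
    calc _
      _ = D.cap ≫ A ◁ (𝟙 _ ⊗≫ Dj.cap ▷ A' ⊗≫ J ◁ D.cup ▷ J' ▷ A' ⊗≫
          J ◁ (D.mate x ▷ (A ⊗ J') ≫ X ◁ z) ▷ A' ⊗≫ (T ▷ (A ⊗ A') ≫ X ◁ dag D.cap) ⊗≫ 𝟙 _) := by
        rw [rotate_eq]; simp only [rotateInv]; monoidal
      _ = D.cap ≫ A ◁ (𝟙 _ ⊗≫ Dj.cap ▷ A' ⊗≫ J ◁ D.cup ▷ J' ▷ A' ⊗≫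
          J ◁ (A' ◁ z ≫ D.mate x ▷ A) ▷ A' ⊗≫ ((J ⊗ X) ◁ dag D.cap ≫ T ▷ 𝟙_ C) ⊗≫ 𝟙 _) := by
        rw [e, ← whisker_exchange (D.mate x) z]
      _ = D.cap ≫ A ◁ (𝟙 _ ⊗≫ Dj.cap ▷ A' ⊗≫ J ◁ D.cup ▷ J' ▷ A' ⊗≫
          J ◁ A' ◁ z ▷ A' ⊗≫ J ◁ (D.mate x ▷ (A ⊗ A') ≫ X ◁ dag D.cap) ⊗≫ T ⊗≫ 𝟙 _) := by
        monoidal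
      _ = D.cap ≫ A ◁ (𝟙 _ ⊗≫ Dj.cap ▷ A' ⊗≫ J ◁ D.cup ▷ J' ▷ A' ⊗≫
          J ◁ A' ◁ z ▷ A' ⊗≫ J ◁ (A' ◁ dag D.cap ≫ D.mate x ▷ 𝟙_ C) ⊗≫ T ⊗≫ 𝟙 _) := by
        rw [whisker_exchange]
      _ = _ := by simp only [fusionMate]; monoidal
  rw [h1, cap_fusionMate]
  conv_rhs => rw [← D.cap_comp_mate x]
  calc _
    _ = 𝟙 _ ⊗≫ D.cap ⊗≫ A ◁ Dj.cup ▷ A' ⊗≫ (z ▷ (J ⊗ A') ≫ A ◁ (J ◁ D.mate x)) ⊗≫ A ◁ T ⊗≫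
        𝟙 _ := by monoidal
    _ = 𝟙 _ ⊗≫ D.cap ⊗≫ A ◁ Dj.cup ▷ A' ⊗≫ ((A ⊗ J') ◁ (J ◁ D.mate x) ≫ z ▷ (J ⊗ X)) ⊗≫
        A ◁ T ⊗≫ 𝟙 _ := by rw [whisker_exchange]
    _ = 𝟙 _ ⊗≫ D.cap ⊗≫ A ◁ (Dj.cup ▷ A' ≫ (J' ⊗ J) ◁ D.mate x) ⊗≫ z ▷ (J ⊗ X) ⊗≫
        A ◁ T ⊗≫ 𝟙 _ := by monoidal
    _ = 𝟙 _ ⊗≫ D.cap ⊗≫ A ◁ (𝟙_ C ◁ D.mate x ≫ Dj.cup ▷ X) ⊗≫ z ▷ (J ⊗ X) ⊗≫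
        A ◁ T ⊗≫ 𝟙 _ := by rw [whisker_exchange]
    _ = _ := by monoidal

end Fuse

end DualPair

namespace SimpleObjects

variable (S : SimpleObjects C) {E : Type*}

theorem rho_cons (g : E × Bool) (L : List (E × Bool)) (x : 𝟙_ C ⟶ S.A g.2 ⊗ S.tens L) :
    S.rho (g :: L) x = (S.pairA g.2).rotate x ≫ (S.tensSnoc L g).inv := by
  have h : (S.pairA g.2).rotate x ≫ (S.tensSnoc L g).inv = S.cupA g.2 ≫
      S.A (!g.2) ◁ ((λ_ (S.A g.2)).inv ≫ x ▷ S.A g.2) ≫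
      S.A (!g.2) ◁ (α_ (S.A g.2) (S.tens L) (S.A g.2)).hom ≫
      (α_ (S.A (!g.2)) (S.A g.2) (S.tens L ⊗ S.A g.2)).inv ≫
      dag (S.cupA g.2) ▷ (S.tens L ⊗ S.A g.2) ≫ (λ_ (S.tens L ⊗ S.A g.2)).hom ≫
      (S.tensSnoc L g).inv := by
    simp only [DualPair.rotate, pairA_cup, Category.assoc]
  exact h.symm

theorem rhoInv_cons (g : E × Bool) (L : List (E × Bool)) (x : 𝟙_ C ⟶ S.tens (L ++ [g])) :
    S.rhoInv (g :: L) x = (S.pairA g.2).rotateInv (x ≫ (S.tensSnoc L g).hom) := by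
  rw [DualPair.rotateInv, pairA_cap]
  rfl

section Absorb

variable {X : C} (Y : ∀ h : E × Bool, X ⊗ S.A h.2 ⟶ S.A h.2)
  (Z : ∀ g : E × Bool, S.A g.2 ⊗ X ⟶ S.A g.2)

theorem absorbFirst_cons (h : E × Bool) (L : List (E × Bool)) :
    S.absorbFirst Y (h :: L) = (α_ X (S.A h.2) (S.tens L)).inv ≫ Y h ▷ S.tens L := rfl

theorem absorbLast_cons (h : E × Bool) {L : List (E × Bool)} (hL : L ≠ []) :
    S.absorbLast Z (h :: L) = (α_ (S.A h.2) (S.tens L) X).hom ≫ S.A h.2 ◁ S.absorbLast Z L := by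
  cases L with
  | nil => exact absurd rfl hL
  | cons g L => rfl

theorem tensSnoc_cons (g : E × Bool) (L : List (E × Bool)) (h : E × Bool) :
    S.tensSnoc (g :: L) h =
      whiskerLeftIso (S.A g.2) (S.tensSnoc L h) ≪≫ (α_ (S.A g.2) (S.tens L) (S.A h.2)).symm := rfl

/-- Absorption at the head of a nonempty list does not see the appended leg. The rules for appended
legs are needed since rotation and reflection both build lists by appending. -/
theorem absorbFirst_snoc {L : List (E × Bool)} (hL : L ≠ []) (g : E × Bool) :
    S.absorbFirst Y (L ++ [g]) = X ◁ (S.tensSnoc L g).hom ≫ (α_ X (S.tens L) (S.A g.2)).inv ≫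
      S.absorbFirst Y L ▷ S.A g.2 ≫ (S.tensSnoc L g).inv := by
  cases L with
  | nil => exact absurd rfl hL
  | cons h L =>
    have e := whisker_exchange (Y h) (S.tensSnoc L g).inv
    calc _
      _ = (α_ X (S.A h.2) (S.tens (L ++ [g]))).inv ≫ Y h ▷ S.tens (L ++ [g]) := rfl
      _ = (α_ X (S.A h.2) (S.tens (L ++ [g]))).inv ≫ (X ⊗ S.A h.2) ◁ ((S.tensSnoc L g).hom ≫
          (S.tensSnoc L g).inv) ≫ Y h ▷ S.tens (L ++ [g]) := by simp
      _ = (α_ X (S.A h.2) (S.tens (L ++ [g]))).inv ≫ (X ⊗ S.A h.2) ◁ (S.tensSnoc L g).hom ≫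
          Y h ▷ (S.tens L ⊗ S.A g.2) ≫ S.A h.2 ◁ (S.tensSnoc L g).inv := by
        rw [← e, whiskerLeft_comp, Category.assoc]
      _ = _ := by
        rw [tensSnoc_cons, absorbFirst_cons]
        simp only [Iso.trans_hom, Iso.trans_inv, whiskerLeftIso_hom, whiskerLeftIso_inv,
          Iso.symm_hom, Iso.symm_inv]
        change _ = X ◁ (S.A h.2 ◁ (S.tensSnoc L g).hom ≫
          (α_ (S.A h.2) (S.tens L) (S.A g.2)).inv) ≫
          (α_ X (S.A h.2 ⊗ S.tens L) (S.A g.2)).inv ≫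
          ((α_ X (S.A h.2) (S.tens L)).inv ≫ Y h ▷ S.tens L) ▷ S.A g.2 ≫
          (α_ (S.A h.2) (S.tens L) (S.A g.2)).hom ≫ S.A h.2 ◁ (S.tensSnoc L g).inv
        monoidal

theorem absorbLast_snoc (L : List (E × Bool)) (g : E × Bool) :
    S.absorbLast Z (L ++ [g]) = (S.tensSnoc L g).hom ▷ X ≫ (α_ (S.tens L) (S.A g.2) X).hom ≫
      S.tens L ◁ Z g ≫ (S.tensSnoc L g).inv := by
  induction L with
  | nil =>
    change (ρ_ (S.A g.2)).hom ▷ X ≫ Z g ≫ (ρ_ (S.A g.2)).inv =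
      ((ρ_ (S.A g.2)).hom ≫ (λ_ (S.A g.2)).inv) ▷ X ≫ (α_ (𝟙_ C) (S.A g.2) X).hom ≫
      𝟙_ C ◁ Z g ≫ (λ_ (S.A g.2)).hom ≫ (ρ_ (S.A g.2)).inv
    monoidal
  | cons h L ih =>
    refine (S.absorbLast_cons Z h (L := L ++ [g]) (by simp)).trans ?_
    rw [ih]
    change _ = (S.A h.2 ◁ (S.tensSnoc L g).hom ≫ (α_ (S.A h.2) (S.tens L) (S.A g.2)).inv) ▷ X ≫
      (α_ (S.A h.2 ⊗ S.tens L) (S.A g.2) X).hom ≫ (S.A h.2 ⊗ S.tens L) ◁ Z g ≫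
      (α_ (S.A h.2) (S.tens L) (S.A g.2)).hom ≫ S.A h.2 ◁ (S.tensSnoc L g).inv
    monoidal

end Absorb

section Insert

variable (j : S.Irr) (Y : ∀ h : E × Bool, S.obj true j ⊗ S.A h.2 ⟶ S.A h.2)
  (Z : ∀ g : E × Bool, S.A g.2 ⊗ S.obj false j ⟶ S.A g.2)

/-- Insertion of `R'_j` between two neighbouring objects, absorbed into them. -/
def insertBetween {A X : C} (z : A ⊗ S.obj false j ⟶ A) (y : S.obj true j ⊗ X ⟶ X) :
    A ⊗ X ⟶ A ⊗ X :=
  A ◁ ((λ_ X).inv ≫ S.R' j ▷ X ≫ (α_ _ _ _).hom) ≫ (α_ _ _ _).inv ≫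
    z ▷ (S.obj true j ⊗ X) ≫ A ◁ y

/-- Insertion of `R'_j` between the legs `k - 1` and `k`, absorbed into these legs, for `k ≥ 1`. -/
def insertAt : ℕ → ∀ L : List (E × Bool), S.tens L ⟶ S.tens L
  | 0, _ => 𝟙 _
  | _ + 1, [] => 𝟙 _
  | 1, g :: L => S.insertBetween j (Z g) (S.absorbFirst Y L)
  | k + 2, g :: L => S.A g.2 ◁ insertAt (k + 1) L

theorem insertAt_one_cons (g : E × Bool) (L : List (E × Bool)) :
    S.insertAt j Y Z 1 (g :: L) = S.insertBetween j (Z g) (S.absorbFirst Y L) := rfl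

theorem insertAt_succ_cons (k : ℕ) (g : E × Bool) (L : List (E × Bool)) :
    S.insertAt j Y Z (k + 2) (g :: L) = S.A g.2 ◁ S.insertAt j Y Z (k + 1) L := rfl

/-- The insertion touches only the legs `k` and `k + 1`, both of which belong to `L` by the bound.
-/
theorem insertAt_snoc (k : ℕ) (L : List (E × Bool)) (hk : k + 1 < L.length) (g : E × Bool) :
    S.insertAt j Y Z (k + 1) (L ++ [g]) =
      (S.tensSnoc L g).hom ≫ S.insertAt j Y Z (k + 1) L ▷ S.A g.2 ≫ (S.tensSnoc L g).inv := by
  induction k generalizing L with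
  | zero =>
    match L, hk with
    | h :: L, hk =>
      have hL : L ≠ [] := by rintro rfl; simp at hk
      refine (S.insertAt_one_cons j Y Z h (L ++ [g])).trans ?_
      rw [absorbFirst_snoc _ _ hL]
      change S.insertBetween j (Z h) _ = (S.A h.2 ◁ (S.tensSnoc L g).hom ≫ (α_ _ _ _).inv) ≫
        S.insertBetween j (Z h) (S.absorbFirst Y L) ▷ S.A g.2 ≫ (α_ _ _ _).hom ≫
          S.A h.2 ◁ (S.tensSnoc L g).inv
      simp only [insertBetween]
      calc _
        _ = 𝟙 _ ⊗≫ S.A h.2 ◁ (S.R' j ▷ S.tens (L ++ [g])) ⊗≫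
            (Z h ▷ (S.obj true j ⊗ S.tens (L ++ [g])) ≫
              S.A h.2 ◁ (S.obj true j ◁ (S.tensSnoc L g).hom)) ⊗≫
            S.A h.2 ◁ S.absorbFirst Y L ▷ S.A g.2 ⊗≫ S.A h.2 ◁ (S.tensSnoc L g).inv := by monoidal
        _ = 𝟙 _ ⊗≫ S.A h.2 ◁ (S.R' j ▷ S.tens (L ++ [g])) ⊗≫
            ((S.A h.2 ⊗ S.obj false j) ◁ (S.obj true j ◁ (S.tensSnoc L g).hom) ≫
              Z h ▷ (S.obj true j ⊗ S.tens L ⊗ S.A g.2)) ⊗≫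
            S.A h.2 ◁ S.absorbFirst Y L ▷ S.A g.2 ⊗≫ S.A h.2 ◁ (S.tensSnoc L g).inv := by
          rw [whisker_exchange]
        _ = 𝟙 _ ⊗≫ S.A h.2 ◁ (S.R' j ▷ S.tens (L ++ [g]) ≫
              (S.obj false j ⊗ S.obj true j) ◁ (S.tensSnoc L g).hom) ⊗≫
              Z h ▷ (S.obj true j ⊗ S.tens L ⊗ S.A g.2) ⊗≫
            S.A h.2 ◁ S.absorbFirst Y L ▷ S.A g.2 ⊗≫ S.A h.2 ◁ (S.tensSnoc L g).inv := by monoidal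
        _ = 𝟙 _ ⊗≫ S.A h.2 ◁ (𝟙_ C ◁ (S.tensSnoc L g).hom ≫ S.R' j ▷ (S.tens L ⊗ S.A g.2)) ⊗≫
              Z h ▷ (S.obj true j ⊗ S.tens L ⊗ S.A g.2) ⊗≫
            S.A h.2 ◁ S.absorbFirst Y L ▷ S.A g.2 ⊗≫ S.A h.2 ◁ (S.tensSnoc L g).inv := by
          rw [whisker_exchange]
        _ = _ := by monoidal
  | succ k ih =>
    match L, hk with
    | h :: L, hk =>
      refine (S.insertAt_succ_cons j Y Z k h (L ++ [g])).trans ?_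
      rw [ih L (by simpa using hk)]
      change _ = (S.A h.2 ◁ (S.tensSnoc L g).hom ≫ (α_ _ _ _).inv) ≫
        (S.A h.2 ◁ S.insertAt j Y Z (k + 1) L) ▷ S.A g.2 ≫ (α_ _ _ _).hom ≫
          S.A h.2 ◁ (S.tensSnoc L g).inv
      monoidal

/-- The boundary case of `insertAt_snoc`: the gap lies between the last leg of `L` and the appended
leg. It is the mirror image of the gap after a first leg. -/
theorem insertAt_last (L : List (E × Bool)) (hL : L ≠ []) (g : E × Bool) :
    S.insertAt j Y Z L.length (L ++ [g]) =
      (S.tensSnoc L g).hom ≫ S.insertBetween j (S.absorbLast Z L) (Y g) ≫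
        (S.tensSnoc L g).inv := by
  induction L with
  | nil => exact absurd rfl hL
  | cons h L ih =>
    by_cases hL' : L = []
    · subst hL'
      change S.insertBetween j (Z h) ((α_ _ _ _).inv ≫ Y g ▷ 𝟙_ C) =
        (S.A h.2 ◁ ((ρ_ _).hom ≫ (λ_ _).inv) ≫ (α_ _ _ _).inv) ≫
        S.insertBetween j ((ρ_ (S.A h.2)).hom ▷ _ ≫ Z h ≫ (ρ_ (S.A h.2)).inv) (Y g) ≫
        (α_ _ _ _).hom ≫ S.A h.2 ◁ ((λ_ _).hom ≫ (ρ_ _).inv)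
      simp only [insertBetween]
      monoidal
    · obtain ⟨k, hk⟩ : ∃ k, L.length = k + 1 :=
        Nat.exists_eq_succ_of_ne_zero (by simpa using hL')
      have ih := ih hL'
      rw [hk] at ih
      rw [List.length_cons, hk, absorbLast_cons _ _ _ hL']
      refine (S.insertAt_succ_cons j Y Z k h (L ++ [g])).trans ?_
      rw [ih]
      change _ = (S.A h.2 ◁ (S.tensSnoc L g).hom ≫ (α_ _ _ _).inv) ≫
        S.insertBetween j ((α_ _ _ _).hom ≫ S.A h.2 ◁ S.absorbLast Z L) (Y g) ≫
        (α_ _ _ _).hom ≫ S.A h.2 ◁ (S.tensSnoc L g).inv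
      simp only [insertBetween]
      monoidal

/-- Splitting off the last leg brings the contraction into the form required by
`DualPair.rotateInv_fuse_rotate`. -/
theorem fuse_snoc {L : List (E × Bool)} (hL : L ≠ []) (g : E × Bool)
    (w : 𝟙_ C ⟶ S.tens L ⊗ S.A g.2) :
    S.fuse j Y Z (L ++ [g]) (w ≫ (S.tensSnoc L g).inv) ≫ (S.tensSnoc L g).hom =
      S.R j ≫ S.obj true j ◁ ((λ_ (S.obj false j)).inv ≫ w ▷ S.obj false j) ≫
        S.obj true j ◁ ((α_ (S.tens L) (S.A g.2) (S.obj false j)).hom ≫ S.tens L ◁ Z g) ≫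
        (α_ (S.obj true j) (S.tens L) (S.A g.2)).inv ≫ S.absorbFirst Y L ▷ S.A g.2 := by
  have e1 : (S.tensSnoc L g).inv ▷ S.obj false j ≫ (S.tensSnoc L g).hom ▷ S.obj false j =
    𝟙 _ := by rw [← comp_whiskerRight]; simp
  have e2 : S.obj true j ◁ (S.tensSnoc L g).inv ≫ S.obj true j ◁ (S.tensSnoc L g).hom =
    𝟙 _ := by rw [← whiskerLeft_comp]; simp
  have e3 := congrArg (fun f => S.obj true j ◁ f) e1
  simp only [whiskerLeft_comp, MonoidalCategory.whiskerLeft_id] at e3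
  rw [fuse, absorbLast_snoc, absorbFirst_snoc _ _ hL]
  simp only [whiskerLeft_comp, comp_whiskerRight, Category.assoc, Iso.inv_hom_id,
    Category.comp_id, reassoc_of% e2, reassoc_of% e3]

/-- Contraction of a loop with the corner at a position `k ≥ 1` is the insertion at `k`. -/
theorem rhoInvN_fuse_rhoN (k : ℕ) (L : List (E × Bool)) (hk : k + 1 < L.length)
    (x : 𝟙_ C ⟶ S.tens L) :
    S.rhoInvN (k + 1) L (S.fuse j Y Z (rotN (k + 1) L) (S.rhoN (k + 1) L x)) =
      x ≫ S.insertAt j Y Z (k + 1) L := by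
  induction k generalizing L with
  | zero =>
    match L, hk, x with
    | g :: L, hk, x =>
      have hL : L ≠ [] := by rintro rfl; simp at hk
      refine Eq.trans ((S.rhoInv_cons g L _).trans (congrArg (fun w => (S.pairA g.2).rotateInv
        (S.fuse j Y Z (L ++ [g]) w ≫ (S.tensSnoc L g).hom)) (S.rho_cons g L x))) ?_
      exact (congrArg _ (S.fuse_snoc j Y Z hL g _)).trans
        ((S.pairA g.2).rotateInv_fuse_rotate (S.simplePair j) (Z g) (S.absorbFirst Y L) x)
  | succ k ih =>
    match L, hk, x with
    | g :: L, hk, x =>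
      have hk' : k + 1 < L.length := by simpa using hk
      -- After one rotation the insertion does not meet the leg `g`, now the last one, so it passes
      -- through the rotation and its inverse.
      have e : ∀ x : 𝟙_ C ⟶ S.A g.2 ⊗ S.tens L, (S.pairA g.2).rotateInv
          ((((S.pairA g.2).rotate x ≫ (S.tensSnoc L g).inv) ≫
          S.insertAt j Y Z (k + 1) (L ++ [g])) ≫ (S.tensSnoc L g).hom) =
          x ≫ S.A g.2 ◁ S.insertAt j Y Z (k + 1) L := by
        intro x
        rw [insertAt_snoc _ _ _ _ _ _ hk', ← DualPair.rotateInv_rotate (S.pairA g.2) (x ≫ _),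
          DualPair.rotate_comp]
        simp
      refine Eq.trans (congrArg (S.rhoInv (g :: L))
        (ih (L ++ [g]) (by simp only [List.length_append]; omega) _)) ?_
      refine Eq.trans ((S.rhoInv_cons g L _).trans (congrArg (fun w => (S.pairA g.2).rotateInv
            ((w ≫ S.insertAt j Y Z (k + 1) (L ++ [g])) ≫ (S.tensSnoc L g).hom))
              (S.rho_cons g L x))) ?_
      exact e x

end Insert

end SimpleObjects

end Rotation

end LevinWen

end

noncomputable section

namespace LevinWen

universe v u

open UnitaryFusionCategory

/-! ### Reflection of the legs of a vertex -/

section Mirror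

variable {C : Type u} [Category.{v} C] [Abelian C] [Linear ℂ C] [MonoidalCategory C]
  [MonoidalPreadditive C] [MonoidalLinear ℂ C] [UnitaryFusionCategory C]

namespace IsConj

variable {X X' X'' U U' : C} {D : DualPair X X'} {E : DualPair U U'} (e : X' ≅ X'')
  (he : dag e.hom = e.inv)

/-- The mirrored list grows at its end while `tens` nests to the right. The dual object of a nested
product must hence be moved along the unitary `tensSnoc`, and conjugacy with it. -/
theorem transport_transport {f : X ⟶ X} {f' : X' ⟶ X'} (h : IsConj D D f f') :
    IsConj (D.transport e he) (D.transport e he) f (e.inv ≫ f' ≫ e.hom) := by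
  simpa using ((transport_inv D e he).comp h).comp (transport D e he)

theorem transport_left {f : U ⊗ X ⟶ X} {f' : X' ⊗ U' ⟶ X'} (h : IsConj (E.prod D) D f f') :
    IsConj (E.prod (D.transport e he)) (D.transport e he) f (e.inv ▷ U' ≫ f' ≫ e.hom) := by
  simpa using ((whiskerLeft E (transport_inv D e he)).comp h).comp (transport D e he)

theorem transport_right {f : X ⊗ U ⟶ X} {f' : U' ⊗ X' ⟶ X'} (h : IsConj (D.prod E) D f f') :
    IsConj ((D.transport e he).prod E) (D.transport e he) f (U' ◁ e.inv ≫ f' ≫ e.hom) := by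
  simpa using (((transport_inv D e he).whiskerRight E).comp h).comp (transport D e he)

end IsConj

namespace SimpleObjects

variable (S : SimpleObjects C)

theorem dag_tensSnoc {E : Type*} (L : List (E × Bool)) (g : E × Bool) :
    dag (S.tensSnoc L g).hom = (S.tensSnoc L g).inv := by
  induction L with
  | nil =>
    change dag ((ρ_ (S.A g.2)).hom ≫ (λ_ (S.A g.2)).inv) =
      (λ_ (S.A g.2)).hom ≫ (ρ_ (S.A g.2)).inv
    simp
  | cons h L ih =>
    change dag (S.A h.2 ◁ (S.tensSnoc L g).hom ≫ (α_ (S.A h.2) (S.tens L) (S.A g.2)).inv) =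
      (α_ (S.A h.2) (S.tens L) (S.A g.2)).hom ≫ S.A h.2 ◁ (S.tensSnoc L g).inv
    simp [ih]

theorem dag_tensSnoc_symm {E : Type*} (L : List (E × Bool)) (g : E × Bool) :
    dag (S.tensSnoc L g).symm.hom = (S.tensSnoc L g).symm.inv := by
  rw [Iso.symm_hom, ← dag_tensSnoc, dag_dag, Iso.symm_inv]

variable {V E₀ E₁ : Type*} (Γ : HalfGraph V E₀ E₁)

/-- The duality between the legs of a vertex and those of its mirror image. -/
def tensPair : ∀ L : List (E₀ ⊕ E₁ × Bool),
    DualPair (S.tens (Γ.upList L)) (S.tens (Γ.downList L))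
  | [] => DualPair.unit C
  | d :: L => ((S.pairA (Γ.sgn d)).prod (tensPair L)).transport
      (S.tensSnoc (Γ.downList L) (Γ.down d)).symm (S.dag_tensSnoc_symm _ _)

theorem tensPair_cap (L : List (E₀ ⊕ E₁ × Bool)) :
    (S.tensPair Γ L).cap = mirrorCap S Γ L := by
  induction L with
  | nil => rfl
  | cons d L ih =>
    change ((S.pairA (Γ.sgn d)).prodCap (S.tensPair Γ L)) ≫
      (S.A (Γ.sgn d) ⊗ S.tens (Γ.upList L)) ◁ (S.tensSnoc (Γ.downList L) (Γ.down d)).inv =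
      S.capA (Γ.sgn d) ≫
      S.A (Γ.sgn d) ◁ ((λ_ (S.A (!Γ.sgn d))).inv ≫ mirrorCap S Γ L ▷ S.A (!Γ.sgn d) ≫
        (α_ (S.tens (Γ.upList L)) (S.tens (Γ.downList L)) (S.A (!Γ.sgn d))).hom ≫
        S.tens (Γ.upList L) ◁ (S.tensSnoc (Γ.downList L) (Γ.down d)).inv) ≫
      (α_ (S.A (Γ.sgn d)) (S.tens (Γ.upList L)) (S.tens (Γ.downList L ++ [Γ.down d]))).inv
    rw [DualPair.prodCap, pairA_cap, ih]
    monoidal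

theorem conjVertex_eq (L : List (E₀ ⊕ E₁ × Bool)) (x : 𝟙_ C ⟶ S.tens (Γ.upList L)) :
    conjVertex S Γ L x = (S.tensPair Γ L).conj x := by
  rw [conjVertex, DualPair.conj, tensPair_cap]

/-- On one leg, inclusions and their adjoints are conjugate to those of the dual summand; the
projections are then tensored together in reversed order. -/
theorem isConj_projLegs {l l' : E₀ ⊕ E₁ × Bool → S.Irr}
    (hl : ∀ d, l (Γ.up d).1 = l' (Γ.down d).1) (L : List (E₀ ⊕ E₁ × Bool)) :
    IsConj (S.tensPair Γ L) (S.tensPair Γ L) (S.projLegs l (Γ.upList L))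
      (S.projLegs l' (Γ.downList L)) := by
  have snoc : ∀ (L : List ((E₀ ⊕ E₁ × Bool) × Bool)) (g : (E₀ ⊕ E₁ × Bool) × Bool),
      S.projLegs l' (L ++ [g]) = (S.tensSnoc L g).hom ≫
        (S.projLegs l' L ⊗ₘ (dag (S.incl g.2 (l' g.1)) ≫ S.incl g.2 (l' g.1))) ≫
          (S.tensSnoc L g).inv := by
    intro L g
    induction L with
    | nil =>
      change (dag (S.incl g.2 (l' g.1)) ≫ S.incl g.2 (l' g.1)) ⊗ₘ 𝟙 (𝟙_ C) =
        ((ρ_ (S.A g.2)).hom ≫ (λ_ (S.A g.2)).inv) ≫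
        (𝟙 (𝟙_ C) ⊗ₘ (dag (S.incl g.2 (l' g.1)) ≫ S.incl g.2 (l' g.1))) ≫
          (λ_ (S.A g.2)).hom ≫ (ρ_ (S.A g.2)).inv
      rw [id_tensorHom, tensorHom_id]
      monoidal
    | cons h L ih =>
      change (dag (S.incl h.2 (l' h.1)) ≫ S.incl h.2 (l' h.1)) ⊗ₘ S.projLegs l' (L ++ [g]) =
        (S.A h.2 ◁ (S.tensSnoc L g).hom ≫ (α_ (S.A h.2) (S.tens L) (S.A g.2)).inv) ≫
        (((dag (S.incl h.2 (l' h.1)) ≫ S.incl h.2 (l' h.1)) ⊗ₘ S.projLegs l' L) ⊗ₘ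
          (dag (S.incl g.2 (l' g.1)) ≫ S.incl g.2 (l' g.1))) ≫
        (α_ (S.A h.2) (S.tens L) (S.A g.2)).hom ≫ S.A h.2 ◁ (S.tensSnoc L g).inv
      rw [ih, associator_naturality_assoc, Category.assoc, Iso.inv_hom_id_assoc, ← id_tensorHom,
        ← id_tensorHom, tensorHom_comp_tensorHom, tensorHom_comp_tensorHom, Category.comp_id,
        Category.id_comp]
  induction L with
  | nil => exact IsConj.id _
  | cons d L ih =>
    have h1 : IsConj (S.pairA (Γ.sgn d)) (S.pairA (Γ.sgn d))
        (dag (S.incl (Γ.up d).2 (l (Γ.up d).1)) ≫ S.incl (Γ.up d).2 (l (Γ.up d).1))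
        (dag (S.incl (Γ.down d).2 (l' (Γ.down d).1)) ≫ S.incl (Γ.down d).2 (l' (Γ.down d).1)) := by
      rw [← hl d]
      exact (S.isConj_dag_incl _ _).comp (S.isConj_incl _ _)
    exact (congrArg (IsConj _ _ _) (snoc (Γ.downList L) (Γ.down d))).mpr
      ((h1.tensorHom ih).transport_transport (S.tensSnoc (Γ.downList L) (Γ.down d)).symm
        (S.dag_tensSnoc_symm _ _))

variable {S} in
-- The inserted co-evaluation `R'_j` is its own conjugate, and the reflection exchanges the two
-- absorptions beside it.
theorem isConj_insertBetween {A A' X X' : C} {D : DualPair A A'} {D' : DualPair X X'} {j : S.Irr}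
    {z : A ⊗ S.obj false j ⟶ A} {z' : S.obj true j ⊗ A' ⟶ A'} {y : S.obj true j ⊗ X ⟶ X}
    {y' : X' ⊗ S.obj false j ⟶ X'}
    (hz : IsConj (D.prod (S.simplePair j).swap) D z z')
    (hy : IsConj ((S.simplePair j).prod D') D' y y') :
    IsConj (D.prod D') (D.prod D') (S.insertBetween j z y) (S.insertBetween j y' z') := by
  have hR : IsConj (DualPair.unit C) ((S.simplePair j).swap.prod (S.simplePair j)) (S.R' j)
    (S.R' j) := IsConj.cap (S.simplePair j).swap
  have h := (IsConj.whiskerLeft D (((IsConj.leftUnitor_inv D').comp (hR.whiskerRight D')).comp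
    (IsConj.associator _ _ _))).comp ((IsConj.associator_inv _ _ _).comp
    ((hz.whiskerRight _).comp (IsConj.whiskerLeft D hy)))
  have e1 : S.insertBetween j z y = _ ◁ (((λ_ _).inv ≫ S.R' j ▷ _) ≫ (α_ _ _ _).hom) ≫
      (α_ _ _ _).inv ≫ z ▷ _ ≫ _ ◁ y := by simp [insertBetween]
  have e2 : S.insertBetween j y' z' = (((ρ_ _).inv ≫ X' ◁ S.R' j) ≫ (α_ _ _ _).inv) ▷ A' ≫
      (α_ _ _ _).hom ≫ (X' ⊗ S.obj false j) ◁ z' ≫ y' ▷ A' := by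
    rw [whisker_exchange, insertBetween]
    monoidal
  rw [e1, e2]
  exact h

section Families

variable {Γ} {S} {j : S.Irr}
  {Y Y' : ∀ h : (E₀ ⊕ E₁ × Bool) × Bool, S.obj true j ⊗ S.A h.2 ⟶ S.A h.2}
  {Z Z' : ∀ g : (E₀ ⊕ E₁ × Bool) × Bool, S.A g.2 ⊗ S.obj false j ⟶ S.A g.2}
  (hY : ∀ d, IsConj ((S.simplePair j).prod (S.pairA (Γ.sgn d))) (S.pairA (Γ.sgn d)) (Y (Γ.up d))
    (Z' (Γ.down d)))
  (hZ : ∀ d, IsConj ((S.pairA (Γ.sgn d)).prod (S.simplePair j).swap) (S.pairA (Γ.sgn d))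
    (Z (Γ.up d)) (Y' (Γ.down d)))

theorem downList_ne_nil {L : List (E₀ ⊕ E₁ × Bool)} (hL : L ≠ []) : Γ.downList L ≠ [] := by
  cases L with
  | nil => exact absurd rfl hL
  | cons d L => simp [HalfGraph.downList]

theorem length_upList (L : List (E₀ ⊕ E₁ × Bool)) : (Γ.upList L).length = L.length := by
  induction L with
  | nil => rfl
  | cons d L ih => simp [HalfGraph.upList, ih]

theorem length_downList (L : List (E₀ ⊕ E₁ × Bool)) : (Γ.downList L).length = L.length := by
  induction L with
  | nil => rfl
  | cons d L ih => simp [HalfGraph.downList, ih]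

include hY in
theorem isConj_absorbFirst {L : List (E₀ ⊕ E₁ × Bool)} (hL : L ≠ []) :
    IsConj ((S.simplePair j).prod (S.tensPair Γ L)) (S.tensPair Γ L)
      (S.absorbFirst Y (Γ.upList L)) (S.absorbLast Z' (Γ.downList L)) := by
  cases L with
  | nil => exact absurd rfl hL
  | cons d L =>
    have e : S.absorbLast Z' (Γ.downList L ++ [Γ.down d]) =
        (S.tensSnoc (Γ.downList L) (Γ.down d)).hom ▷ S.obj false j ≫ ((α_ _ _ _).hom ≫
          S.tens (Γ.downList L) ◁ Z' (Γ.down d)) ≫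
            (S.tensSnoc (Γ.downList L) (Γ.down d)).inv := by
      rw [absorbLast_snoc, Category.assoc]
    exact (congrArg (IsConj _ _ _) e).mpr (((IsConj.associator_inv _ _ _).comp
      ((hY d).whiskerRight (S.tensPair Γ L))).transport_left
        (S.tensSnoc (Γ.downList L) (Γ.down d)).symm (S.dag_tensSnoc_symm _ _))

include hZ in
theorem isConj_absorbLast {L : List (E₀ ⊕ E₁ × Bool)} (hL : L ≠ []) :
    IsConj ((S.tensPair Γ L).prod (S.simplePair j).swap) (S.tensPair Γ L)
      (S.absorbLast Z (Γ.upList L)) (S.absorbFirst Y' (Γ.downList L)) := by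
  induction L with
  | nil => exact absurd rfl hL
  | cons d L ih =>
    by_cases hL' : L = []
    · subst hL'
      have e : S.absorbFirst Y' (Γ.downList [d]) = S.obj true j ◁ ((ρ_ _).hom ≫ (λ_ _).inv) ≫
          (S.obj true j ◁ (λ_ _).hom ≫ Y' (Γ.down d) ≫ (λ_ _).inv) ≫ (λ_ _).hom ≫ (ρ_ _).inv := by
        change (α_ _ _ _).inv ≫ Y' (Γ.down d) ▷ 𝟙_ C = _
        monoidal
      exact (congrArg (IsConj _ _ _) e).mpr
        ((((IsConj.rightUnitor (S.pairA (Γ.sgn d))).whiskerRight (S.simplePair j).swap).comp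
          ((hZ d).comp (IsConj.rightUnitor_inv (S.pairA (Γ.sgn d))))).transport_right
            (S.tensSnoc (Γ.downList []) (Γ.down d)).symm (S.dag_tensSnoc_symm _ _))
    · have e : S.absorbFirst Y' (Γ.downList L ++ [Γ.down d]) =
          S.obj true j ◁ (S.tensSnoc (Γ.downList L) (Γ.down d)).hom ≫ ((α_ _ _ _).inv ≫
          S.absorbFirst Y' (Γ.downList L) ▷ S.A (Γ.down d).2) ≫
            (S.tensSnoc (Γ.downList L) (Γ.down d)).inv := by
        rw [absorbFirst_snoc _ _ (downList_ne_nil hL'), Category.assoc]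
      have e' := S.absorbLast_cons Z (Γ.up d) (L := Γ.upList L)
        (by rwa [ne_eq, ← List.length_eq_zero_iff, length_upList, List.length_eq_zero_iff])
      exact (congrArg₂ (IsConj _ _) e' e).mpr (((IsConj.associator _ _ _).comp
        (IsConj.whiskerLeft (S.pairA (Γ.sgn d)) (ih hL'))).transport_right
          (S.tensSnoc (Γ.downList L) (Γ.down d)).symm (S.dag_tensSnoc_symm _ _))

-- Reversing the list sends the gap before leg `k + 1` to the gap before leg `n - (k + 1)` of the
-- mirrored list of length `n`.
include hY hZ in
theorem isConj_insertAt (k : ℕ) (L : List (E₀ ⊕ E₁ × Bool)) (hk : k + 1 < L.length) :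
    IsConj (S.tensPair Γ L) (S.tensPair Γ L) (S.insertAt j Y Z (k + 1) (Γ.upList L))
      (S.insertAt j Y' Z' (L.length - (k + 1)) (Γ.downList L)) := by
  induction L generalizing k with
  | nil => simp at hk
  | cons d L ih =>
    cases k with
    | zero =>
      have hL : L ≠ [] := by rintro rfl; simp at hk
      have e := S.insertAt_last j Y' Z' _ (downList_ne_nil (Γ := Γ) hL) (Γ.down d)
      rw [length_downList] at e
      exact (congrArg (IsConj _ _ _) e).mpr
        ((isConj_insertBetween (hZ d) (isConj_absorbFirst hY hL)).transport_transport
          (S.tensSnoc (Γ.downList L) (Γ.down d)).symm (S.dag_tensSnoc_symm _ _))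
    | succ k =>
      have hk' : k + 1 < L.length := by simpa using hk
      have h := ih k hk'
      obtain ⟨m, hm⟩ : ∃ m, L.length - (k + 1) = m + 1 :=
        Nat.exists_eq_succ_of_ne_zero (by omega)
      have e := S.insertAt_snoc j Y' Z' m (Γ.downList L) (by rw [length_downList]; omega)
        (Γ.down d)
      have hm' : (d :: L).length - (k + 1 + 1) = m + 1 := by rw [List.length_cons]; omega
      rw [hm] at h
      rw [hm']
      exact (congrArg (IsConj _ _ _) e).mpr
        ((IsConj.whiskerLeft (S.pairA (Γ.sgn d)) h).transport_transport
          (S.tensSnoc (Γ.downList L) (Γ.down d)).symm (S.dag_tensSnoc_symm _ _))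

/-- With at least two legs, the first and the last are different, so the exchange law applies. -/
theorem absorbFirst_comp_absorbLast {E : Type*}
    (Y : ∀ h : E × Bool, S.obj true j ⊗ S.A h.2 ⟶ S.A h.2)
    (Z : ∀ g : E × Bool, S.A g.2 ⊗ S.obj false j ⟶ S.A g.2)
    (L : List (E × Bool)) (hL : 1 < L.length) :
    S.absorbFirst Y L ▷ S.obj false j ≫ S.absorbLast Z L =
      (α_ _ _ _).hom ≫ S.obj true j ◁ S.absorbLast Z L ≫ S.absorbFirst Y L := by
  match L, hL with
  | g :: L, hL =>
    have hL' : L ≠ [] := by rintro rfl; simp at hL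
    rw [S.absorbLast_cons Z g hL']
    change ((α_ _ _ _).inv ≫ Y g ▷ S.tens L) ▷ S.obj false j ≫ (α_ _ _ _).hom ≫
        S.A g.2 ◁ S.absorbLast Z L = (α_ (S.obj true j) (S.A g.2 ⊗ S.tens L) (S.obj false j)).hom ≫
        S.obj true j ◁ ((α_ _ _ _).hom ≫ S.A g.2 ◁ S.absorbLast Z L) ≫ (α_ _ _ _).inv ≫
        Y g ▷ S.tens L
    calc _
      _ = 𝟙 _ ⊗≫ (Y g ▷ (S.tens L ⊗ S.obj false j) ≫ S.A g.2 ◁ S.absorbLast Z L) := by monoidal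
      _ = 𝟙 _ ⊗≫ ((S.obj true j ⊗ S.A g.2) ◁ S.absorbLast Z L ≫ Y g ▷ S.tens L) := by
        rw [whisker_exchange]
      _ = _ := by monoidal

-- The co-evaluation `R_j` is self-conjugate and the reflection exchanges absorption at the first
-- leg with absorption at the last, so the contraction without rotation keeps its form.
include hY hZ in
theorem conjVertex_fuse (L : List (E₀ ⊕ E₁ × Bool)) (hL : 1 < L.length)
    (x : 𝟙_ C ⟶ S.tens (Γ.upList L)) :
    conjVertex S Γ L (S.fuse j Y Z (Γ.upList L) x) =
      S.fuse j Y' Z' (Γ.downList L) (conjVertex S Γ L x) := by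
  have hL' : L ≠ [] := by rintro rfl; simp at hL
  rw [conjVertex_eq, conjVertex_eq]
  refine (IsConj.eq_conj ?_).symm
  have hR : IsConj (DualPair.unit C) ((S.simplePair j).prod (S.simplePair j).swap) (S.R j)
    (S.R j) := IsConj.cap (S.simplePair j)
  have h := hR.comp ((IsConj.whiskerLeft (S.simplePair j)
    ((IsConj.leftUnitor_inv (S.simplePair j).swap).comp
      ((IsConj.conj (S.tensPair Γ L) x).whiskerRight _))).comp
    ((IsConj.whiskerLeft (S.simplePair j) (isConj_absorbLast hZ hL')).comp
      (isConj_absorbFirst hY hL')))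
  -- The calculus yields the mirrored diagram with the left absorption performed first, opposite to
  -- the order in `fuse`.
  have e : S.fuse j Y' Z' (Γ.downList L) ((S.tensPair Γ L).conj x) =
      S.R j ≫ ((ρ_ (S.obj true j)).inv ≫ S.obj true j ◁ (S.tensPair Γ L).conj x) ▷ S.obj false j ≫
      S.absorbFirst Y' (Γ.downList L) ▷ S.obj false j ≫ S.absorbLast Z' (Γ.downList L) := by
    rw [fuse, absorbFirst_comp_absorbLast _ _ _ (by rwa [length_downList])]
    monoidal
  rw [e]
  exact h

end Families

section Commute

variable {E : Type*} (j : S.Irr) (Y : ∀ h : E × Bool, S.obj true j ⊗ S.A h.2 ⟶ S.A h.2)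
  (Z : ∀ g : E × Bool, S.A g.2 ⊗ S.obj false j ⟶ S.A g.2)

theorem absorbFirst_insertAt (k : ℕ) (L : List (E × Bool)) :
    S.obj true j ◁ S.insertAt j Y Z (k + 2) L ≫ S.absorbFirst Y L =
      S.absorbFirst Y L ≫ S.insertAt j Y Z (k + 2) L := by
  cases L with
  | nil => simp [absorbFirst]
  | cons g L =>
    change S.obj true j ◁ (S.A g.2 ◁ S.insertAt j Y Z (k + 1) L) ≫ (α_ _ _ _).inv ≫
      Y g ▷ S.tens L = ((α_ _ _ _).inv ≫ Y g ▷ S.tens L) ≫ S.A g.2 ◁ S.insertAt j Y Z (k + 1) L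
    rw [Category.assoc, ← whisker_exchange]
    monoidal

/-- The bound says that the last leg comes after the legs `k` and `k + 1` touched by the insertion.
-/
theorem insertAt_absorbLast (k : ℕ) (L : List (E × Bool)) (hk : k + 2 < L.length) :
    S.insertAt j Y Z (k + 1) L ▷ S.obj false j ≫ S.absorbLast Z L =
      S.absorbLast Z L ≫ S.insertAt j Y Z (k + 1) L := by
  induction k generalizing L with
  | zero =>
    match L, hk with
    | g :: L, hk =>
      have hk' : 1 < L.length := by rw [List.length_cons] at hk; omega
      have hL' : L ≠ [] := by rintro rfl; simp at hk'
      have e := absorbFirst_comp_absorbLast Y Z L hk'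
      rw [S.absorbLast_cons Z g hL']
      change S.insertBetween j (Z g) (S.absorbFirst Y L) ▷ S.obj false j ≫ (α_ _ _ _).hom ≫
        S.A g.2 ◁ S.absorbLast Z L = ((α_ _ _ _).hom ≫ S.A g.2 ◁ S.absorbLast Z L) ≫
        S.insertBetween j (Z g) (S.absorbFirst Y L)
      simp only [insertBetween]
      calc _
        _ = 𝟙 _ ⊗≫ S.A g.2 ◁ S.R' j ▷ (S.tens L ⊗ S.obj false j) ⊗≫
            Z g ▷ (S.obj true j ⊗ S.tens L ⊗ S.obj false j) ⊗≫
            S.A g.2 ◁ (S.absorbFirst Y L ▷ S.obj false j ≫ S.absorbLast Z L) := by monoidal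
        _ = 𝟙 _ ⊗≫ S.A g.2 ◁ S.R' j ▷ (S.tens L ⊗ S.obj false j) ⊗≫
            (Z g ▷ (S.obj true j ⊗ S.tens L ⊗ S.obj false j) ≫
            S.A g.2 ◁ S.obj true j ◁ S.absorbLast Z L) ⊗≫ S.A g.2 ◁ S.absorbFirst Y L := by
          rw [e]; monoidal
        _ = 𝟙 _ ⊗≫ S.A g.2 ◁ (S.R' j ▷ (S.tens L ⊗ S.obj false j) ≫
            (S.obj false j ⊗ S.obj true j) ◁ S.absorbLast Z L) ⊗≫
            Z g ▷ (S.obj true j ⊗ S.tens L) ⊗≫ S.A g.2 ◁ S.absorbFirst Y L := by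
          rw [← whisker_exchange]; monoidal
        _ = _ := by
          rw [← whisker_exchange]; monoidal
  | succ k ih =>
    match L, hk with
    | g :: L, hk =>
      have hk' : k + 2 < L.length := by rw [List.length_cons] at hk; omega
      have hL' : L ≠ [] := by rintro rfl; simp at hk'
      rw [S.absorbLast_cons Z g hL']
      change (S.A g.2 ◁ S.insertAt j Y Z (k + 1) L) ▷ S.obj false j ≫ (α_ _ _ _).hom ≫
        S.A g.2 ◁ S.absorbLast Z L = ((α_ _ _ _).hom ≫ S.A g.2 ◁ S.absorbLast Z L) ≫
        S.A g.2 ◁ S.insertAt j Y Z (k + 1) L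
      rw [Category.assoc, ← whiskerLeft_comp, ← ih L hk']
      monoidal

/-- The insertion touches the legs `k + 1` and `k + 2`, neither of which is the first or the last,
the two legs at which the loop is absorbed. -/
theorem fuse_insertAt (k : ℕ) (L : List (E × Bool)) (hk : k + 3 < L.length)
    (x : 𝟙_ C ⟶ S.tens L) :
    S.fuse j Y Z L (x ≫ S.insertAt j Y Z (k + 2) L) =
      S.fuse j Y Z L x ≫ S.insertAt j Y Z (k + 2) L := by
  simp only [fuse, Category.assoc, comp_whiskerRight, whiskerLeft_comp]
  rw [← absorbFirst_insertAt, ← whiskerLeft_comp_assoc (S.obj true j) (S.absorbLast Z L),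
    ← S.insertAt_absorbLast j Y Z (k + 1) L hk, whiskerLeft_comp_assoc]

/-- The gaps are at distance at least two, so the two insertions involve four different legs. -/
theorem insertAt_comm (k l : ℕ) (L : List (E × Bool)) :
    S.insertAt j Y Z (k + 1) L ≫ S.insertAt j Y Z (k + l + 3) L =
      S.insertAt j Y Z (k + l + 3) L ≫ S.insertAt j Y Z (k + 1) L := by
  induction k generalizing L with
  | zero =>
    match L with
    | [] => rfl
    | g :: L =>
      have e := S.absorbFirst_insertAt j Y Z l L
      rw [show 0 + l + 3 = (l + 1) + 2 by ring]
      change S.insertBetween j (Z g) (S.absorbFirst Y L) ≫ S.A g.2 ◁ S.insertAt j Y Z (l + 2) L =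
        S.A g.2 ◁ S.insertAt j Y Z (l + 2) L ≫ S.insertBetween j (Z g) (S.absorbFirst Y L)
      simp only [insertBetween]
      generalize S.insertAt j Y Z (l + 2) L = T at e
      calc _
        _ = 𝟙 _ ⊗≫ S.A g.2 ◁ S.R' j ▷ S.tens L ⊗≫ Z g ▷ (S.obj true j ⊗ S.tens L) ⊗≫
            S.A g.2 ◁ (S.absorbFirst Y L ≫ T) := by monoidal
        _ = 𝟙 _ ⊗≫ S.A g.2 ◁ S.R' j ▷ S.tens L ⊗≫ (Z g ▷ (S.obj true j ⊗ S.tens L) ≫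
            S.A g.2 ◁ S.obj true j ◁ T) ⊗≫ S.A g.2 ◁ S.absorbFirst Y L := by rw [← e]; monoidal
        _ = 𝟙 _ ⊗≫ S.A g.2 ◁ (S.R' j ▷ S.tens L ≫ (S.obj false j ⊗ S.obj true j) ◁ T) ⊗≫
            Z g ▷ (S.obj true j ⊗ S.tens L) ⊗≫ S.A g.2 ◁ S.absorbFirst Y L := by
          rw [← whisker_exchange]; monoidal
        _ = _ := by rw [← whisker_exchange]; monoidal
  | succ k ih =>
    match L with
    | [] => exact (Category.comp_id _).trans (Category.id_comp _).symm
    | g :: L =>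
      have h1 : S.insertAt j Y Z (k + 1 + l + 3) (g :: L) =
          S.A g.2 ◁ S.insertAt j Y Z (k + l + 3) L := by
        rw [show k + 1 + l + 3 = (k + l + 2) + 2 by ring]; rfl
      rw [h1]
      change S.A g.2 ◁ S.insertAt j Y Z (k + 1) L ≫ S.A g.2 ◁ S.insertAt j Y Z (k + l + 3) L =
        S.A g.2 ◁ S.insertAt j Y Z (k + l + 3) L ≫ S.A g.2 ◁ S.insertAt j Y Z (k + 1) L
      rw [← whiskerLeft_comp, ih, whiskerLeft_comp]

end Commute

end SimpleObjects

end Mirror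

end LevinWen

end

noncomputable section

namespace LevinWen

universe v u

open UnitaryFusionCategory

/-! ### Products of corner operators and their reflection -/

section Corners

variable {C : Type u} [Category.{v} C] [Abelian C] [Linear ℂ C] [MonoidalCategory C]
  [MonoidalPreadditive C] [MonoidalLinear ℂ C] [UnitaryFusionCategory C]

namespace SimpleObjects

variable {S : SimpleObjects C}

section CornerAt

variable {E : Type*} (j : S.Irr) (Y : ∀ h : E × Bool, S.obj true j ⊗ S.A h.2 ⟶ S.A h.2)
  (Z : ∀ g : E × Bool, S.A g.2 ⊗ S.obj false j ⟶ S.A g.2)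

/-- The operator `ρ^(-k) C_{y,z} ρ^k` at the corner before the leg `k`. -/
def cornerAt (L : List (E × Bool)) (k : ℕ) (x : 𝟙_ C ⟶ S.tens L) : 𝟙_ C ⟶ S.tens L :=
  S.rhoInvN k L (S.fuse j Y Z (rotN k L) (S.rhoN k L x))

theorem cornerAt_zero (L : List (E × Bool)) (x : 𝟙_ C ⟶ S.tens L) :
    cornerAt j Y Z L 0 x = S.fuse j Y Z L x := rfl

theorem cornerAt_succ (L : List (E × Bool)) (k : ℕ) (hk : k + 1 < L.length)
    (x : 𝟙_ C ⟶ S.tens L) :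
    cornerAt j Y Z L (k + 1) x = x ≫ S.insertAt j Y Z (k + 1) L :=
  S.rhoInvN_fuse_rhoN j Y Z k L hk x

/-- Operators at corners that are not neighbours commute. -/
theorem cornerAt_comm {L : List (E × Bool)} {k l : ℕ} (hkl : k + 1 < l) (hl : l < L.length)
    (h : k = 0 → l + 1 ≠ L.length) (x : 𝟙_ C ⟶ S.tens L) :
    cornerAt j Y Z L k (cornerAt j Y Z L l x) = cornerAt j Y Z L l (cornerAt j Y Z L k x) := by
  obtain ⟨m, rfl⟩ := Nat.exists_eq_add_of_lt hkl
  cases k with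
  | zero =>
    -- The corner `0` lies between the last and the first leg and so is also a neighbour of the
    -- corner before the last leg; this is the case excluded by `h`.
    have h := h rfl
    rw [show 0 + 1 + m + 1 = (m + 1) + 1 by ring] at *
    rw [cornerAt_succ _ _ _ _ _ hl, cornerAt_succ _ _ _ _ _ hl, cornerAt_zero, cornerAt_zero,
      fuse_insertAt _ _ _ _ _ _ (by omega)]
  | succ k =>
    rw [show k + 1 + 1 + m + 1 = (k + m + 2) + 1 by ring] at *
    rw [cornerAt_succ _ _ _ _ _ hl, cornerAt_succ _ _ _ _ _ hl,
      cornerAt_succ _ _ _ _ _ (by omega), cornerAt_succ _ _ _ _ _ (by omega), Category.assoc,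
      Category.assoc, insertAt_comm]

open Classical in
/-- The product of the operators at the corners of the plaquette `p` at a vertex. -/
def loopOp (p : Finset (E × Bool)) (L : List (E × Bool)) (x : 𝟙_ C ⟶ S.tens L) :
    𝟙_ C ⟶ S.tens L :=
  L.foldr (fun h x => if h ∈ p then S.cornerOp j Y Z L h x else x) x

open Classical in
theorem loopOp_eq (p : Finset (E × Bool)) {L : List (E × Bool)} (hL : L.Nodup)
    (x : 𝟙_ C ⟶ S.tens L) :
    loopOp j Y Z p L x = (List.finRange L.length).foldr
      (fun k x => if L.get k ∈ p then cornerAt j Y Z L k x else x) x := by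
  have h : ∀ f : E × Bool → (𝟙_ C ⟶ S.tens L) → (𝟙_ C ⟶ S.tens L),
      L.foldr f x = (List.finRange L.length).foldr (fun k => f (L.get k)) x := by
    intro f
    rw [← List.foldr_map (f := L.get) (g := f)]
    rw [← List.ofFn_eq_map, List.ofFn_get]
  rw [loopOp, h]
  congr 1
  funext k y
  split_ifs
  · rw [cornerOp, cornerAt]
    have e : List.idxOf (L.get k) L = k := hL.idxOf_getElem k k.2
    rw [e]
  · rfl

end CornerAt

section CornerMirror

variable {V E₀ E₁ : Type*} {Γ : HalfGraph V E₀ E₁} {j : S.Irr}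
  {Y Y' : ∀ h : (E₀ ⊕ E₁ × Bool) × Bool, S.obj true j ⊗ S.A h.2 ⟶ S.A h.2}
  {Z Z' : ∀ g : (E₀ ⊕ E₁ × Bool) × Bool, S.A g.2 ⊗ S.obj false j ⟶ S.A g.2}
  (hY : ∀ d, IsConj ((S.simplePair j).prod (S.pairA (Γ.sgn d))) (S.pairA (Γ.sgn d)) (Y (Γ.up d))
    (Z' (Γ.down d)))
  (hZ : ∀ d, IsConj ((S.pairA (Γ.sgn d)).prod (S.simplePair j).swap) (S.pairA (Γ.sgn d))
    (Z (Γ.up d)) (Y' (Γ.down d)))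

-- The reflection acts on the cyclically ordered gaps as `k ↦ -k`. The gap `0`, where the list is
-- cut, is fixed and treated by `conjVertex_fuse`; the others are insertions.
include hY hZ in
theorem conjVertex_cornerAt {L : List (E₀ ⊕ E₁ × Bool)} (hL : 1 < L.length) {k : ℕ}
    (hk : k < L.length) (x : 𝟙_ C ⟶ S.tens (Γ.upList L)) :
    conjVertex S Γ L (cornerAt j Y Z (Γ.upList L) k x) =
      cornerAt j Y' Z' (Γ.downList L) ((L.length - k) % L.length) (conjVertex S Γ L x) := by
  cases k with
  | zero =>
    rw [Nat.sub_zero, Nat.mod_self, cornerAt_zero, cornerAt_zero]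
    exact conjVertex_fuse hY hZ L hL x
  | succ k =>
    rw [Nat.mod_eq_of_lt (by omega)]
    have h := isConj_insertAt hY hZ k L hk
    obtain ⟨m, hm⟩ : ∃ m, L.length - (k + 1) = m + 1 :=
      Nat.exists_eq_succ_of_ne_zero (by omega)
    rw [hm] at h ⊢
    rw [cornerAt_succ _ _ _ _ _ (by rwa [length_upList]),
      cornerAt_succ _ _ _ _ _ (by rw [length_downList]; omega), conjVertex_eq, conjVertex_eq]
    exact (IsConj.eq_conj ((IsConj.conj _ x).comp h)).symm

theorem upList_eq_map (L : List (E₀ ⊕ E₁ × Bool)) : Γ.upList L = L.map Γ.up := by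
  induction L with
  | nil => rfl
  | cons d L ih => simp [HalfGraph.upList, ih]

theorem downList_eq_map (L : List (E₀ ⊕ E₁ × Bool)) : Γ.downList L = (L.map Γ.down).reverse := by
  induction L with
  | nil => rfl
  | cons d L ih => simp [HalfGraph.downList, ih]

/-- The half-edges of `p` at a vertex with links `L` are the successors of the other ends of the
half-edges of `p` that precede them, and no plaquette is on both sides of an edge. -/
structure IsCornerSet {E : Type*} (p : Finset (E × Bool)) (L : List (E × Bool)) : Prop where
  nodup : L.Nodup
  succ_mem : ∀ (k : ℕ) (hk : k < L.length),
    L[(k + 1) % L.length]'(Nat.mod_lt _ (by omega)) ∈ p ↔ opp L[k] ∈ p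
  opp_notMem : ∀ h ∈ p, opp h ∉ p

/-- If the legs `k` and `k + 1` both belonged to `p`, then so would both halves of the edge at `k`.
-/
theorem IsCornerSet.not_succ {E : Type*} {p : Finset (E × Bool)} {L : List (E × Bool)}
    (h : IsCornerSet p L) {k l : ℕ} (hk : k < L.length) (hl : l < L.length) (hkp : L[k] ∈ p)
    (hlp : L[l] ∈ p) : l ≠ (k + 1) % L.length := by
  rintro rfl
  exact h.opp_notMem _ hkp ((h.succ_mem k hk).1 hlp)

-- Two different corners of `p` at one vertex are never neighbours, so their operators commute and
-- may be multiplied in any order, in particular in the one produced by the reflection.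
open Classical in
theorem loopOp_perm {E : Type*} {p : Finset (E × Bool)} {L : List (E × Bool)}
    (Y : ∀ h : E × Bool, S.obj true j ⊗ S.A h.2 ⟶ S.A h.2)
    (Z : ∀ g : E × Bool, S.A g.2 ⊗ S.obj false j ⟶ S.A g.2) (h : IsCornerSet p L)
    {K : List (Fin L.length)} (hK : K.Perm (List.finRange L.length)) (x : 𝟙_ C ⟶ S.tens L) :
    loopOp j Y Z p L x =
      K.foldr (fun k x => if L.get k ∈ p then cornerAt j Y Z L k x else x) x := by
  rw [loopOp_eq _ _ _ _ h.nodup]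
  refine (hK.foldr_eq' (fun k _ l _ y => ?_) x).symm
  have key : ∀ k l : Fin L.length, k < l → L.get k ∈ p → L.get l ∈ p → ∀ y,
      cornerAt j Y Z L k (cornerAt j Y Z L l y) = cornerAt j Y Z L l (cornerAt j Y Z L k y) := by
    intro k l hkl hk hl y
    have h1 := h.not_succ k.2 l.2 hk hl
    have h2 := h.not_succ l.2 k.2 hl hk
    have hkl' : (k : ℕ) < l := hkl
    have hl' := l.2
    rw [Nat.mod_eq_of_lt (by omega)] at h1
    refine cornerAt_comm j Y Z (by omega) l.2 (fun hk0 hl0 => h2 ?_) y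
    rw [hl0, Nat.mod_self, hk0]
  by_cases hk : L.get k ∈ p <;> by_cases hl : L.get l ∈ p <;> simp only [hk, hl, if_true, if_false]
  rcases lt_trichotomy k l with hkl | rfl | hkl
  · exact (key k l hkl hk hl y).symm
  · rfl
  · exact key l k hkl hl hk y

include hY hZ in
theorem conjVertex_loopOp {p p' : Finset ((E₀ ⊕ E₁ × Bool) × Bool)} {L : List (E₀ ⊕ E₁ × Bool)}
    (h : IsCornerSet p (Γ.upList L)) (h' : IsCornerSet p' (Γ.downList L))
    (hpp : ∀ d, opp (Γ.up d) ∈ p ↔ Γ.down d ∈ p') (x : 𝟙_ C ⟶ S.tens (Γ.upList L)) :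
    conjVertex S Γ L (loopOp j Y Z p (Γ.upList L) x) =
      loopOp j Y' Z' p' (Γ.downList L) (conjVertex S Γ L x) := by
  classical
  have hn : (Γ.downList L).length = L.length := length_downList L
  have hn' : (Γ.upList L).length = L.length := length_upList L
  -- The action of the reflection on the gaps, a bijection that need not respect the order in which
  -- the corners of the mirror image are listed.
  let σ : Fin (Γ.upList L).length → Fin (Γ.downList L).length := fun k =>
    ⟨(L.length - k) % L.length, by
      rw [hn]; exact Nat.mod_lt _ (by have := k.2; omega)⟩
  have hσ : Function.Bijective σ := by
    rw [Fintype.bijective_iff_injective_and_card]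
    refine ⟨fun k l hkl => ?_, by simp [hn, hn']⟩
    have hkl := congrArg Fin.val hkl
    have hk : (k : ℕ) < L.length := lt_of_lt_of_eq k.2 hn'
    have hl : (l : ℕ) < L.length := lt_of_lt_of_eq l.2 hn'
    simp only [σ] at hkl
    ext
    by_cases hk0 : (k : ℕ) = 0 <;> by_cases hl0 : (l : ℕ) = 0
    · omega
    · rw [hk0, Nat.sub_zero, Nat.mod_self, Nat.mod_eq_of_lt (by omega)] at hkl
      omega
    · rw [hl0, Nat.sub_zero, Nat.mod_self, Nat.mod_eq_of_lt (by omega)] at hkl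
      omega
    · rw [Nat.mod_eq_of_lt (by omega), Nat.mod_eq_of_lt (by omega)] at hkl
      omega
  have hK : ((List.finRange (Γ.upList L).length).map σ).Perm
      (List.finRange (Γ.downList L).length) := by
    refine (List.perm_ext_iff_of_nodup ((List.nodup_finRange _).map hσ.1)
      (List.nodup_finRange _)).2 fun a => ?_
    simpa using hσ.2 a
  rw [loopOp_eq _ _ _ _ h.nodup, loopOp_perm Y' Z' h' hK, List.foldr_map]
  have hmem : ∀ k : Fin (Γ.upList L).length,
      (Γ.upList L).get k ∈ p ↔ (Γ.downList L).get (σ k) ∈ p' := by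
    intro k
    have hk : (k : ℕ) < L.length := lt_of_lt_of_eq k.2 hn'
    have hdown : ∀ i (hi : i < L.length) (hi' : (L.length - (i + 1)) < (Γ.downList L).length),
        (Γ.downList L)[L.length - (i + 1)] = Γ.down L[i] := by
      intro i hi hi'
      simp only [downList_eq_map, List.getElem_reverse, List.length_map, List.getElem_map]
      congr 2
      omega
    have hup : ∀ i (hi : i < (Γ.upList L).length) (hi' : i < L.length),
        (Γ.upList L)[i] = Γ.up L[i] := by
      intro i hi hi'
      simp only [upList_eq_map, List.getElem_map]
    -- Here `i` is the leg that cyclically precedes the gap `k`. Its mirror image is the leg that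
    -- follows the mirrored gap, so membership in `p'` is decided by the other half of the edge at
    -- `i`.
    obtain ⟨i, hi, hik, hiσ⟩ : ∃ i, ∃ hi : i < L.length, (i + 1) % L.length = k ∧
        (σ k : ℕ) = L.length - (i + 1) := by
      by_cases hk0 : (k : ℕ) = 0
      · refine ⟨L.length - 1, by omega, ?_, ?_⟩
        · rw [Nat.sub_add_cancel (by omega), Nat.mod_self, hk0]
        · simp only [σ, hk0, Nat.sub_zero, Nat.mod_self]; omega
      · refine ⟨k - 1, by omega, ?_, ?_⟩
        · rw [Nat.sub_add_cancel (by omega), Nat.mod_eq_of_lt hk]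
        · simp only [σ]
          rw [Nat.mod_eq_of_lt (by omega), Nat.sub_add_cancel (by omega)]
    have e1 : (Γ.upList L).get k =
        (Γ.upList L)[(i + 1) % (Γ.upList L).length]'(Nat.mod_lt _ (by omega)) := by
      simp only [List.get_eq_getElem, hn', hik]
    have e2 : (Γ.downList L).get (σ k) = Γ.down L[i] := by
      rw [← hdown i hi (by omega)]
      simp only [List.get_eq_getElem, hiσ]
    rw [e1, e2, h.succ_mem i (by omega), hup i (by omega) hi, hpp]
  -- A single leg would be its own cyclic successor, contrary to `IsCornerSet.not_succ`.
  have hlen : ∀ k : Fin (Γ.upList L).length, (Γ.upList L).get k ∈ p → 1 < L.length := by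
    intro k hk
    by_contra hL
    have hk' := k.2
    have h1 : (Γ.upList L).length = 1 := by omega
    have h2 : ∀ m n : ℕ, n = 1 → m < n → m = (m + 1) % n := by
      rintro m _ rfl hm
      omega
    exact h.not_succ k.2 k.2 hk hk (h2 _ _ h1 k.2)
  induction List.finRange (Γ.upList L).length with
  | nil => rfl
  | cons k K ih =>
    rw [List.foldr_cons, List.foldr_cons, ← ih]
    by_cases hk : (Γ.upList L).get k ∈ p
    · rw [if_pos hk, if_pos ((hmem k).1 hk)]
      exact conjVertex_cornerAt hY hZ (hlen k hk) (by have := k.2; omega) _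
    · rw [if_neg hk, if_neg (fun h => hk ((hmem k).2 h))]

end CornerMirror

end SimpleObjects

end Corners

end LevinWen

end

noncomputable section

namespace LevinWen

universe v u

open SimpleObjects

@[simp] theorem opp_opp {E : Type*} (h : E × Bool) : opp (opp h) = h := by simp [opp]

/-! ### Plaquettes as cycles of a permutation -/

namespace RibbonGraph

variable {V E : Type*} (G : RibbonGraph V E)

theorem opp_mem_link (h : E × Bool) : opp h ∈ G.link (G.base (opp h)) := (G.mem_link _ _).2 rfl

theorem base_next (h : E × Bool) : G.base (G.next h) = G.base (opp h) := by
  classical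
  rw [← G.mem_link, next]
  convert (List.formPerm_mem_iff_mem (l := G.link (G.base (opp h))) (x := opp h)).2
    (G.opp_mem_link h)

theorem next_injective : Function.Injective G.next := by
  classical
  intro h h' e
  have hb : G.base (opp h) = G.base (opp h') := by rw [← base_next, e, base_next]
  rw [next, next, hb] at e
  have := (List.formPerm (G.link (G.base (opp h')))).injective e
  simpa using congrArg opp this

section Finite

variable [Fintype E]

/-- The walk around the plaquettes as a permutation of the half-edges. -/
def nextPerm : Equiv.Perm (E × Bool) :=
  Equiv.ofBijective G.next (Finite.injective_iff_bijective.1 G.next_injective)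

theorem nextPerm_apply (h : E × Bool) : G.nextPerm h = G.next h := rfl

theorem nextPerm_pow_apply (n : ℕ) (h : E × Bool) : (G.nextPerm ^ n) h = G.next^[n] h := by
  rw [← Equiv.Perm.iterate_eq_pow]; rfl

/-- For a permutation of a finite set, a forward orbit is a full cycle. -/
theorem mem_plaquettes {p : Finset (E × Bool)} :
    p ∈ G.plaquettes ↔ ∃ h, ∀ h', h' ∈ p ↔ G.nextPerm.SameCycle h h' := by
  classical
  have key : ∀ h h', (∃ n : ℕ, G.next^[n] h = h') ↔ G.nextPerm.SameCycle h h' := by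
    intro h h'
    constructor
    · rintro ⟨n, hn⟩
      exact ⟨n, by rw [zpow_natCast, nextPerm_pow_apply, hn]⟩
    · intro hs
      obtain ⟨n, _, _, hn⟩ := hs.exists_pow_eq
      exact ⟨n, by rw [← nextPerm_pow_apply, hn]⟩
  rw [plaquettes, Finset.mem_image]
  constructor
  · rintro ⟨h, -, rfl⟩
    exact ⟨h, fun h' => by simp [key]⟩
  · rintro ⟨h, hh⟩
    exact ⟨h, Finset.mem_univ _, by ext h'; simp [key, hh]⟩

variable {G} {p : Finset (E × Bool)}

theorem next_mem_iff (hp : p ∈ G.plaquettes) (h : E × Bool) : G.next h ∈ p ↔ h ∈ p := by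
  obtain ⟨h₀, hh⟩ := G.mem_plaquettes.1 hp
  rw [hh, hh, ← nextPerm_apply, Equiv.Perm.sameCycle_apply_right]

/-- The leg after `k` at a vertex is the image under `next` of the other half of the edge at `k`,
and `p` is invariant under `next` in both directions. -/
theorem isCornerSet (hG : G.IsRegular) (hp : p ∈ G.plaquettes) (v : V) :
    IsCornerSet p (G.link v) where
  nodup := G.nodup_link v
  succ_mem k hk := by
    classical
    have hb : G.base (opp (opp (G.link v)[k])) = v := by
      rw [opp_opp, ← G.mem_link]
      exact List.getElem_mem hk
    have hn : G.next (opp (G.link v)[k]) = (G.link v)[(k + 1) % (G.link v).length]'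
        (Nat.mod_lt _ (by omega)) := by
      rw [next, hb, opp_opp]
      convert List.formPerm_apply_getElem _ (G.nodup_link v) k hk
    rw [← hn, next_mem_iff hp]
  opp_notMem := hG p hp

theorem plaquettes_eq_of_mem {q : Finset (E × Bool)} (hp : p ∈ G.plaquettes)
    (hq : q ∈ G.plaquettes) {h : E × Bool} (h1 : h ∈ p) (h2 : h ∈ q) : p = q := by
  obtain ⟨h₁, hh₁⟩ := G.mem_plaquettes.1 hp
  obtain ⟨h₂, hh₂⟩ := G.mem_plaquettes.1 hq
  ext h'
  rw [hh₁] at h1 ⊢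
  rw [hh₂] at h2 ⊢
  exact ⟨fun h => h2.trans (h1.symm.trans h), fun h => h1.trans (h2.symm.trans h)⟩

end Finite

end RibbonGraph

/-! ### The action of the reflection on plaquettes -/

namespace HalfGraph

variable {V E₀ E₁ : Type*}

/-- The reflection of edges of the doubled graph. -/
def edgeMirror : Equiv.Perm (E₀ ⊕ E₁ × Bool) where
  toFun e := e.map id (fun q => (q.1, !q.2))
  invFun e := e.map id (fun q => (q.1, !q.2))
  left_inv e := by rcases e with e | ⟨e, b⟩ <;> simp
  right_inv e := by rcases e with e | ⟨e, b⟩ <;> simp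

@[simp] theorem edgeMirror_edgeMirror (e : E₀ ⊕ E₁ × Bool) : edgeMirror (edgeMirror e) = e :=
  edgeMirror.symm_apply_apply e

/-- The reflection of half-edges; it reverses the orientation. -/
def halfMirror : Equiv.Perm ((E₀ ⊕ E₁ × Bool) × Bool) where
  toFun h := (edgeMirror h.1, !h.2)
  invFun h := (edgeMirror h.1, !h.2)
  left_inv h := by simp
  right_inv h := by simp

/-- The reflection of the walks around plaquettes: if a walk leaves a vertex along `h`, the
reflected walk leaves a vertex along `walkMirror h`. -/
def walkMirror : Equiv.Perm ((E₀ ⊕ E₁ × Bool) × Bool) where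
  toFun h := (edgeMirror h.1, h.2)
  invFun h := (edgeMirror h.1, h.2)
  left_inv h := by simp
  right_inv h := by simp

@[simp] theorem walkMirror_walkMirror (h : (E₀ ⊕ E₁ × Bool) × Bool) :
    walkMirror (walkMirror h) = h := walkMirror.symm_apply_apply h

theorem opp_walkMirror (h : (E₀ ⊕ E₁ × Bool) × Bool) : opp (walkMirror h) = halfMirror h := rfl

theorem halfMirror_opp (h : (E₀ ⊕ E₁ × Bool) × Bool) : halfMirror (opp h) = walkMirror h := by
  simp [halfMirror, walkMirror, opp]

variable (Γ : HalfGraph V E₀ E₁)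

theorem halfMirror_up (d : E₀ ⊕ E₁ × Bool) : halfMirror (Γ.up d) = Γ.down d := by
  rcases d with e | ⟨e, s⟩ <;> rfl

theorem halfMirror_down (d : E₀ ⊕ E₁ × Bool) : halfMirror (Γ.down d) = Γ.up d := by
  rw [← halfMirror_up]; exact halfMirror.symm_apply_apply _

theorem edgeMirror_up (d : E₀ ⊕ E₁ × Bool) : edgeMirror (Γ.up d).1 = (Γ.down d).1 := by
  rcases d with e | ⟨e, s⟩ <;> rfl

theorem walkMirror_down (d : E₀ ⊕ E₁ × Bool) : walkMirror (Γ.down d) = opp (Γ.up d) := by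
  rw [← halfMirror_up, ← halfMirror_opp]; simp [halfMirror, opp]

theorem link_mirror (v : V) (b : Bool) :
    Γ.double.link (v, !b) = ((Γ.double.link (v, b)).map halfMirror).reverse := by
  cases b
  · change Γ.upList (Γ.link v) = ((Γ.downList (Γ.link v)).map halfMirror).reverse
    rw [downList_eq_map, upList_eq_map, List.map_reverse, List.reverse_reverse, List.map_map]
    exact List.map_congr_left fun d _ => (Γ.halfMirror_down d).symm
  · change Γ.downList (Γ.link v) = ((Γ.upList (Γ.link v)).map halfMirror).reverse
    rw [downList_eq_map, upList_eq_map, List.map_map]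
    exact congrArg _ (List.map_congr_left fun d _ => (Γ.halfMirror_up d).symm)

theorem base_halfMirror (h : (E₀ ⊕ E₁ × Bool) × Bool) :
    Γ.double.base (halfMirror h) = ((Γ.double.base h).1, !(Γ.double.base h).2) := by
  rw [← Γ.double.mem_link, link_mirror, List.mem_reverse, List.mem_map]
  exact ⟨h, (Γ.double.mem_link _ _).2 rfl, rfl⟩

theorem formPerm_map_equiv {α : Type*} [DecidableEq α] (f : Equiv.Perm α) {l : List α}
    (hl : l.Nodup) {x : α} (hx : x ∈ l) : (l.map f).formPerm (f x) = f (l.formPerm x) := by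
  obtain ⟨k, hk, rfl⟩ := List.getElem_of_mem hx
  have hk' : k < (l.map f).length := by simpa using hk
  have h := List.formPerm_apply_getElem (l.map f) (hl.map f.injective) k hk'
  rw [List.getElem_map] at h
  rw [h, List.formPerm_apply_getElem l hl k hk, List.getElem_map]
  simp

/-- The reflection reverses the cyclic order at every vertex, that is, inverts `formPerm`.
Conjugation by `walkMirror` therefore turns `next` into its inverse. -/
theorem next_walkMirror_next (h : (E₀ ⊕ E₁ × Bool) × Bool) :
    Γ.double.next (walkMirror (Γ.double.next h)) = walkMirror h := by
  classical
  have hb : Γ.double.base (opp (walkMirror (Γ.double.next h))) =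
      ((Γ.double.base (opp h)).1, !(Γ.double.base (opp h)).2) := by
    rw [opp_walkMirror, base_halfMirror, RibbonGraph.base_next]
  have hl : Γ.double.link (Γ.double.base (opp (walkMirror (Γ.double.next h)))) =
      ((Γ.double.link (Γ.double.base (opp h))).map halfMirror).reverse := by
    rw [hb, link_mirror]
  have hn : Γ.double.next h = (Γ.double.link (Γ.double.base (opp h))).formPerm (opp h) := by
    rw [RibbonGraph.next]; convert rfl
  have hn' : ∀ h, Γ.double.next h = (Γ.double.link (Γ.double.base (opp h))).formPerm (opp h) := by
    intro h; rw [RibbonGraph.next]; convert rfl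
  rw [hn' (walkMirror _), hl, opp_walkMirror, List.formPerm_reverse, Equiv.Perm.inv_eq_iff_eq,
    ← halfMirror_opp, formPerm_map_equiv _ (Γ.double.nodup_link _) (Γ.double.opp_mem_link h), hn]

variable {Γ}

open Classical in
/-- The mirror image of a plaquette. -/
def mirrorFace (p : Finset ((E₀ ⊕ E₁ × Bool) × Bool)) : Finset ((E₀ ⊕ E₁ × Bool) × Bool) :=
  p.image walkMirror

theorem mem_mirrorFace {p : Finset ((E₀ ⊕ E₁ × Bool) × Bool)} {h : (E₀ ⊕ E₁ × Bool) × Bool} :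
    h ∈ mirrorFace p ↔ walkMirror h ∈ p := by
  classical
  simp only [mirrorFace, Finset.mem_image]
  constructor
  · rintro ⟨k, hk, rfl⟩
    rwa [walkMirror_walkMirror]
  · intro hh
    exact ⟨_, hh, walkMirror_walkMirror h⟩

theorem mirrorFace_mirrorFace (p : Finset ((E₀ ⊕ E₁ × Bool) × Bool)) :
    mirrorFace (mirrorFace p) = p := by
  ext h
  rw [mem_mirrorFace, mem_mirrorFace, walkMirror_walkMirror]

variable [Fintype E₀] [Fintype E₁]

theorem mirrorFace_mem {p : Finset ((E₀ ⊕ E₁ × Bool) × Bool)} (hp : p ∈ Γ.double.plaquettes) :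
    mirrorFace p ∈ Γ.double.plaquettes := by
  obtain ⟨h, hh⟩ := Γ.double.mem_plaquettes.1 hp
  have hc : walkMirror * Γ.double.nextPerm * walkMirror⁻¹ = Γ.double.nextPerm⁻¹ := by
    rw [eq_inv_iff_mul_eq_one]
    ext1 k
    have := Γ.next_walkMirror_next k
    simp only [Equiv.Perm.mul_apply, Equiv.Perm.one_apply]
    rw [Equiv.Perm.inv_def]
    change walkMirror (Γ.double.next (walkMirror (Γ.double.next k))) = k
    rw [this, walkMirror_walkMirror]
  refine Γ.double.mem_plaquettes.2 ⟨walkMirror h, fun h' => ?_⟩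
  have h2 := Equiv.Perm.sameCycle_conj (f := Γ.double.nextPerm) (g := walkMirror)
    (x := walkMirror h) (y := h')
  rw [hc, Equiv.Perm.sameCycle_inv] at h2
  rw [mem_mirrorFace, hh, h2, Equiv.Perm.inv_def]
  change _ ↔ Γ.double.nextPerm.SameCycle (walkMirror (walkMirror h)) (walkMirror h')
  rw [walkMirror_walkMirror]

/-- A half-edge of a crossing edge is fixed by `walkMirror`, and two plaquettes that share a
half-edge are equal. -/
theorem mirrorFace_eq_of_mem {p : Finset ((E₀ ⊕ E₁ × Bool) × Bool)}
    (hp : p ∈ Γ.double.plaquettes) {e : E₀} {s : Bool} (h : (Sum.inl e, s) ∈ p) :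
    mirrorFace p = p :=
  RibbonGraph.plaquettes_eq_of_mem (mirrorFace_mem hp) hp (mem_mirrorFace.2 h) h

/-- A plaquette that does not cross the mirror lies on one side. -/
theorem exists_side {p : Finset ((E₀ ⊕ E₁ × Bool) × Bool)} (hp : p ∈ Γ.double.plaquettes)
    (h0 : ∀ e s, (Sum.inl e, s) ∉ p) :
    ∃ b, ∀ h ∈ p, ∃ e s, h = (Sum.inr (e, b), s) := by
  classical
  obtain ⟨h, hh⟩ := Γ.double.mem_plaquettes.1 hp
  -- One step of the walk changes sides only along a crossing edge, and `p` has none.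
  have side : ∀ k ∈ p, (Γ.double.base (Γ.double.next k)).2 = (Γ.double.base k).2 := by
    rintro ⟨e | ⟨e, b⟩, s⟩ hk
    · exact absurd hk (h0 e s)
    · rw [RibbonGraph.base_next]
      cases b <;> rfl
  have key : ∀ n : ℕ, (Γ.double.nextPerm ^ n) h ∈ p ∧
      (Γ.double.base ((Γ.double.nextPerm ^ n) h)).2 = (Γ.double.base h).2 := by
    intro n
    induction n with
    | zero => exact ⟨(hh _).2 (Equiv.Perm.SameCycle.refl _ _), rfl⟩
    | succ n ih =>
      rw [pow_succ', Equiv.Perm.mul_apply, RibbonGraph.nextPerm_apply]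
      exact ⟨(RibbonGraph.next_mem_iff hp _).2 ih.1, (side _ ih.1).trans ih.2⟩
  refine ⟨(Γ.double.base h).2, fun k hk => ?_⟩
  obtain ⟨n, _, _, hn⟩ := ((hh k).1 hk).exists_pow_eq
  have hb := (key n).2
  rw [hn] at hb
  rcases k with ⟨e | ⟨e, b⟩, s⟩
  · exact absurd hk (h0 e s)
  · refine ⟨e, s, ?_⟩
    rw [← hb]
    cases b <;> rfl

end HalfGraph

end LevinWen

end

noncomputable section

namespace LevinWen

universe v u

open UnitaryFusionCategory SimpleObjects

/-! ### The plaquette operator at a vertex: locality, linearity and reflection -/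

section VertexOperators

variable {C : Type u} [Category.{v} C] [Abelian C] [Linear ℂ C] [MonoidalCategory C]
  [MonoidalPreadditive C] [MonoidalLinear ℂ C] [UnitaryFusionCategory C]
  {S : SimpleObjects C}

namespace SimpleObjects

section Congruence

variable {E : Type*} {j : S.Irr} {Y Y' : ∀ h : E × Bool, S.obj true j ⊗ S.A h.2 ⟶ S.A h.2}
  {Z Z' : ∀ g : E × Bool, S.A g.2 ⊗ S.obj false j ⟶ S.A g.2}

theorem mem_rotN {h : E × Bool} (k : ℕ) (L : List (E × Bool)) : h ∈ rotN k L ↔ h ∈ L := by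
  induction k generalizing L with
  | zero => rfl
  | succ k ih =>
    rw [rotN, ih]
    cases L <;> simp [rot, or_comm]

theorem absorbFirst_congr {L : List (E × Bool)} (hY : ∀ h ∈ L, Y h = Y' h) :
    S.absorbFirst Y L = S.absorbFirst Y' L := by
  cases L with
  | nil => rfl
  | cons h L => rw [absorbFirst, absorbFirst, hY h (by simp)]

theorem absorbLast_congr {L : List (E × Bool)} (hZ : ∀ h ∈ L, Z h = Z' h) :
    S.absorbLast Z L = S.absorbLast Z' L := by
  induction L with
  | nil => rfl
  | cons h L ih =>
    cases L with
    | nil => rw [absorbLast, absorbLast, hZ h (by simp)]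
    | cons g L => rw [absorbLast, absorbLast, ih fun h hh => hZ h (List.mem_cons_of_mem _ hh)]

theorem loopOp_congr {p : Finset (E × Bool)} {L : List (E × Bool)} (hY : ∀ h ∈ L, Y h = Y' h)
    (hZ : ∀ h ∈ L, Z h = Z' h) (x : 𝟙_ C ⟶ S.tens L) :
    loopOp j Y Z p L x = loopOp j Y' Z' p L x := by
  classical
  unfold loopOp cornerOp fuse
  congr 1
  funext h x
  rw [absorbFirst_congr fun h hh => hY h ((mem_rotN _ _).1 hh),
    absorbLast_congr fun h hh => hZ h ((mem_rotN _ _).1 hh)]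

theorem loopOp_of_forall_notMem {p : Finset (E × Bool)} {L : List (E × Bool)}
    (hp : ∀ h ∈ L, h ∉ p) (x : 𝟙_ C ⟶ S.tens L) : loopOp j Y Z p L x = x := by
  classical
  unfold loopOp
  have key : ∀ (f : E × Bool → (𝟙_ C ⟶ S.tens L) → (𝟙_ C ⟶ S.tens L)) (K : List (E × Bool)),
      (∀ h ∈ K, h ∉ p) → K.foldr (fun h x => if h ∈ p then f h x else x) x = x := by
    intro f K hK
    induction K with
    | nil => rfl
    | cons h K ih =>
      rw [List.foldr_cons, if_neg (hK h (by simp)), ih fun h hh => hK h (List.mem_cons_of_mem _ hh)]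
  exact key _ L hp

end Congruence

section Linearity

variable {E : Type*}

theorem isLinearMap_rho (L : List (E × Bool)) : IsLinearMap ℂ (S.rho L) := by
  cases L with
  | nil => exact ⟨fun _ _ => rfl, fun _ _ => rfl⟩
  | cons g L =>
    exact ⟨fun x y => by simp [rho, rot]; rfl, fun c x => by simp [rho, rot]; rfl⟩

theorem isLinearMap_rhoInv (L : List (E × Bool)) : IsLinearMap ℂ (S.rhoInv L) := by
  cases L with
  | nil => exact ⟨fun _ _ => rfl, fun _ _ => rfl⟩
  | cons g L =>
    let F : (𝟙_ C ⟶ S.tens L ⊗ S.A g.2) → (𝟙_ C ⟶ S.A g.2 ⊗ S.tens L) := fun w =>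
      S.capA g.2 ≫ S.A g.2 ◁ ((λ_ (S.A (!g.2))).inv ≫ w ▷ S.A (!g.2)) ≫
        S.A g.2 ◁ ((α_ (S.tens L) (S.A g.2) (S.A (!g.2))).hom ≫
          S.tens L ◁ dag (S.capA g.2) ≫ (ρ_ (S.tens L)).hom)
    have hF : IsLinearMap ℂ F := ⟨fun x y => by simp [F], fun c x => by simp [F]⟩
    exact ⟨fun x y => (congrArg F (Preadditive.add_comp _ _ _ x y (S.tensSnoc L g).hom)).trans
      (hF.map_add _ _), fun c x => (congrArg F (Linear.smul_comp _ _ _ c x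
      (S.tensSnoc L g).hom)).trans (hF.map_smul _ _)⟩

theorem isLinearMap_rhoN (k : ℕ) (L : List (E × Bool)) : IsLinearMap ℂ (S.rhoN k L) := by
  induction k generalizing L with
  | zero => exact ⟨fun _ _ => rfl, fun _ _ => rfl⟩
  | succ k ih =>
    exact ((ih (rot L)).mk' _ ∘ₗ (isLinearMap_rho L).mk' _).isLinear

theorem isLinearMap_rhoInvN (k : ℕ) (L : List (E × Bool)) : IsLinearMap ℂ (S.rhoInvN k L) := by
  induction k generalizing L with
  | zero => exact ⟨fun _ _ => rfl, fun _ _ => rfl⟩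
  | succ k ih =>
    exact ((isLinearMap_rhoInv L).mk' _ ∘ₗ (ih (rot L)).mk' _).isLinear

variable (j : S.Irr) (Y : ∀ h : E × Bool, S.obj true j ⊗ S.A h.2 ⟶ S.A h.2)
  (Z : ∀ g : E × Bool, S.A g.2 ⊗ S.obj false j ⟶ S.A g.2)

theorem isLinearMap_fuse (L : List (E × Bool)) : IsLinearMap ℂ (S.fuse j Y Z L) :=
  ⟨fun x y => by simp [fuse], fun c x => by simp [fuse]⟩

theorem isLinearMap_cornerOp [DecidableEq E] (L : List (E × Bool)) (h : E × Bool) :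
    IsLinearMap ℂ (S.cornerOp j Y Z L h) :=
  ((isLinearMap_rhoInvN _ L).mk' _ ∘ₗ (isLinearMap_fuse j Y Z _).mk' _ ∘ₗ
    (isLinearMap_rhoN (L.idxOf h) L).mk' _).isLinear

theorem isLinearMap_loopOp (p : Finset (E × Bool)) (L : List (E × Bool)) :
    IsLinearMap ℂ (loopOp j Y Z p L) := by
  classical
  unfold loopOp
  have key : ∀ (f : E × Bool → (𝟙_ C ⟶ S.tens L) → (𝟙_ C ⟶ S.tens L)) (K : List (E × Bool)),
      (∀ h, IsLinearMap ℂ (f h)) → IsLinearMap ℂ fun x => K.foldr f x := by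
    intro f K hf
    induction K with
    | nil => exact ⟨fun _ _ => rfl, fun _ _ => rfl⟩
    | cons h K ih => exact ((hf h).mk' _ ∘ₗ ih.mk' _).isLinear
  refine key _ L fun h => ?_
  by_cases hp : h ∈ p
  · simp only [hp, if_true]
    exact isLinearMap_cornerOp j Y Z L h
  · simp only [hp, if_false]
    exact ⟨fun _ _ => rfl, fun _ _ => rfl⟩

end Linearity

section Fusion

variable (Φ : S.FusionONB) {E : Type*} (p : Finset (E × Bool)) (j : S.Irr) (l l' : E → S.Irr)
  (a : E × Bool → ℕ)

namespace FusionONB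

/-- The basis vectors of the fusion spaces, numbered by all natural numbers. -/
def vec {j i i' : S.Irr} {s : Bool} (n : ℕ) : S.obj true j ⊗ S.obj s i ⟶ S.obj s i' :=
  if h : n < Φ.N j i i' s then Φ.y ⟨n, h⟩ else 0

/-- The double negation in the sign is what the other end of an edge produces; it reduces to `s`
only after a case distinction. -/
theorem isConj_vec {j : S.Irr} (s : Bool) (i i' : S.Irr) (n : ℕ) :
    IsConj ((S.simplePair j).prod (S.pairA s)) (S.pairA s)
      (S.obj true j ◁ dag (S.incl s i) ≫ Φ.vec n ≫ S.incl s i')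
      (dag (S.incl (!s) i) ▷ S.obj false j ≫
        S.conjFusion (s := !s) (Φ.vec (s := !!s) (i := i) (i' := i') n) ≫ S.incl (!s) i') := by
  refine (IsConj.whiskerLeft _ (S.isConj_dag_incl s _)).comp (IsConj.comp ?_ (S.isConj_incl s _))
  cases s
  · exact S.isConj_conjFusion (s := true) (Φ.vec n)
  · exact S.isConj_conjFusion (s := false) (Φ.vec n)

end FusionONB

/-- The fusion `hom(j ⊗ A^ε, A^ε)` at the half-edge `h` for the choice `a` of basis vectors. -/
def fusionLeft (h : E × Bool) : S.obj true j ⊗ S.A h.2 ⟶ S.A h.2 :=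
  open Classical in
  if h ∈ p then
    S.obj true j ◁ dag (S.incl h.2 (l h.1)) ≫ Φ.vec (a h) ≫ S.incl h.2 (l' h.1)
  else 0

/-- The reflected fusion `hom(A^ε ⊗ j⁻, A^ε)` at the other end `g` of an edge. -/
def fusionRight (g : E × Bool) : S.A g.2 ⊗ S.obj false j ⟶ S.A g.2 :=
  open Classical in
  if opp g ∈ p then
    dag (S.incl g.2 (l g.1)) ▷ S.obj false j ≫ S.conjFusion (Φ.vec (a (opp g))) ≫
      S.incl g.2 (l' g.1)
  else 0

variable {Φ p j l l' a}

/-- Choices with values in `ℕ` have a type that does not depend on the edge labels, so they can be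
split into halves and reflected without casts. -/
theorem leftFusion_eq
    (b : ∀ h : {h : E × Bool // h ∈ p}, Fin (Φ.N j (l h.1.1) (l' h.1.1) h.1.2))
    (hab : ∀ h, (b h : ℕ) = a h.1) : leftFusion Φ p j l l' b = fusionLeft Φ p j l l' a := by
  funext h
  unfold leftFusion fusionLeft
  split_ifs with hp
  · rw [FusionONB.vec, dif_pos (by rw [← hab ⟨h, hp⟩]; exact (b ⟨h, hp⟩).2)]
    congr 3
    exact Fin.ext (hab ⟨h, hp⟩)
  · rfl

theorem rightFusion_eq
    (b : ∀ h : {h : E × Bool // h ∈ p}, Fin (Φ.N j (l h.1.1) (l' h.1.1) h.1.2))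
    (hab : ∀ h, (b h : ℕ) = a h.1) : rightFusion Φ p j l l' b = fusionRight Φ p j l l' a := by
  funext h
  unfold rightFusion fusionRight
  split_ifs with hp
  · have : (Φ.vec (a (opp h)) : _ ⟶ S.obj (!h.2) (l' h.1)) = Φ.y (b ⟨opp h, hp⟩) := by
      rw [FusionONB.vec, dif_pos (by rw [← hab ⟨opp h, hp⟩]; exact (b ⟨opp h, hp⟩).2)]
      congr 1
      exact Fin.ext (hab ⟨opp h, hp⟩).symm
    exact congrArg (fun w => dag (S.incl h.2 (l h.1)) ▷ S.obj false j ≫ S.conjFusion w ≫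
      S.incl h.2 (l' h.1)) this.symm
  · rfl

variable {E' : Type*} {p' : Finset (E' × Bool)} {m m' : E' → S.Irr} {b : E' × Bool → ℕ}

theorem isConj_fusionLeft {e : E} {e' : E'} {s : Bool} (hp : (e, s) ∈ p ↔ (e', s) ∈ p')
    (hl : l e = m e') (hl' : l' e = m' e') (ha : a (e, s) = b (e', s)) :
    IsConj ((S.simplePair j).prod (S.pairA s)) (S.pairA s) (fusionLeft Φ p j l l' a (e, s))
      (fusionRight Φ p' j m m' b (e', !s)) := by
  have hs : opp (e', !s) = (e', s) := by simp [opp]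
  by_cases h : (e, s) ∈ p
  · have h' : opp (e', !s) ∈ p' := by rw [hs]; exact hp.1 h
    rw [fusionLeft, if_pos h, fusionRight, if_pos h']
    -- The labels and the basis index at the mirror image are generalised so that their equalities
    -- can be substituted in dependent types.
    have key : ∀ i i' n, l e = i → l' e = i' → a (e, s) = n →
        IsConj ((S.simplePair j).prod (S.pairA s)) (S.pairA s)
          (S.obj true j ◁ dag (S.incl s (l e)) ≫ Φ.vec (a (e, s)) ≫ S.incl s (l' e))
          (dag (S.incl (!s) i) ▷ S.obj false j ≫
            S.conjFusion (s := !s) (Φ.vec (s := !!s) (i := i) (i' := i') n) ≫ S.incl (!s) i') := by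
      rintro _ _ _ rfl rfl rfl
      exact Φ.isConj_vec s _ _ _
    exact key _ _ _ hl hl' (ha.trans (congrArg b hs.symm))
  · have h' : opp (e', !s) ∉ p' := by rw [hs]; exact fun h' => h (hp.2 h')
    rw [fusionLeft, if_neg h, fusionRight, if_neg h']
    exact IsConj.zero _ _

/-- Conjugacy is symmetric, so this is `isConj_fusionLeft` read from the mirror image. -/
theorem isConj_fusionRight {e : E} {e' : E'} {s : Bool} (hp : (e, !s) ∈ p ↔ (e', !s) ∈ p')
    (hl : l e = m e') (hl' : l' e = m' e') (ha : a (e, !s) = b (e', !s)) :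
    IsConj ((S.pairA s).prod (S.simplePair j).swap) (S.pairA s) (fusionRight Φ p j l l' a (e, s))
      (fusionLeft Φ p' j m m' b (e', !s)) := by
  cases s
  · have := (isConj_fusionLeft (Φ := Φ) (j := j) hp.symm hl.symm hl'.symm ha.symm).symm
    rw [← pairA_true_swap]
    exact this
  · have := (isConj_fusionLeft (Φ := Φ) (j := j) hp.symm hl.symm hl'.symm ha.symm).symm
    rw [← pairA_false_swap]
    exact this

/-- The operators at a vertex and at its mirror image are conjugate. -/
theorem conjVertex_loopOp_fusion {V E₀ E₁ : Type*} [Fintype E₀] [Fintype E₁]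
    {Γ : HalfGraph V E₀ E₁} (hΓ : Γ.double.IsRegular)
    {p : Finset ((E₀ ⊕ E₁ × Bool) × Bool)} (hp : p ∈ Γ.double.plaquettes)
    {l l' : E₀ ⊕ E₁ × Bool → S.Irr} {a : (E₀ ⊕ E₁ × Bool) × Bool → ℕ}
    (hl : ∀ e, l (HalfGraph.edgeMirror e) = l e) (hl' : ∀ e, l' (HalfGraph.edgeMirror e) = l' e)
    (ha : ∀ h, a (HalfGraph.walkMirror h) = a h) (v : V)
    (x : 𝟙_ C ⟶ S.tens (Γ.upList (Γ.link v))) :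
    conjVertex S Γ (Γ.link v)
        (loopOp j (fusionLeft Φ p j l l' a) (fusionRight Φ p j l l' a) p (Γ.upList (Γ.link v)) x) =
      loopOp j (fusionLeft Φ (HalfGraph.mirrorFace p) j l l' a)
        (fusionRight Φ (HalfGraph.mirrorFace p) j l l' a) (HalfGraph.mirrorFace p)
        (Γ.downList (Γ.link v)) (conjVertex S Γ (Γ.link v) x) := by
  have key : ∀ d s, ((Γ.up d).1, s) ∈ p ↔ ((Γ.down d).1, s) ∈ HalfGraph.mirrorFace p := by
    intro d s
    rw [HalfGraph.mem_mirrorFace, ← HalfGraph.edgeMirror_up]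
    change _ ↔ HalfGraph.walkMirror (HalfGraph.walkMirror ((Γ.up d).1, s)) ∈ p
    rw [HalfGraph.walkMirror_walkMirror]
  have hlab : ∀ {α : Type} (f : E₀ ⊕ E₁ × Bool → α), (∀ e, f (HalfGraph.edgeMirror e) = f e) →
      ∀ d, f (Γ.up d).1 = f (Γ.down d).1 := by
    intro α f hf d
    rw [← HalfGraph.edgeMirror_up, hf]
  have hbas : ∀ d s, a ((Γ.up d).1, s) = a ((Γ.down d).1, s) := fun d s =>
    hlab (fun e => a (e, s)) (fun e => ha (e, s)) d
  refine conjVertex_loopOp (fun d => ?_) (fun d => ?_)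
    (RibbonGraph.isCornerSet hΓ hp (v, true))
    (RibbonGraph.isCornerSet hΓ (HalfGraph.mirrorFace_mem hp) (v, false)) (fun d => ?_) x
  · exact isConj_fusionLeft (key d _) (hlab l hl d) (hlab l' hl' d) (hbas d _)
  · exact isConj_fusionRight (key d _) (hlab l hl d) (hlab l' hl' d) (hbas d _)
  · rw [HalfGraph.mem_mirrorFace, HalfGraph.walkMirror_down]

end Fusion

end SimpleObjects

end VertexOperators

end LevinWen

end

noncomputable section

namespace LevinWen

/-! ### Semigroups that preserve a closed cone -/

section Exponential

open Filter Topology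

variable {H : Type*} [NormedAddCommGroup H] [NormedSpace ℂ H] [CompleteSpace H]

/-- The exponential of an operator that preserves a closed cone preserves it. -/
theorem exp_smul_apply_mem {K : Set H} (hK : IsClosed K) (h0 : (0 : H) ∈ K)
    (hadd : ∀ x ∈ K, ∀ y ∈ K, x + y ∈ K) (hsmul : ∀ c : ℝ, 0 ≤ c → ∀ x ∈ K, (c : ℂ) • x ∈ K)
    {T : H →L[ℂ] H} (hT : ∀ x ∈ K, T x ∈ K) {b : ℝ} (hb : 0 ≤ b) {x : H} (hx : x ∈ K) :
    NormedSpace.exp ((b : ℂ) • T) x ∈ K := by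
  have h := (NormedSpace.exp_series_hasSum_exp' (𝕂 := ℂ) ((b : ℂ) • T)).mapL
    (ContinuousLinearMap.apply ℂ H x)
  refine hK.mem_of_tendsto h (Eventually.of_forall fun s => ?_)
  refine Finset.sum_induction _ (· ∈ K) (fun x y hx hy => hadd x hx y hy) h0 fun n _ => ?_
  have hn : ∀ n : ℕ, (T ^ n) x ∈ K := by
    intro n
    induction n with
    | zero => simpa using hx
    | succ n ih => rw [pow_succ']; exact hT _ ih
  have := hsmul ((n.factorial : ℝ)⁻¹ * b ^ n) (by positivity) _ (hn n)
  rw [ContinuousLinearMap.apply_apply, smul_pow, smul_smul]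
  rw [Complex.ofReal_mul, Complex.ofReal_inv, Complex.ofReal_natCast, Complex.ofReal_pow] at this
  exact this

/-- A generator `T` for which every `T + c + c⁻¹ D`, `c > 0`, preserves a closed cone generates a
semigroup that preserves it. -/
theorem exp_smul_apply_mem_of_forall {K : Set H} (hK : IsClosed K) (h0 : (0 : H) ∈ K)
    (hadd : ∀ x ∈ K, ∀ y ∈ K, x + y ∈ K) (hsmul : ∀ c : ℝ, 0 ≤ c → ∀ x ∈ K, (c : ℂ) • x ∈ K)
    {T D : H →L[ℂ] H}
    (hT : ∀ c : ℝ, 0 < c → ∀ x ∈ K, T x + (c : ℂ) • x + ((c⁻¹ : ℝ) : ℂ) • D x ∈ K)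
    {b : ℝ} (hb : 0 ≤ b) {x : H} (hx : x ∈ K) :
    NormedSpace.exp ((b : ℂ) • T) x ∈ K := by
  let _ : NormedAlgebra ℚ (H →L[ℂ] H) := NormedAlgebra.restrictScalars ℚ ℂ (H →L[ℂ] H)
  have key : ∀ c : ℝ, 0 < c →
      NormedSpace.exp ((b : ℂ) • (T + ((c⁻¹ : ℝ) : ℂ) • D)) x ∈ K := by
    intro c hc
    have h1 := exp_smul_apply_mem hK h0 hadd hsmul
      (T := T + (c : ℂ) • (1 : H →L[ℂ] H) + ((c⁻¹ : ℝ) : ℂ) • D) (hT c hc) hb hx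
    -- The added constant `c` only contributes the positive factor `exp (-b c)`.
    have h2 : (b : ℂ) • (T + ((c⁻¹ : ℝ) : ℂ) • D) =
        algebraMap ℂ (H →L[ℂ] H) ((-(b * c) : ℝ) : ℂ) +
          (b : ℂ) • (T + (c : ℂ) • (1 : H →L[ℂ] H) + ((c⁻¹ : ℝ) : ℂ) • D) := by
      rw [Algebra.algebraMap_eq_smul_one]
      push_cast
      module
    rw [h2, NormedSpace.exp_add_of_commute (Algebra.commutes _ _), ← NormedSpace.algebraMap_exp_comm,
      ← Complex.exp_eq_exp_ℂ, Algebra.algebraMap_eq_smul_one, ← Complex.ofReal_exp]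
    exact hsmul _ (Real.exp_pos _).le _ h1
  -- The correction `c⁻¹ D` disappears as `c → ∞`, and the cone is closed.
  have hlim : Tendsto (fun c : ℝ => NormedSpace.exp ((b : ℂ) • (T + ((c⁻¹ : ℝ) : ℂ) • D)) x) atTop
      (𝓝 (NormedSpace.exp ((b : ℂ) • (T + (((0 : ℝ) : ℂ)) • D)) x)) := by
    have hc : Continuous fun r : ℝ => NormedSpace.exp ((b : ℂ) • (T + (r : ℂ) • D)) x :=
      (ContinuousLinearMap.apply ℂ H x).continuous.comp
        (NormedSpace.exp_continuous.comp (by fun_prop))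
    exact (hc.tendsto 0).comp tendsto_inv_atTop_zero
  have h := hK.mem_of_tendsto hlim ((eventually_gt_atTop 0).mono key)
  simpa using h

end Exponential

/-! ### The reflection cone -/

section Cone

open Matrix

variable {X I Y Y' : Type*} (φ : I × Y' × Y ≃ X) (Θ : Matrix Y' Y ℂ)

/-- A vector of `⨁_i H'_i ⊗ H_i`, as a family of matrices. -/
def slice (F : EuclideanSpace ℂ X) (i : I) : Matrix Y' Y ℂ := Matrix.of fun m p => F (φ (i, m, p))

theorem slice_add (F G : EuclideanSpace ℂ X) (i : I) :
    slice φ (F + G) i = slice φ F i + slice φ G i := rfl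

theorem slice_smul (c : ℂ) (F : EuclideanSpace ℂ X) (i : I) :
    slice φ (c • F) i = c • slice φ F i := rfl

variable [Fintype Y]

/-- The cone generated by the vectors `θ h ⊗ h`. -/
def reflectionCone : Set (EuclideanSpace ℂ X) :=
  {F | ∀ i, ∃ P : Matrix Y Y ℂ, P.PosSemidef ∧ slice φ F i = Θ * P}

variable {φ Θ}

theorem zero_mem_reflectionCone : (0 : EuclideanSpace ℂ X) ∈ reflectionCone φ Θ := fun i =>
  ⟨0, PosSemidef.zero, by ext; simp [slice]⟩

theorem add_mem_reflectionCone {F G : EuclideanSpace ℂ X} (hF : F ∈ reflectionCone φ Θ)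
    (hG : G ∈ reflectionCone φ Θ) : F + G ∈ reflectionCone φ Θ := fun i => by
  obtain ⟨P, hP, h⟩ := hF i
  obtain ⟨Q, hQ, h'⟩ := hG i
  exact ⟨P + Q, hP.add hQ, by rw [slice_add, h, h', Matrix.mul_add]⟩

theorem smul_mem_reflectionCone {c : ℝ} (hc : 0 ≤ c) {F : EuclideanSpace ℂ X}
    (hF : F ∈ reflectionCone φ Θ) : (c : ℂ) • F ∈ reflectionCone φ Θ := fun i => by
  obtain ⟨P, hP, h⟩ := hF i
  exact ⟨(c : ℂ) • P, hP.smul (by exact_mod_cast hc), by rw [slice_smul, h, Matrix.mul_smul]⟩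

theorem sum_mem_reflectionCone {ι : Type*} (A : Finset ι) {F : ι → EuclideanSpace ℂ X}
    (hF : ∀ k ∈ A, F k ∈ reflectionCone φ Θ) : ∑ k ∈ A, F k ∈ reflectionCone φ Θ :=
  Finset.sum_induction _ (· ∈ reflectionCone φ Θ) (fun _ _ => add_mem_reflectionCone)
    zero_mem_reflectionCone hF

theorem isClosed_setOf_posSemidef : IsClosed {P : Matrix Y Y ℂ | P.PosSemidef} := by
  simp only [posSemidef_iff_dotProduct_mulVec, Set.ofPred_and, Set.ofPred_forall]
  refine IsClosed.inter ?_ (isClosed_iInter fun x => ?_)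
  · exact isClosed_eq (by fun_prop) (by fun_prop)
  · exact isClosed_le (by fun_prop) (by fun_prop)

section Fin

variable [Fintype Y'] [DecidableEq Y]

/-- As `Θ` is an isometry, the positive matrix is recovered as `Θᴴ * slice φ F i`, so membership
becomes a closed condition on `F` without an existential quantifier. -/
theorem isClosed_reflectionCone (hΘ : Θᴴ * Θ = 1) : IsClosed (reflectionCone φ Θ) := by
  have h : reflectionCone φ Θ = ⋂ i, {F | (Θᴴ * slice φ F i).PosSemidef} ∩
      {F | Θ * (Θᴴ * slice φ F i) = slice φ F i} := by
    ext F
    simp only [reflectionCone, Set.mem_iInter, Set.mem_inter_iff, Set.mem_ofPred_eq]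
    refine forall_congr' fun i => ⟨?_, fun ⟨h1, h2⟩ => ⟨_, h1, h2.symm⟩⟩
    rintro ⟨P, hP, h⟩
    rw [h, ← Matrix.mul_assoc Θᴴ, hΘ, Matrix.one_mul]
    exact ⟨hP, rfl⟩
  rw [h]
  have hs : ∀ i, Continuous fun F => slice φ F i := fun i => by
    unfold slice
    fun_prop
  refine isClosed_iInter fun i => IsClosed.inter ?_ ?_
  · exact isClosed_setOf_posSemidef.preimage (continuous_const.matrix_mul (hs i))
  · exact isClosed_eq (continuous_const.matrix_mul (continuous_const.matrix_mul (hs i))) (hs i)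

variable [Fintype X] [Fintype I]

/-- Vectors in the cone have nonnegative inner products with `θ h ⊗ h`. -/
theorem inner_nonneg_of_mem_reflectionCone (hΘ : Θᴴ * Θ = 1) {F G : EuclideanSpace ℂ X}
    (hF : F ∈ reflectionCone φ Θ) (hG : G ∈ reflectionCone φ Θ) : 0 ≤ inner ℂ F G := by
  have key : inner ℂ F G = ∑ i, ((slice φ F i)ᴴ * slice φ G i).trace := by
    rw [PiLp.inner_apply, ← φ.sum_comp, Fintype.sum_prod_type]
    refine Finset.sum_congr rfl fun i _ => ?_
    rw [Fintype.sum_prod_type, Finset.sum_comm]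
    simp [Matrix.trace, Matrix.mul_apply, slice, mul_comm]
  rw [key]
  refine Finset.sum_nonneg fun i _ => ?_
  obtain ⟨P, hP, h⟩ := hF i
  obtain ⟨Q, hQ, h'⟩ := hG i
  rw [h, h', conjTranspose_mul, Matrix.mul_assoc, ← Matrix.mul_assoc Θᴴ, hΘ, Matrix.one_mul,
    hP.isHermitian.eq]
  -- It remains to bound `tr(P Q)`. For a rank one summand of `Q` this trace is a value of the
  -- quadratic form of `P`.
  obtain ⟨m, v, rfl⟩ := posSemidef_iff_eq_sum_vecMulVec.1 hQ
  rw [Finset.mul_sum, Matrix.trace_sum]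
  refine Finset.sum_nonneg fun k _ => ?_
  rw [Matrix.mul_vecMulVec, Matrix.trace_vecMulVec, dotProduct_comm]
  exact hP.dotProduct_mulVec_nonneg _

-- On slices, `Q' ⊗ Q` acts by `F ↦ Q' F Qᵀ`. The intertwining relation takes `Θ P` to `Θ (Qᵀᴴ P
-- Qᵀ)`, a congruence of `P`, and nonnegative weights keep the sum positive semidefinite.
omit [DecidableEq Y] in
theorem toEuclideanCLM_mem_reflectionCone [DecidableEq X] {α : Type*} {M : Matrix X X ℂ} {W : I → I → ℝ}
    (hW : ∀ i' i, 0 ≤ W i' i) {A : I → I → Finset α} {Q' : I → I → α → Matrix Y' Y' ℂ}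
    {Q : I → I → α → Matrix Y Y ℂ}
    (hM : ∀ i' m' p' i m p, M (φ (i', m', p')) (φ (i, m, p)) =
      W i' i * ∑ a ∈ A i' i, Q' i' i a m' m * Q i' i a p' p)
    (hQ : ∀ i' i, ∀ a ∈ A i' i, Q' i' i a * Θ = Θ * (Q i' i a)ᵀᴴ) {F : EuclideanSpace ℂ X}
    (hF : F ∈ reflectionCone φ Θ) : toEuclideanCLM (𝕜 := ℂ) M F ∈ reflectionCone φ Θ := by
  intro i'
  have hs : slice φ (toEuclideanCLM (𝕜 := ℂ) M F) i' =
      ∑ i, (W i' i : ℂ) • ∑ a ∈ A i' i, Q' i' i a * slice φ F i * (Q i' i a)ᵀ := by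
    ext m' p'
    change (M *ᵥ F.ofLp) (φ (i', m', p')) = _
    rw [mulVec, dotProduct, ← φ.sum_comp, Fintype.sum_prod_type, Matrix.sum_apply]
    refine Finset.sum_congr rfl fun i _ => ?_
    simp only [hM, Fintype.sum_prod_type, Matrix.smul_apply, Matrix.sum_apply, Matrix.mul_apply,
      Matrix.transpose_apply, slice, Matrix.of_apply, smul_eq_mul, Finset.mul_sum, Finset.sum_mul]
    rw [Finset.sum_comm]
    conv_lhs => enter [2, p]; rw [Finset.sum_comm]
    rw [Finset.sum_comm]
    refine Finset.sum_congr rfl fun a _ => Finset.sum_congr rfl fun p _ =>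
      Finset.sum_congr rfl fun m _ => ?_
    ring
  choose P hP h using hF
  refine ⟨∑ i, (W i' i : ℂ) • ∑ a ∈ A i' i, (Q i' i a)ᵀᴴ * P i * (Q i' i a)ᵀ, ?_, ?_⟩
  · refine posSemidef_sum _ fun i _ => PosSemidef.smul (posSemidef_sum _ fun a _ => ?_)
      (by exact_mod_cast hW i' i)
    exact (hP i).conjTranspose_mul_mul_same _
  · rw [hs, Matrix.mul_sum]
    refine Finset.sum_congr rfl fun i _ => ?_
    rw [Matrix.mul_smul, Matrix.mul_sum]
    congr 1
    refine Finset.sum_congr rfl fun a ha => ?_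
    rw [h, ← Matrix.mul_assoc, hQ _ _ a ha]
    simp only [Matrix.mul_assoc]

variable [DecidableEq X] [DecidableEq I] [DecidableEq Y']

/-- A generator that is the sum of an operator that preserves the reflection cone, of an operator
on one side, and of its mirror image, generates a semigroup that preserves the reflection cone. -/
theorem exp_toEuclideanCLM_mem_reflectionCone (hΘ : Θᴴ * Θ = 1) {M M₀ : Matrix X X ℂ}
    (hM₀ : ∀ F ∈ reflectionCone φ Θ, toEuclideanCLM (𝕜 := ℂ) M₀ F ∈ reflectionCone φ Θ)
    {B' : I → Matrix Y' Y' ℂ} {B : I → Matrix Y Y ℂ} (hB : ∀ i, B' i * Θ = Θ * (B i)ᵀᴴ)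
    (hM : ∀ i' m' p' i m p, M (φ (i', m', p')) (φ (i, m, p)) =
      M₀ (φ (i', m', p')) (φ (i, m, p)) + if i' = i then
        (if p' = p then B' i m' m else 0) + (if m' = m then B i p' p else 0) else 0)
    {b : ℝ} (hb : 0 ≤ b) {F : EuclideanSpace ℂ X} (hF : F ∈ reflectionCone φ Θ) :
    NormedSpace.exp ((b : ℂ) • toEuclideanCLM (𝕜 := ℂ) M) F ∈ reflectionCone φ Θ := by
  let D : Matrix X X ℂ := Matrix.of fun x' x => if (φ.symm x').1 = (φ.symm x).1 then
    B' (φ.symm x).1 (φ.symm x').2.1 (φ.symm x).2.1 * B (φ.symm x).1 (φ.symm x').2.2 (φ.symm x).2.2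
    else 0
  have step : ∀ c : ℝ, 0 < c → ∀ F ∈ reflectionCone φ Θ,
      toEuclideanCLM (𝕜 := ℂ) M F + (c : ℂ) • F +
        ((c⁻¹ : ℝ) : ℂ) • toEuclideanCLM (𝕜 := ℂ) D F ∈ reflectionCone φ Θ := by
    intro c hc F hF
    -- With `D = B' ⊗ B`, this is the product `c⁻¹ (c + B') ⊗ (c + B)` at equal crossing labels, to
    -- which the cone criterion for tensor products applies.
    let N : Matrix X X ℂ := M - M₀ + (c : ℂ) • (1 : Matrix X X ℂ) + ((c⁻¹ : ℝ) : ℂ) • D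
    have hN : toEuclideanCLM (𝕜 := ℂ) N F ∈ reflectionCone φ Θ := by
      refine toEuclideanCLM_mem_reflectionCone (α := Unit)
        (W := fun i' i => if i' = i then c⁻¹ else 0) (A := fun _ _ => {()})
        (Q' := fun _ i _ => (c : ℂ) • 1 + B' i) (Q := fun _ i _ => (c : ℂ) • 1 + B i)
        (fun i' i => by split_ifs <;> positivity) (fun i' m' p' i m p => ?_)
        (fun i' i _ _ => ?_) hF
      · have hc' : (c : ℂ) ≠ 0 := by exact_mod_cast hc.ne'
        simp only [N, D, Matrix.add_apply, Matrix.sub_apply, hM, Matrix.smul_apply, Matrix.one_apply,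
          Matrix.of_apply, Equiv.symm_apply_apply, φ.injective.eq_iff, Prod.mk.injEq,
          Finset.sum_singleton, smul_eq_mul]
        by_cases hi : i' = i
        · by_cases hm : m' = m <;> by_cases hp : p' = p <;> (simp [hi, hm, hp] <;> field_simp; try ring)
        · simp [hi]
      · simp [Matrix.add_mul, Matrix.mul_add, hB, Matrix.transpose_add, Matrix.conjTranspose_add,
          Matrix.transpose_smul, Matrix.conjTranspose_smul]
    have h := add_mem_reflectionCone (hM₀ F hF) hN
    have e : toEuclideanCLM (𝕜 := ℂ) N = toEuclideanCLM (𝕜 := ℂ) M - toEuclideanCLM (𝕜 := ℂ) M₀ +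
        (c : ℂ) • (1 : EuclideanSpace ℂ X →L[ℂ] EuclideanSpace ℂ X) +
        ((c⁻¹ : ℝ) : ℂ) • toEuclideanCLM (𝕜 := ℂ) D := by
      rw [map_add, map_add, map_sub, map_smul, map_smul, map_one]
    have e' : toEuclideanCLM (𝕜 := ℂ) M F + (c : ℂ) • F +
        ((c⁻¹ : ℝ) : ℂ) • toEuclideanCLM (𝕜 := ℂ) D F =
        toEuclideanCLM (𝕜 := ℂ) M₀ F + toEuclideanCLM (𝕜 := ℂ) N F := by
      rw [e]
      change _ = _ + (toEuclideanCLM (𝕜 := ℂ) M F - toEuclideanCLM (𝕜 := ℂ) M₀ F + (c : ℂ) • F +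
        ((c⁻¹ : ℝ) : ℂ) • toEuclideanCLM (𝕜 := ℂ) D F)
      abel
    rw [e']
    exact h
  exact @exp_smul_apply_mem_of_forall (EuclideanSpace ℂ X) _ _ _ (reflectionCone φ Θ)
    (isClosed_reflectionCone hΘ) zero_mem_reflectionCone
    (fun _ h _ h' => add_mem_reflectionCone h h') (fun _ h _ h' => smul_mem_reflectionCone h h')
    (toEuclideanCLM (𝕜 := ℂ) M) (toEuclideanCLM (𝕜 := ℂ) D) step b hb F hF

end Fin

end Cone

end LevinWen

end

noncomputable section

namespace LevinWen

universe v u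

/-! ### Matrices that are sums of tensor products over the vertices -/

section TensorMatrix

open Matrix

variable {V E I : Type*} [Fintype V] [Fintype E] [Fintype I] {α : Type*} {n n' : V → ℕ}

/-- A sum of tensor products of matrices, with coefficients that depend on the labels of the
edges. -/
def tensorMatrix (D : (E → I) → (E → I) → ℂ) (A : (E → I) → (E → I) → Finset α)
    (q : (E → I) → (E → I) → α → ∀ v, Matrix (Fin (n' v)) (Fin (n v)) ℂ) :
    Matrix (Config n' E I) (Config n E I) ℂ :=
  Matrix.of fun c' c => D c'.edge c.edge *
    ∑ a ∈ A c'.edge c.edge, ∏ v, q c'.edge c.edge a v (c'.vert v) (c.vert v)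

open Classical in
/-- The tensor product of matrices that does not change the labels of the edges. -/
def diagTensor (E I : Type*) (θ : ∀ v, Matrix (Fin (n' v)) (Fin (n v)) ℂ) :
    Matrix (Config n' E I) (Config n E I) ℂ :=
  Matrix.of fun c' c => if c'.edge = c.edge then ∏ v, θ v (c'.vert v) (c.vert v) else 0

open Classical in
theorem sum_config {M : Type*} [AddCommMonoid M] (f : Config n E I → M) :
    ∑ c, f c = ∑ l : E → I, ∑ b : ∀ v, Fin (n v), f ⟨b, l⟩ := by
  rw [← (Config.equiv n E I).symm.sum_comp, Fintype.sum_prod_type_right]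
  rfl

omit [Fintype V] [Fintype E] [Fintype I] in
theorem Config.ext' {c c' : Config n E I} (h : c.vert = c'.vert) (h' : c.edge = c'.edge) :
    c = c' := by
  cases c; cases c'; congr

variable {D : (E → I) → (E → I) → ℂ} {A : (E → I) → (E → I) → Finset α}

/-- Only the intermediate edge labels equal to those of the column survive, and the sum over tuples
of vertex labels of a product is the product of the sums. -/
theorem tensorMatrix_mul_diagTensor {n'' : V → ℕ}
    (q : (E → I) → (E → I) → α → ∀ v, Matrix (Fin (n'' v)) (Fin (n' v)) ℂ)
    (θ : ∀ v, Matrix (Fin (n' v)) (Fin (n v)) ℂ) :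
    tensorMatrix D A q * diagTensor E I θ = tensorMatrix D A fun l' l a v => q l' l a v * θ v := by
  classical
  ext c' c
  rw [Matrix.mul_apply, sum_config, Finset.sum_eq_single c.edge]
  · simp only [tensorMatrix, diagTensor, Matrix.of_apply, if_true, Matrix.mul_apply]
    simp only [Finset.prod_univ_sum, Fintype.piFinset_univ, mul_assoc, ← Finset.mul_sum]
    congr 1
    simp only [Finset.sum_mul]
    rw [Finset.sum_comm]
    simp only [Finset.prod_mul_distrib]
  · intro l _ hl
    simp [diagTensor, hl]
  · simp

theorem diagTensor_mul_tensorMatrix {n'' : V → ℕ}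
    (q : (E → I) → (E → I) → α → ∀ v, Matrix (Fin (n' v)) (Fin (n v)) ℂ)
    (θ : ∀ v, Matrix (Fin (n'' v)) (Fin (n' v)) ℂ) :
    diagTensor E I θ * tensorMatrix D A q = tensorMatrix D A fun l' l a v => θ v * q l' l a v := by
  classical
  ext c' c
  rw [Matrix.mul_apply, sum_config, Finset.sum_eq_single c'.edge]
  · simp only [tensorMatrix, diagTensor, Matrix.of_apply, if_true, Matrix.mul_apply]
    simp only [Finset.prod_univ_sum, Fintype.piFinset_univ, mul_left_comm _ (D _ _),
      ← Finset.mul_sum]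
    congr 1
    simp only [Finset.mul_sum]
    rw [Finset.sum_comm]
    simp only [Finset.prod_mul_distrib]
  · intro l _ hl
    simp [diagTensor, hl.symm]
  · simp

omit [Fintype E] [Fintype I] in
theorem tensorMatrix_transpose_conjTranspose
    (q : (E → I) → (E → I) → α → ∀ v, Matrix (Fin (n' v)) (Fin (n v)) ℂ)
    (hD : ∀ l' l, star (D l' l) = D l' l) :
    (tensorMatrix D A q)ᵀᴴ = tensorMatrix D A fun l' l a v => (q l' l a v)ᵀᴴ := by
  ext c' c
  have := hD c'.edge c.edge
  simp only [tensorMatrix, Matrix.conjTranspose_apply, Matrix.transpose_apply, Matrix.of_apply,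
    star_mul', this, star_sum, star_prod]

/-- Tensor products of matrices that are mirror images are mirror images. -/
theorem tensorMatrix_intertwine {n' n : V → ℕ} {θ : ∀ v, Matrix (Fin (n' v)) (Fin (n v)) ℂ}
    {q' : (E → I) → (E → I) → α → ∀ v, Matrix (Fin (n' v)) (Fin (n' v)) ℂ}
    {q : (E → I) → (E → I) → α → ∀ v, Matrix (Fin (n v)) (Fin (n v)) ℂ}
    (hD : ∀ l' l, star (D l' l) = D l' l)
    (h : ∀ l' l a v, q' l' l a v * θ v = θ v * (q l' l a v)ᵀᴴ) :
    tensorMatrix D A q' * diagTensor E I θ = diagTensor E I θ * (tensorMatrix D A q)ᵀᴴ := by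
  rw [tensorMatrix_mul_diagTensor, tensorMatrix_transpose_conjTranspose _ hD,
    diagTensor_mul_tensorMatrix]
  simp only [h]

omit [Fintype I] in
theorem diagTensor_one : diagTensor E I (fun v => (1 : Matrix (Fin (n v)) (Fin (n v)) ℂ)) = 1 := by
  classical
  ext c' c
  rw [Matrix.one_apply]
  split_ifs with h
  · subst h; simp [diagTensor]
  · simp only [diagTensor, Matrix.of_apply]
    split_ifs with h'
    · obtain ⟨v, hv⟩ : ∃ v, c'.vert v ≠ c.vert v := by
        by_contra! h''
        exact h (Config.ext' (funext h'') h')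
      exact Finset.prod_eq_zero (Finset.mem_univ v) (Matrix.one_apply_ne hv)
    · rfl

theorem diagTensor_isometry {θ : ∀ v, Matrix (Fin (n' v)) (Fin (n v)) ℂ}
    (h : ∀ v, (θ v)ᴴ * θ v = 1) : (diagTensor E I θ)ᴴ * diagTensor E I θ = 1 := by
  classical
  have h1 : (diagTensor E I θ)ᴴ =
      tensorMatrix (α := Unit) (fun l' l => if l' = l then 1 else 0) (fun _ _ => {()})
        fun _ _ _ v => (θ v)ᴴ := by
    ext c' c
    by_cases hc : c'.edge = c.edge
    · simp [diagTensor, tensorMatrix, Matrix.conjTranspose_apply, hc]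
    · simp [diagTensor, tensorMatrix, Matrix.conjTranspose_apply, hc, Ne.symm hc]
  rw [h1, tensorMatrix_mul_diagTensor, ← diagTensor_one]
  ext c' c
  simp [diagTensor, tensorMatrix, h]

end TensorMatrix

/-! ### Matrices of operators and conjugations in orthonormal bases -/

section OpMatrix

open Matrix UnitaryFusionCategory

variable {C : Type u} [Category.{v} C] [Abelian C] [Linear ℂ C] [MonoidalCategory C]
  [MonoidalPreadditive C] [MonoidalLinear ℂ C] [UnitaryFusionCategory C]
  {X Y : C} (D : DualPair X Y) (B : HomONB X) (B' : HomONB Y)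

namespace HomONB

/-- The matrix of an operator on `hom(1, X)`. -/
def opMatrix (T : (𝟙_ C ⟶ X) → (𝟙_ C ⟶ X)) : Matrix (Fin B.n) (Fin B.n) ℂ :=
  Matrix.of fun a b => homInner (B.vec a) (T (B.vec b))

theorem opMatrix_id : B.opMatrix (fun x => x) = 1 := by
  ext a b
  simp [opMatrix, B.orthonormal, Matrix.one_apply]

/-- The matrix of the conjugation `hom(1, X) → hom(1, X⁻)`. -/
def conjMatrix : Matrix (Fin B'.n) (Fin B.n) ℂ :=
  Matrix.of fun a b => homInner (B'.vec a) (D.conj (B.vec b))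

variable {D B B'}

theorem conjMatrix_isometry : (conjMatrix D B B')ᴴ * conjMatrix D B B' = 1 := by
  ext a b
  simp only [Matrix.mul_apply, Matrix.conjTranspose_apply, conjMatrix, Matrix.of_apply,
    homInner_symm, Matrix.one_apply]
  rw [B'.sum_homInner_mul, DualPair.homInner_conj, B.orthonormal]
  simp [eq_comm]

/-- The conjugation is antilinear, so passing it through `T` conjugates the matrix entries; `ᵀᴴ` is
the entrywise complex conjugate. -/
theorem opMatrix_mul_conjMatrix {T : (𝟙_ C ⟶ X) → (𝟙_ C ⟶ X)} {T' : (𝟙_ C ⟶ Y) → (𝟙_ C ⟶ Y)}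
    (hT' : IsLinearMap ℂ T') (h : ∀ x, D.conj (T x) = T' (D.conj x)) :
    B'.opMatrix T' * conjMatrix D B B' = conjMatrix D B B' * (B.opMatrix T)ᵀᴴ := by
  ext a b
  simp only [Matrix.mul_apply, Matrix.conjTranspose_apply, Matrix.transpose_apply, conjMatrix,
    opMatrix, Matrix.of_apply, homInner_symm]
  have h1 : ∑ k, homInner (B'.vec a) (T' (B'.vec k)) * homInner (B'.vec k) (D.conj (B.vec b)) =
      homInner (B'.vec a) (T' (D.conj (B.vec b))) := by
    conv_rhs => rw [← B'.sum_homInner_smul (D.conj (B.vec b))]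
    change _ = homInner _ (hT'.mk' T' _)
    rw [map_sum, homInner_sum_right]
    refine Finset.sum_congr rfl fun k _ => ?_
    rw [map_smul, homInner_smul_right, mul_comm]
    rfl
  -- The conjugation is surjective, so every inner product in `hom(1, Y)` can be pulled back by
  -- antiunitarity.
  obtain ⟨w, hw⟩ : ∃ w, B'.vec a = D.conj w := ⟨D.swap.conj (B'.vec a), (D.swap.conj_conj _).symm⟩
  rw [h1, ← h, hw, DualPair.homInner_conj]
  simp only [DualPair.homInner_conj]
  rw [← B.sum_homInner_mul]
  exact Finset.sum_congr rfl fun k _ => mul_comm _ _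

end HomONB

end OpMatrix

end LevinWen

end

noncomputable section

namespace LevinWen

universe v u

open UnitaryFusionCategory SimpleObjects

/-! ### Matrix elements of the loop operators -/

section LoopMatrix

variable {C : Type u} [Category.{v} C] [Abelian C] [Linear ℂ C] [MonoidalCategory C]
  [MonoidalPreadditive C] [MonoidalLinear ℂ C] [UnitaryFusionCategory C]
  {S : SimpleObjects C}

theorem SimpleObjects.dim_nonneg (j : S.Irr) : 0 ≤ S.dim j :=
  (Complex.nonneg_iff.1 (scalar_comp_dag_nonneg (S.R j))).1

theorem SimpleObjects.globalDim_nonneg : 0 ≤ S.globalDim :=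
  Finset.sum_nonneg fun _ _ => sq_nonneg _

variable (S) in
open Classical in
/-- The weight of a change of the labels of the edges that meet `P` from `l` to `l'`. -/
def edgeWeight {F : Type*} (s t : ℝ) (P : Finset (F × Bool)) (l l' : F → S.Irr) : ℝ :=
  if ∀ e, (e, true) ∉ P → (e, false) ∉ P → l' e = l e then
    ∏ h ∈ P, S.dim (l h.1) ^ s * S.dim (l' h.1) ^ t
  else 0

/-- Quantum dimensions are nonnegative, hence so are their powers with arbitrary real exponents.
This is why the normalisation is immaterial for reflection positivity. -/
theorem edgeWeight_nonneg {F : Type*} (s t : ℝ) (P : Finset (F × Bool)) (l l' : F → S.Irr) :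
    0 ≤ edgeWeight S s t P l l' := by
  unfold edgeWeight
  split_ifs
  · exact Finset.prod_nonneg fun h _ => mul_nonneg (Real.rpow_nonneg (dim_nonneg _) _)
      (Real.rpow_nonneg (dim_nonneg _) _)
  · exact le_rfl

open Classical in
theorem edgeWeight_empty {F : Type*} (s t : ℝ) (l l' : F → S.Irr) :
    edgeWeight S s t ∅ l l' = if l' = l then 1 else 0 := by
  simp [edgeWeight, funext_iff]

open Classical in
/-- The choices of basis vectors of the fusion spaces at the half-edges in `P`. -/
def fusionRange (Φ : S.FusionONB) (j : S.Irr) {F : Type*} [Fintype F] (P : Finset (F × Bool))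
    (l l' : F → S.Irr) : Finset (F × Bool → ℕ) :=
  Fintype.piFinset fun h => if h ∈ P then Finset.range (Φ.N j (l h.1) (l' h.1) h.2) else {0}

theorem fusionRange_empty (Φ : S.FusionONB) (j : S.Irr) {F : Type*} [Fintype F]
    (l l' : F → S.Irr) : fusionRange Φ j ∅ l l' = {0} := by
  ext a
  simp [fusionRange, funext_iff]

variable {V E : Type*} [Fintype V] [Fintype E] {G : RibbonGraph V E}
  {β : ∀ v, HomONB (S.tens (G.link v))} {Φ : S.FusionONB}

theorem loopMatrix_apply (s t : ℝ) (p : Finset (E × Bool)) (j : S.Irr)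
    (c' c : Config (fun v => (β v).n) E S.Irr) :
    loopMatrix G β Φ s t p j c' c = edgeWeight S s t p c.edge c'.edge *
      ∑ a ∈ fusionRange Φ j p c.edge c'.edge, ∏ v,
        (β v).opMatrix (loopOp j (fusionLeft Φ p j c.edge c'.edge a)
          (fusionRight Φ p j c.edge c'.edge a) p (G.link v)) (c'.vert v) (c.vert v) := by
  classical
  rw [loopMatrix, edgeWeight]
  split_ifs with h
  · congr 1
    -- The default value `0` outside `p` is the only one that `fusionRange` allows there, so
    -- extension by it is a bijection.
    refine Finset.sum_bij' (fun a _ h => if hp : h ∈ p then (a ⟨h, hp⟩ : ℕ) else 0)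
      (fun a ha h => ⟨a h.1, ?_⟩) (fun a _ => ?_) (fun a _ => Finset.mem_univ _)
      (fun a _ => ?_) (fun a ha => ?_) (fun a _ => ?_)
    · have := Fintype.mem_piFinset.1 ha h.1
      simpa [h.2] using this
    · refine Fintype.mem_piFinset.2 fun h => ?_
      by_cases hp : h ∈ p
      · simp only [hp, dif_pos, if_true, Finset.mem_range]
        exact (a ⟨h, hp⟩).2
      · simp [hp]
    · funext h
      ext
      simp [h.2]
    · funext h
      by_cases hp : h ∈ p
      · simp [hp]
      · have := Fintype.mem_piFinset.1 ha h
        simp only [hp, if_false, Finset.mem_singleton] at this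
        simp [hp, this]
    · refine Finset.prod_congr rfl fun v _ => ?_
      rw [← leftFusion_eq a (by simp), ← rightFusion_eq a (by simp)]
      rfl
  · simp

end LoopMatrix

/-! ### Splitting edge data into crossing edges and two sides -/

section Join

variable {E₀ E₁ α : Type*}

/-- Data on the edges of the doubled graph from data on the crossing edges and on both sides. -/
def joinLabel (i : E₀ → α) (k : Bool → E₁ → α) : E₀ ⊕ E₁ × Bool → α :=
  Sum.elim i fun q => k q.2 q.1

/-- Data on the half-edges of the doubled graph from data on the crossing edges and on both
sides. -/
def joinBasis (a : E₀ × Bool → α) (k : Bool → E₁ × Bool → α) (h : (E₀ ⊕ E₁ × Bool) × Bool) : α :=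
  joinLabel (fun e => a (e, h.2)) (fun b e => k b (e, h.2)) h.1

variable [Fintype E₀] [Fintype E₁]

open Classical in
/-- The half-edges of `p` at crossing edges. -/
def crossPart (p : Finset ((E₀ ⊕ E₁ × Bool) × Bool)) : Finset (E₀ × Bool) :=
  Finset.univ.filter fun q => (Sum.inl q.1, q.2) ∈ p

open Classical in
/-- The half-edges of `p` at edges on one side. -/
def sidePart (p : Finset ((E₀ ⊕ E₁ × Bool) × Bool)) (b : Bool) : Finset (E₁ × Bool) :=
  Finset.univ.filter fun q => (Sum.inr (q.1, b), q.2) ∈ p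

omit [Fintype E₁] in
theorem mem_crossPart {p : Finset ((E₀ ⊕ E₁ × Bool) × Bool)} {q : E₀ × Bool} :
    q ∈ crossPart p ↔ (Sum.inl q.1, q.2) ∈ p := by simp [crossPart]

omit [Fintype E₀] in
theorem mem_sidePart {p : Finset ((E₀ ⊕ E₁ × Bool) × Bool)} {b : Bool} {q : E₁ × Bool} :
    q ∈ sidePart p b ↔ (Sum.inr (q.1, b), q.2) ∈ p := by simp [sidePart]

theorem prod_eq_crossPart_sidePart {M : Type*} [CommMonoid M]
    (p : Finset ((E₀ ⊕ E₁ × Bool) × Bool)) (f : (E₀ ⊕ E₁ × Bool) × Bool → M) :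
    ∏ h ∈ p, f h = (∏ q ∈ crossPart p, f (Sum.inl q.1, q.2)) *
      ((∏ q ∈ sidePart p false, f (Sum.inr (q.1, false), q.2)) *
        ∏ q ∈ sidePart p true, f (Sum.inr (q.1, true), q.2)) := by
  classical
  have h : ∏ h ∈ p, f h = ∏ h, if h ∈ p then f h else 1 := by
    rw [Finset.prod_ite_mem, Finset.univ_inter]
  rw [h, crossPart, sidePart, sidePart, Finset.prod_filter, Finset.prod_filter, Finset.prod_filter]
  simp only [Fintype.prod_prod_type, Fintype.prod_sum_type, Fintype.prod_bool,
    Finset.prod_mul_distrib]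
  ac_rfl

theorem sum_piFinset_join {M : Type*} [AddCommMonoid M]
    (T : (E₀ ⊕ E₁ × Bool) × Bool → Finset α) (f : ((E₀ ⊕ E₁ × Bool) × Bool → α) → M) :
    open Classical in
    ∑ a ∈ Fintype.piFinset T, f a =
      ∑ a₀ ∈ Fintype.piFinset fun q : E₀ × Bool => T (Sum.inl q.1, q.2),
        ∑ a ∈ Fintype.piFinset fun q : E₁ × Bool => T (Sum.inr (q.1, false), q.2),
          ∑ a' ∈ Fintype.piFinset fun q : E₁ × Bool => T (Sum.inr (q.1, true), q.2),
            f (joinBasis a₀ fun b => bif b then a' else a) := by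
  classical
  rw [← Finset.sum_product', ← Finset.sum_product']
  refine Finset.sum_nbij' (fun a => (((fun q => a (Sum.inl q.1, q.2)),
    (fun q => a (Sum.inr (q.1, false), q.2))), (fun q => a (Sum.inr (q.1, true), q.2))))
    (fun x => joinBasis x.1.1 fun b => bif b then x.2 else x.1.2) ?_ ?_ ?_ ?_ ?_
  · intro a ha
    simp only [Finset.mem_product, Fintype.mem_piFinset] at ha ⊢
    exact ⟨⟨fun q => ha _, fun q => ha _⟩, fun q => ha _⟩
  · intro a ha
    simp only [Finset.mem_product, Fintype.mem_piFinset] at ha ⊢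
    rintro ⟨e | ⟨e, _ | _⟩, s⟩
    · exact ha.1.1 (e, s)
    · exact ha.1.2 (e, s)
    · exact ha.2 (e, s)
  · intro a _
    funext h
    rcases h with ⟨e | ⟨e, _ | _⟩, s⟩ <;> rfl
  · intro a _
    rfl
  · intro a _
    congr 1
    funext h
    rcases h with ⟨e | ⟨e, _ | _⟩, s⟩ <;> rfl

end Join

end LevinWen

end

noncomputable section

namespace LevinWen

universe v u

open UnitaryFusionCategory SimpleObjects HalfGraph

/-! ### Factorisation of the loop operators across the mirror -/

section Halves

variable {C : Type u} [Category.{v} C] [Abelian C] [Linear ℂ C] [MonoidalCategory C]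
  [MonoidalPreadditive C] [MonoidalLinear ℂ C] [UnitaryFusionCategory C]
  {S : SimpleObjects C}

/-- Both the constraint on the labels and the weight are products over edges. -/
theorem edgeWeight_join {E₀ E₁ : Type*} [Fintype E₀] [Fintype E₁] (s t : ℝ)
    (p : Finset ((E₀ ⊕ E₁ × Bool) × Bool)) (i i' : E₀ → S.Irr) (k k' : Bool → E₁ → S.Irr) :
    edgeWeight S s t p (joinLabel i k) (joinLabel i' k') =
      edgeWeight S s t (crossPart p) i i' *
        (edgeWeight S s t (sidePart p false) (k false) (k' false) *
          edgeWeight S s t (sidePart p true) (k true) (k' true)) := by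
  classical
  have h : (∀ e, (e, true) ∉ p → (e, false) ∉ p → joinLabel i' k' e = joinLabel i k e) ↔
      (∀ e, (e, true) ∉ crossPart p → (e, false) ∉ crossPart p → i' e = i e) ∧
      (∀ e, (e, true) ∉ sidePart p false → (e, false) ∉ sidePart p false →
        k' false e = k false e) ∧
      (∀ e, (e, true) ∉ sidePart p true → (e, false) ∉ sidePart p true →
        k' true e = k true e) := by
    simp [joinLabel, mem_crossPart, mem_sidePart, Sum.forall, Prod.forall, forall_and]
  simp only [edgeWeight, h, prod_eq_crossPart_sidePart p]
  split_ifs with h1 h2 h3 h4 h5 h6 h7 <;> first | rfl | tauto | simp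

theorem sum_fusionRange_join {E₀ E₁ M : Type*} [Fintype E₀] [Fintype E₁] [AddCommMonoid M]
    (Φ : S.FusionONB) (j : S.Irr) (p : Finset ((E₀ ⊕ E₁ × Bool) × Bool)) (i i' : E₀ → S.Irr)
    (k k' : Bool → E₁ → S.Irr) (f : ((E₀ ⊕ E₁ × Bool) × Bool → ℕ) → M) :
    ∑ a ∈ fusionRange Φ j p (joinLabel i k) (joinLabel i' k'), f a =
      ∑ a₀ ∈ fusionRange Φ j (crossPart p) i i',
        ∑ a ∈ fusionRange Φ j (sidePart p false) (k false) (k' false),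
          ∑ a' ∈ fusionRange Φ j (sidePart p true) (k true) (k' true),
            f (joinBasis a₀ fun b => bif b then a' else a) := by
  classical
  have h0 : fusionRange Φ j (crossPart p) i i' = Fintype.piFinset fun q : E₀ × Bool =>
      if (Sum.inl q.1, q.2) ∈ p then Finset.range (Φ.N j (i q.1) (i' q.1) q.2) else {0} := by
    unfold fusionRange
    congr 1
    funext q
    simp only [mem_crossPart]
  have h1 : ∀ b, fusionRange Φ j (sidePart p b) (k b) (k' b) = Fintype.piFinset fun q : E₁ × Bool =>
      if (Sum.inr (q.1, b), q.2) ∈ p then Finset.range (Φ.N j (k b q.1) (k' b q.1) q.2)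
      else {0} := by
    intro b
    unfold fusionRange
    congr 1
    funext q
    simp only [mem_sidePart]
  rw [h0, h1, h1, fusionRange]
  convert sum_piFinset_join _ f <;> rfl

variable {V E₀ E₁ : Type*} {Γ : HalfGraph V E₀ E₁}

theorem HalfGraph.exists_of_mem_link {v : V} {b : Bool} {h : (E₀ ⊕ E₁ × Bool) × Bool}
    (hh : h ∈ Γ.double.link (v, b)) : (∃ e, h.1 = Sum.inl e) ∨ ∃ e, h.1 = Sum.inr (e, b) := by
  rw [Γ.double.mem_link] at hh
  rcases h with ⟨e | ⟨e, b'⟩, s⟩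
  · exact Or.inl ⟨e, rfl⟩
  · refine Or.inr ⟨e, ?_⟩
    have := congrArg Prod.snd hh
    cases b' <;> exact congrArg (fun b => Sum.inr (e, b)) this

theorem joinLabel_eq_of_mem_link {α : Type*} {v : V} {b : Bool} {h : (E₀ ⊕ E₁ × Bool) × Bool}
    (hh : h ∈ Γ.double.link (v, b)) (i : E₀ → α) (k : Bool → E₁ → α) :
    joinLabel i k h.1 = joinLabel i (fun _ => k b) h.1 := by
  obtain ⟨e, he⟩ | ⟨e, he⟩ := HalfGraph.exists_of_mem_link hh <;> rw [he] <;> rfl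

theorem fusionLeft_congr {Φ : S.FusionONB} {E : Type*} {p : Finset (E × Bool)} {j : S.Irr}
    {l l' m m' : E → S.Irr} {a b : E × Bool → ℕ} {h : E × Bool} (hl : l h.1 = m h.1)
    (hl' : l' h.1 = m' h.1) (ha : a h = b h) :
    fusionLeft Φ p j l l' a h = fusionLeft Φ p j m m' b h := by
  rw [fusionLeft, fusionLeft, hl, hl', ha]

theorem fusionRight_congr {Φ : S.FusionONB} {E : Type*} {p : Finset (E × Bool)} {j : S.Irr}
    {l l' m m' : E → S.Irr} {a b : E × Bool → ℕ} {g : E × Bool} (hl : l g.1 = m g.1)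
    (hl' : l' g.1 = m' g.1) (ha : a (opp g) = b (opp g)) :
    fusionRight Φ p j l l' a g = fusionRight Φ p j m m' b g := by
  rw [fusionRight, fusionRight, hl, hl', ha]

/-- The operators at a vertex depend only on the data on the same side. -/
theorem loopOp_fusion_join (Φ : S.FusionONB) (j : S.Irr) (p : Finset ((E₀ ⊕ E₁ × Bool) × Bool))
    (i i' : E₀ → S.Irr) (k k' : Bool → E₁ → S.Irr) (a₀ : E₀ × Bool → ℕ)
    (a : Bool → E₁ × Bool → ℕ) (v : V) (b : Bool) :
    loopOp j (fusionLeft Φ p j (joinLabel i k) (joinLabel i' k') (joinBasis a₀ a))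
        (fusionRight Φ p j (joinLabel i k) (joinLabel i' k') (joinBasis a₀ a)) p
        (Γ.double.link (v, b)) =
      loopOp j (fusionLeft Φ p j (joinLabel i fun _ => k b) (joinLabel i' fun _ => k' b)
          (joinBasis a₀ fun _ => a b))
        (fusionRight Φ p j (joinLabel i fun _ => k b) (joinLabel i' fun _ => k' b)
          (joinBasis a₀ fun _ => a b)) p (Γ.double.link (v, b)) := by
  funext x
  refine loopOp_congr (fun h hh => ?_) (fun h hh => ?_) x
  · have h1 := joinLabel_eq_of_mem_link hh (fun e => a₀ (e, h.2)) (fun b e => a b (e, h.2))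
    exact fusionLeft_congr (joinLabel_eq_of_mem_link hh i k) (joinLabel_eq_of_mem_link hh i' k') h1
  · have h1 := joinLabel_eq_of_mem_link hh (fun e => a₀ (e, !h.2)) (fun b e => a b (e, !h.2))
    exact fusionRight_congr (joinLabel_eq_of_mem_link hh i k) (joinLabel_eq_of_mem_link hh i' k') h1

variable (β : ∀ v, HomONB (S.tens (Γ.double.link v)))

/-- Labels of a product basis of the part of `𝓗` on one side that does not include the crossing
edges. -/
abbrev SideConfig (b : Bool) := Config (fun v : V => (β (v, b)).n) E₁ S.Irr

/-- The labels of the product basis of `𝓗` as triples of labels of the crossing edges and of labels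
of both sides. -/
def joinConfig : (E₀ → S.Irr) × SideConfig β false × SideConfig β true ≃
    Config (fun v => (β v).n) (E₀ ⊕ E₁ × Bool) S.Irr where
  toFun x := ⟨fun v => match v with
      | (v, false) => x.2.1.vert v
      | (v, true) => x.2.2.vert v,
    joinLabel x.1 fun b => bif b then x.2.2.edge else x.2.1.edge⟩
  invFun c := ⟨fun e => c.edge (Sum.inl e), ⟨fun v => c.vert (v, false), fun e =>
    c.edge (Sum.inr (e, false))⟩, ⟨fun v => c.vert (v, true), fun e => c.edge (Sum.inr (e, true))⟩⟩
  left_inv _ := rfl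
  right_inv c := by
    refine Config.ext' (funext fun v => ?_) (funext fun e => ?_)
    · rcases v with ⟨v, _ | _⟩ <;> rfl
    · rcases e with e | ⟨e, _ | _⟩ <;> rfl

theorem joinConfig_edge (i : E₀ → S.Irr) (m : SideConfig β false) (q : SideConfig β true) :
    (joinConfig β (i, m, q)).edge = joinLabel i fun b => bif b then q.edge else m.edge := rfl

theorem joinConfig_vert_false (i : E₀ → S.Irr) (m : SideConfig β false) (q : SideConfig β true)
    (v : V) : (joinConfig β (i, m, q)).vert (v, false) = m.vert v := rfl

theorem joinConfig_vert_true (i : E₀ → S.Irr) (m : SideConfig β false) (q : SideConfig β true)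
    (v : V) : (joinConfig β (i, m, q)).vert (v, true) = q.vert v := rfl

variable [Fintype V] [Fintype E₁]

/-- The reflection of the vertices and edges of one side. -/
def sideReflection : Matrix (SideConfig β false) (SideConfig β true) ℂ :=
  diagTensor E₁ S.Irr fun v =>
    HomONB.conjMatrix (S.tensPair Γ (Γ.link v)) (β (v, true)) (β (v, false))

theorem sideReflection_isometry :
    (sideReflection β).conjTranspose * sideReflection β = 1 :=
  diagTensor_isometry fun _ => HomONB.conjMatrix_isometry

variable [Fintype E₀]

/-- The part of a plaquette operator on one side. -/
def sideLoop (Φ : S.FusionONB) (s t : ℝ) (p : Finset ((E₀ ⊕ E₁ × Bool) × Bool)) (j : S.Irr)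
    (b : Bool) (i' i : E₀ → S.Irr) (a₀ : E₀ × Bool → ℕ) :
    Matrix (SideConfig β b) (SideConfig β b) ℂ :=
  tensorMatrix (fun k' k => (edgeWeight S s t (sidePart p b) k k' : ℂ))
    (fun k' k => fusionRange Φ j (sidePart p b) k k')
    fun k' k a v => (β (v, b)).opMatrix
      (loopOp j (fusionLeft Φ p j (joinLabel i fun _ => k) (joinLabel i' fun _ => k')
          (joinBasis a₀ fun _ => a))
        (fusionRight Φ p j (joinLabel i fun _ => k) (joinLabel i' fun _ => k')
          (joinBasis a₀ fun _ => a)) p (Γ.double.link (v, b)))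

variable {β} {Φ : S.FusionONB} {s t : ℝ} {p : Finset ((E₀ ⊕ E₁ × Bool) × Bool)} {j : S.Irr}

/-- The two halves share only the labels of the crossing edges and the choices of fusion vectors
there. Once these are fixed everything else factorises, in the form asked for by
`toEuclideanCLM_mem_reflectionCone`. -/
theorem loopMatrix_joinConfig (i' : E₀ → S.Irr) (m' : SideConfig β false)
    (q' : SideConfig β true) (i : E₀ → S.Irr) (m : SideConfig β false) (q : SideConfig β true) :
    loopMatrix Γ.double β Φ s t p j (joinConfig β (i', m', q')) (joinConfig β (i, m, q)) =
      edgeWeight S s t (crossPart p) i i' * ∑ a ∈ fusionRange Φ j (crossPart p) i i',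
        sideLoop β Φ s t p j false i' i a m' m * sideLoop β Φ s t p j true i' i a q' q := by
  rw [loopMatrix_apply, joinConfig_edge, joinConfig_edge, edgeWeight_join, sum_fusionRange_join]
  simp only [loopOp_fusion_join, Fintype.prod_prod_type, Fintype.prod_bool, cond_true, cond_false,
    joinConfig_vert_false, joinConfig_vert_true, sideLoop, tensorMatrix, Matrix.of_apply]
  push_cast
  simp only [mul_assoc, Finset.mul_sum, Finset.sum_mul, Finset.prod_mul_distrib]
  refine Finset.sum_congr rfl fun a _ => ?_
  rw [Finset.sum_comm]
  refine Finset.sum_congr rfl fun a' _ => Finset.sum_congr rfl fun a'' _ => ?_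
  ring

omit [Fintype E₁] in
theorem crossPart_mirrorFace : crossPart (mirrorFace p) = crossPart p := by
  ext q
  rw [mem_crossPart, mem_crossPart, mem_mirrorFace]
  rfl

omit [Fintype E₀] in
theorem sidePart_mirrorFace (b : Bool) : sidePart (mirrorFace p) b = sidePart p (!b) := by
  ext q
  rw [mem_sidePart, mem_sidePart, mem_mirrorFace]
  rfl

/-- The operators of one side are written with the data of that side copied to the other. Such data
are invariant under the reflection, so `conjVertex_loopOp_fusion` applies at every vertex. -/
theorem sideLoop_intertwine (hΓ : Γ.double.IsRegular) (hp : p ∈ Γ.double.plaquettes)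
    (i' i : E₀ → S.Irr) (a₀ : E₀ × Bool → ℕ) :
    sideLoop β Φ s t (mirrorFace p) j false i' i a₀ * sideReflection β =
      sideReflection β * (sideLoop β Φ s t p j true i' i a₀).transpose.conjTranspose := by
  unfold sideLoop
  rw [sidePart_mirrorFace]
  refine tensorMatrix_intertwine (fun _ _ => Complex.conj_ofReal _) fun k' k a v => ?_
  refine HomONB.opMatrix_mul_conjMatrix (isLinearMap_loopOp _ _ _ _ _) fun x => ?_
  have h := conjVertex_loopOp_fusion (Φ := Φ) (j := j) hΓ hp (l := joinLabel i fun _ => k)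
    (l' := joinLabel i' fun _ => k') (a := joinBasis a₀ fun _ => a) (by
      rintro (e | ⟨e, b⟩) <;> rfl) (by rintro (e | ⟨e, b⟩) <;> rfl)
      (by rintro ⟨e | ⟨e, b⟩, s⟩ <;> rfl) v x
  rw [conjVertex_eq, conjVertex_eq] at h
  exact h

/-- No corner of `p` occurs on this side, the weight forces equal labels, and only the zero choice
of fusion vectors remains. -/
theorem sideLoop_eq_one {b : Bool} (h0 : crossPart p = ∅) (hb : sidePart p b = ∅)
    (i' i : E₀ → S.Irr) (a₀ : E₀ × Bool → ℕ) : sideLoop β Φ s t p j b i' i a₀ = 1 := by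
  classical
  have h : ∀ v Y Z, loopOp j Y Z p (Γ.double.link (v, b)) = fun x => x := fun v Y Z => by
    funext x
    refine loopOp_of_forall_notMem (fun h hh hp => ?_) x
    obtain ⟨e, he⟩ | ⟨e, he⟩ := HalfGraph.exists_of_mem_link hh
    · have : (e, h.2) ∈ crossPart p := mem_crossPart.2 (by rwa [← he])
      simp [h0] at this
    · have : (e, h.2) ∈ sidePart p b := mem_sidePart.2 (by rwa [← he])
      simp [hb] at this
  rw [← diagTensor_one]
  ext c' c
  simp [sideLoop, tensorMatrix, diagTensor, h, HomONB.opMatrix_id, hb, edgeWeight_empty,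
    fusionRange_empty]
  split_ifs <;> simp

end Halves

end LevinWen

end

noncomputable section

namespace LevinWen

universe v u

open UnitaryFusionCategory SimpleObjects HalfGraph

/-! ### The vertex terms as one-sided operators -/

section VertexTerms

variable {C : Type u} [Category.{v} C] [Abelian C] [Linear ℂ C] [MonoidalCategory C]
  [MonoidalPreadditive C] [MonoidalLinear ℂ C] [UnitaryFusionCategory C]
  {S : SimpleObjects C} {V E₀ E₁ : Type*} {Γ : HalfGraph V E₀ E₁}

theorem projLegs_congr {E : Type*} {l l' : E → S.Irr} {L : List (E × Bool)}
    (h : ∀ g ∈ L, l g.1 = l' g.1) : S.projLegs l L = S.projLegs l' L := by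
  induction L with
  | nil => rfl
  | cons g L ih =>
    rw [projLegs, projLegs, h g (by simp), ih fun g hg => h g (List.mem_cons_of_mem _ hg)]

variable (β : ∀ v, HomONB (S.tens (Γ.double.link v))) [Fintype V] [Fintype E₁]

open Classical in
/-- The part of a vertex operator on the side of the vertex. -/
def sideVertex (b : Bool) (v : V) (i : E₀ → S.Irr) : Matrix (SideConfig β b) (SideConfig β b) ℂ :=
  tensorMatrix (α := Unit) (fun k' k => if k' = k then 1 else 0) (fun _ _ => {()})
    fun _ k _ w => (β (w, b)).opMatrix fun x =>
      if w = v then x ≫ S.projLegs (joinLabel i fun _ => k) (Γ.double.link (w, b)) else x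

variable {β}

open Classical in
theorem sideVertex_apply (b : Bool) (v : V) (i : E₀ → S.Irr) (c' c : SideConfig β b) :
    sideVertex β b v i c' c = if c'.edge = c.edge ∧ ∀ w, w ≠ v → c'.vert w = c.vert w then
      homInner ((β (v, b)).vec (c'.vert v)) ((β (v, b)).vec (c.vert v) ≫
        S.projLegs (joinLabel i fun _ => c.edge) (Γ.double.link (v, b))) else 0 := by
  simp only [sideVertex, tensorMatrix, Matrix.of_apply, Finset.sum_singleton, ite_mul, one_mul,
    zero_mul]
  by_cases h : c'.edge = c.edge
  · by_cases h' : ∀ w, w ≠ v → c'.vert w = c.vert w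
    · rw [if_pos h, if_pos ⟨h, h'⟩, Finset.prod_eq_single v]
      · simp [HomONB.opMatrix]
      · intro w _ hw
        simp [hw, HomONB.opMatrix_id, h' w hw]
      · simp
    · rw [if_pos h, if_neg fun h'' => h' h''.2]
      push Not at h'
      obtain ⟨w, hw, hw'⟩ := h'
      refine Finset.prod_eq_zero (Finset.mem_univ w) ?_
      simp [hw, HomONB.opMatrix_id, hw']
  · rw [if_neg h, if_neg fun h'' => h h''.1]

/-- At `v` the label projections of the two mirror images are conjugate by `isConj_projLegs`; at the
other vertices the operator is the identity. -/
theorem sideVertex_intertwine (v : V) (i : E₀ → S.Irr) :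
    sideVertex β false v i * sideReflection β =
      sideReflection β * (sideVertex β true v i).transpose.conjTranspose := by
  classical
  unfold sideVertex
  refine tensorMatrix_intertwine (fun _ _ => by split_ifs <;> simp) fun _ k _ w => ?_
  refine HomONB.opMatrix_mul_conjMatrix ?_ fun x => ?_
  · split_ifs
    · exact ⟨fun x y => by simp, fun c x => by simp⟩
    · exact ⟨fun x y => rfl, fun c x => rfl⟩
  · by_cases hw : w = v
    · refine (congrArg (S.tensPair Γ (Γ.link w)).conj (if_pos hw)).trans
        (Eq.trans ?_ (if_pos hw).symm)
      refine (IsConj.eq_conj ((IsConj.conj _ x).comp (S.isConj_projLegs Γ (fun d => ?_) _))).symm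
      rw [← HalfGraph.edgeMirror_up]
      rcases (Γ.up d).1 with e | ⟨e, b⟩ <;> rfl
    · exact (congrArg (S.tensPair Γ (Γ.link w)).conj (if_neg hw)).trans (if_neg hw).symm

omit [Fintype V] [Fintype E₁] in
theorem joinConfig_edge_eq_iff (i' : E₀ → S.Irr) (m' : SideConfig β false)
    (q' : SideConfig β true) (i : E₀ → S.Irr) (m : SideConfig β false) (q : SideConfig β true) :
    (joinConfig β (i', m', q')).edge = (joinConfig β (i, m, q)).edge ↔
      i' = i ∧ m'.edge = m.edge ∧ q'.edge = q.edge := by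
  constructor
  · intro h
    exact ⟨funext fun e => congrFun h (Sum.inl e), funext fun e => congrFun h (Sum.inr (e, false)),
      funext fun e => congrFun h (Sum.inr (e, true))⟩
  · rintro ⟨h1, h2, h3⟩
    rw [joinConfig_edge, joinConfig_edge, h1, h2, h3]

variable [Fintype E₀]

open Classical in
theorem vertexMatrix_joinConfig_false (v : V) (i' : E₀ → S.Irr) (m' : SideConfig β false)
    (q' : SideConfig β true) (i : E₀ → S.Irr) (m : SideConfig β false) (q : SideConfig β true) :
    vertexMatrix S Γ.double β (v, false) (joinConfig β (i', m', q')) (joinConfig β (i, m, q)) =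
      if i' = i then if q' = q then sideVertex β false v i m' m else 0 else 0 := by
  have hl : S.projLegs (joinConfig β (i, m, q)).edge (Γ.double.link (v, false)) =
      S.projLegs (joinLabel i fun _ => m.edge) (Γ.double.link (v, false)) :=
    projLegs_congr fun g hg =>
      joinLabel_eq_of_mem_link hg i fun b => bif b then q.edge else m.edge
  have hw : (∀ w, w ≠ (v, false) → (joinConfig β (i', m', q')).vert w =
      (joinConfig β (i, m, q)).vert w) ↔ (∀ w, w ≠ v → m'.vert w = m.vert w) ∧ q'.vert = q.vert := by
    constructor
    · exact fun h => ⟨fun w hw => h (w, false) (by simpa using hw),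
        funext fun w => h (w, true) (by simp)⟩
    · rintro ⟨h1, h2⟩ ⟨w, _ | _⟩ hw
      · exact h1 w (by simpa using hw)
      · exact congrFun h2 w
  have hq : q' = q ↔ q'.vert = q.vert ∧ q'.edge = q.edge :=
    ⟨fun h => by simp [h], fun h => Config.ext' h.1 h.2⟩
  rw [vertexMatrix, hl, sideVertex_apply]
  simp only [hw, hq, joinConfig_edge_eq_iff, joinConfig_vert_false, ← ite_and]
  congr 1
  simp only [eq_iff_iff]
  tauto

open Classical in
theorem vertexMatrix_joinConfig_true (v : V) (i' : E₀ → S.Irr) (m' : SideConfig β false)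
    (q' : SideConfig β true) (i : E₀ → S.Irr) (m : SideConfig β false) (q : SideConfig β true) :
    vertexMatrix S Γ.double β (v, true) (joinConfig β (i', m', q')) (joinConfig β (i, m, q)) =
      if i' = i then if m' = m then sideVertex β true v i q' q else 0 else 0 := by
  have hl : S.projLegs (joinConfig β (i, m, q)).edge (Γ.double.link (v, true)) =
      S.projLegs (joinLabel i fun _ => q.edge) (Γ.double.link (v, true)) :=
    projLegs_congr fun g hg =>
      joinLabel_eq_of_mem_link hg i fun b => bif b then q.edge else m.edge
  have hw : (∀ w, w ≠ (v, true) → (joinConfig β (i', m', q')).vert w =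
      (joinConfig β (i, m, q)).vert w) ↔ (∀ w, w ≠ v → q'.vert w = q.vert w) ∧ m'.vert = m.vert := by
    constructor
    · exact fun h => ⟨fun w hw => h (w, true) (by simpa using hw),
        funext fun w => h (w, false) (by simp)⟩
    · rintro ⟨h1, h2⟩ ⟨w, _ | _⟩ hw
      · exact congrFun h2 w
      · exact h1 w (by simpa using hw)
  have hq : m' = m ↔ m'.vert = m.vert ∧ m'.edge = m.edge :=
    ⟨fun h => by simp [h], fun h => Config.ext' h.1 h.2⟩
  rw [vertexMatrix, hl, sideVertex_apply]
  simp only [hw, hq, joinConfig_edge_eq_iff, joinConfig_vert_true, ← ite_and]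
  congr 1
  simp only [eq_iff_iff]
  tauto

end VertexTerms

/-! ### Decomposition of the interaction into crossing and one-sided parts -/

section OneSided

variable {C : Type u} [Category.{v} C] [Abelian C] [Linear ℂ C] [MonoidalCategory C]
  [MonoidalPreadditive C] [MonoidalLinear ℂ C] [UnitaryFusionCategory C]
  {S : SimpleObjects C} {V E₀ E₁ : Type*} {Γ : HalfGraph V E₀ E₁}

section Faces

variable [Fintype E₀] [Fintype E₁]

variable (Γ) in
open Classical in
/-- The plaquettes that cross the mirror. -/
def crossFaces : Finset (Finset ((E₀ ⊕ E₁ × Bool) × Bool)) :=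
  Γ.double.plaquettes.filter fun p => crossPart p ≠ ∅

variable (Γ) in
open Classical in
/-- The plaquettes on one side. -/
def sideFaces (b : Bool) : Finset (Finset ((E₀ ⊕ E₁ × Bool) × Bool)) :=
  Γ.double.plaquettes.filter fun p => crossPart p = ∅ ∧ sidePart p (!b) = ∅

/-- By `exists_side`, a plaquette without crossing edges lies on one side, and only on one since it
is nonempty. -/
theorem sum_plaquettes {M : Type*} [AddCommMonoid M]
    (f : Finset ((E₀ ⊕ E₁ × Bool) × Bool) → M) :
    ∑ p ∈ Γ.double.plaquettes, f p =
      ∑ p ∈ crossFaces Γ, f p + (∑ p ∈ sideFaces Γ false, f p + ∑ p ∈ sideFaces Γ true, f p) := by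
  classical
  rw [crossFaces, ← Finset.sum_filter_not_add_sum_filter _ fun p => crossPart p = ∅]
  congr 1
  rw [sideFaces, sideFaces, ← Finset.filter_filter, ← Finset.filter_filter,
    ← Finset.sum_filter_add_sum_filter_not (Γ.double.plaquettes.filter fun p => crossPart p = ∅)
      fun p => sidePart p (!false) = ∅]
  congr 1
  refine Finset.sum_congr (Finset.filter_congr fun p hp => ?_) fun _ _ => rfl
  obtain ⟨hp, h0⟩ := Finset.mem_filter.1 hp
  obtain ⟨b, hb⟩ := exists_side hp fun e s he => by
    have : (e, s) ∈ crossPart p := mem_crossPart.2 he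
    simp [h0] at this
  have hne : ∃ h, h ∈ p := by
    obtain ⟨h, hh⟩ := Γ.double.mem_plaquettes.1 hp
    exact ⟨h, (hh h).2 (Equiv.Perm.SameCycle.refl _ _)⟩
  have hb' : sidePart p (!b) = ∅ := by
    refine Finset.eq_empty_of_forall_notMem fun q hq => ?_
    obtain ⟨e, s, h⟩ := hb _ (mem_sidePart.1 hq)
    cases b <;> simp at h
  have hb'' : sidePart p b ≠ ∅ := by
    obtain ⟨h, hh⟩ := hne
    obtain ⟨e, s, rfl⟩ := hb h hh
    exact Finset.ne_empty_of_mem (mem_sidePart (q := (e, s)).2 hh)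
  cases b
  · simp_all
  · simp_all

theorem mirrorFace_mem_sideFaces {p : Finset ((E₀ ⊕ E₁ × Bool) × Bool)} {b : Bool}
    (hp : p ∈ sideFaces Γ b) : mirrorFace p ∈ sideFaces Γ (!b) := by
  classical
  obtain ⟨hp, h0, h1⟩ := Finset.mem_filter.1 hp
  refine Finset.mem_filter.2 ⟨mirrorFace_mem hp, by rwa [crossPart_mirrorFace], ?_⟩
  rw [sidePart_mirrorFace, Bool.not_not, h1]

theorem mirrorFace_eq_of_mem_crossFaces {p : Finset ((E₀ ⊕ E₁ × Bool) × Bool)}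
    (hp : p ∈ crossFaces Γ) : mirrorFace p = p := by
  classical
  obtain ⟨hp, h0⟩ := Finset.mem_filter.1 hp
  obtain ⟨q, hq⟩ := Finset.nonempty_iff_ne_empty.2 h0
  exact mirrorFace_eq_of_mem hp (mem_crossPart.1 hq)

end Faces

variable [Fintype V] [Fintype E₀] [Fintype E₁]
  {β : ∀ v, HomONB (S.tens (Γ.double.link v))} {Φ : S.FusionONB}

open Classical in
theorem loopMatrix_joinConfig_false {s t : ℝ} {p : Finset ((E₀ ⊕ E₁ × Bool) × Bool)} {j : S.Irr}
    (hp : p ∈ sideFaces Γ false) (i' : E₀ → S.Irr) (m' : SideConfig β false)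
    (q' : SideConfig β true) (i : E₀ → S.Irr) (m : SideConfig β false) (q : SideConfig β true) :
    loopMatrix Γ.double β Φ s t p j (joinConfig β (i', m', q')) (joinConfig β (i, m, q)) =
      if i' = i then if q' = q then sideLoop β Φ s t p j false i i 0 m' m else 0 else 0 := by
  obtain ⟨hp, h0, h1⟩ := Finset.mem_filter.1 hp
  rw [loopMatrix_joinConfig, h0, edgeWeight_empty, fusionRange_empty, Finset.sum_singleton,
    sideLoop_eq_one h0 (b := true) h1, Matrix.one_apply]
  split_ifs with hi hq <;> simp [hi]

open Classical in
theorem loopMatrix_joinConfig_true {s t : ℝ} {p : Finset ((E₀ ⊕ E₁ × Bool) × Bool)} {j : S.Irr}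
    (hp : p ∈ sideFaces Γ true) (i' : E₀ → S.Irr) (m' : SideConfig β false)
    (q' : SideConfig β true) (i : E₀ → S.Irr) (m : SideConfig β false) (q : SideConfig β true) :
    loopMatrix Γ.double β Φ s t p j (joinConfig β (i', m', q')) (joinConfig β (i, m, q)) =
      if i' = i then if m' = m then sideLoop β Φ s t p j true i i 0 q' q else 0 else 0 := by
  obtain ⟨hp, h0, h1⟩ := Finset.mem_filter.1 hp
  rw [loopMatrix_joinConfig, h0, edgeWeight_empty, fusionRange_empty, Finset.sum_singleton,
    sideLoop_eq_one h0 (b := false) h1, Matrix.one_apply]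
  split_ifs with hi hq <;> simp [hi]

variable (β Φ)

/-- The part of the interaction on one side. -/
def sideInteraction (r s t lamP lamV : ℝ) (b : Bool) (i : E₀ → S.Irr) :
    Matrix (SideConfig β b) (SideConfig β b) ℂ :=
  (lamP : ℂ) • ∑ p ∈ sideFaces Γ b, ∑ j, ((S.dim j ^ r / S.globalDim : ℝ) : ℂ) •
      sideLoop β Φ s t p j b i i 0 +
    (lamV : ℂ) • ∑ v, sideVertex β b v i

variable {β Φ}

/-- The reflection is a bijection between the plaquettes of the two sides, along which the sums are
reindexed; the coefficients are real. -/
theorem sideInteraction_intertwine (hΓ : Γ.double.IsRegular) (r s t lamP lamV : ℝ)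
    (i : E₀ → S.Irr) :
    sideInteraction β Φ r s t lamP lamV false i * sideReflection β =
      sideReflection β *
        (sideInteraction β Φ r s t lamP lamV true i).transpose.conjTranspose := by
  simp only [sideInteraction, Matrix.add_mul, Matrix.mul_add, Matrix.transpose_add,
    Matrix.conjTranspose_add, Matrix.transpose_smul, Matrix.conjTranspose_smul, Matrix.smul_mul,
    Matrix.mul_smul, Matrix.transpose_sum, Matrix.conjTranspose_sum, Matrix.sum_mul, Matrix.mul_sum,
    sideVertex_intertwine, Complex.star_def, Complex.conj_ofReal]
  congr 2
  refine Finset.sum_nbij' mirrorFace mirrorFace (fun p => mirrorFace_mem_sideFaces)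
    (fun p => mirrorFace_mem_sideFaces) (fun p _ => mirrorFace_mirrorFace p)
    (fun p _ => mirrorFace_mirrorFace p) fun p hp => ?_
  classical
  have h := mirrorFace_mem (Finset.mem_filter.1 hp).1
  refine Finset.sum_congr rfl fun j _ => ?_
  rw [← sideLoop_intertwine hΓ h, mirrorFace_mirrorFace]

variable (β Φ) in
/-- The plaquette operators at the plaquettes that cross the mirror. -/
def crossInteraction (r s t lamP : ℝ) :
    Matrix (Config (fun v => (β v).n) (E₀ ⊕ E₁ × Bool) S.Irr)
      (Config (fun v => (β v).n) (E₀ ⊕ E₁ × Bool) S.Irr) ℂ :=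
  (lamP : ℂ) • ∑ p ∈ crossFaces Γ, plaquetteMatrix Γ.double β Φ r s t p

-- A crossing plaquette is its own mirror image, so the two halves of its operator intertwine with
-- each other and the cone criterion applies to each loop label separately.
open Matrix in
theorem crossInteraction_mem (hΓ : Γ.double.IsRegular) {r s t lamP : ℝ} (hP : 0 ≤ lamP)
    (F : Space S Γ.double β) (hF : F ∈ reflectionCone (joinConfig β) (sideReflection β)) :
    toEuclideanCLM (𝕜 := ℂ) (crossInteraction β Φ r s t lamP) F ∈
      reflectionCone (joinConfig β) (sideReflection β) := by
  classical
  have hl : ∀ p ∈ crossFaces Γ, ∀ j, toEuclideanCLM (𝕜 := ℂ) (loopMatrix Γ.double β Φ s t p j) F ∈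
      reflectionCone (joinConfig β) (sideReflection β) := by
    intro p hp j
    refine toEuclideanCLM_mem_reflectionCone
      (W := fun i' i => edgeWeight S s t (crossPart p) i i') (fun i' i => edgeWeight_nonneg _ _ _ _ _)
      (fun i' m' q' i m q => loopMatrix_joinConfig i' m' q' i m q) (fun i' i a _ => ?_) hF
    have h := sideLoop_intertwine (β := β) (Φ := Φ) (s := s) (t := t) (j := j) hΓ
      (Finset.mem_filter.1 hp).1 i' i a
    rwa [mirrorFace_eq_of_mem_crossFaces hp] at h
  have e : toEuclideanCLM (𝕜 := ℂ) (crossInteraction β Φ r s t lamP) F = (lamP : ℂ) •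
      ∑ p ∈ crossFaces Γ, ∑ j, ((S.dim j ^ r / S.globalDim : ℝ) : ℂ) •
        toEuclideanCLM (𝕜 := ℂ) (loopMatrix Γ.double β Φ s t p j) F := by
    simp only [crossInteraction, plaquetteMatrix, map_smul, map_sum]
    rw [_root_.smul_apply, _root_.sum_apply]
    simp only [_root_.sum_apply, _root_.smul_apply]
  rw [e]
  exact smul_mem_reflectionCone hP (sum_mem_reflectionCone _ fun p hp => sum_mem_reflectionCone _ fun j _ =>
    smul_mem_reflectionCone (div_nonneg (Real.rpow_nonneg (dim_nonneg _) _) globalDim_nonneg)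
      (hl p hp j))

open Classical in
theorem interaction_joinConfig (r s t lamP lamV : ℝ) (i' : E₀ → S.Irr) (m' : SideConfig β false)
    (q' : SideConfig β true) (i : E₀ → S.Irr) (m : SideConfig β false) (q : SideConfig β true) :
    ((lamP : ℂ) • ∑ p ∈ Γ.double.plaquettes, plaquetteMatrix Γ.double β Φ r s t p +
        (lamV : ℂ) • ∑ v, vertexMatrix S Γ.double β v)
      (joinConfig β (i', m', q')) (joinConfig β (i, m, q)) =
    crossInteraction β Φ r s t lamP (joinConfig β (i', m', q')) (joinConfig β (i, m, q)) +
      if i' = i then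
        (if q' = q then sideInteraction β Φ r s t lamP lamV false i m' m else 0) +
        (if m' = m then sideInteraction β Φ r s t lamP lamV true i q' q else 0) else 0 := by
  have h0 : ∑ p ∈ sideFaces Γ false, plaquetteMatrix Γ.double β Φ r s t p
      (joinConfig β (i', m', q')) (joinConfig β (i, m, q)) = if i' = i then if q' = q then
        ∑ p ∈ sideFaces Γ false, ∑ j, ((S.dim j ^ r / S.globalDim : ℝ) : ℂ) *
          sideLoop β Φ s t p j false i i 0 m' m else 0 else 0 := by
    simp only [plaquetteMatrix, Matrix.sum_apply, Matrix.smul_apply, smul_eq_mul]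
    rw [Finset.sum_congr rfl fun p hp => Finset.sum_congr rfl fun j _ => by
      rw [loopMatrix_joinConfig_false hp]]
    split_ifs <;> simp
  have h1 : ∑ p ∈ sideFaces Γ true, plaquetteMatrix Γ.double β Φ r s t p
      (joinConfig β (i', m', q')) (joinConfig β (i, m, q)) = if i' = i then if m' = m then
        ∑ p ∈ sideFaces Γ true, ∑ j, ((S.dim j ^ r / S.globalDim : ℝ) : ℂ) *
          sideLoop β Φ s t p j true i i 0 q' q else 0 else 0 := by
    simp only [plaquetteMatrix, Matrix.sum_apply, Matrix.smul_apply, smul_eq_mul]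
    rw [Finset.sum_congr rfl fun p hp => Finset.sum_congr rfl fun j _ => by
      rw [loopMatrix_joinConfig_true hp]]
    split_ifs <;> simp
  simp only [crossInteraction, sideInteraction, Matrix.add_apply, Matrix.smul_apply, sum_plaquettes,
    Matrix.sum_apply, h0, h1, Fintype.sum_prod_type, Fintype.sum_bool, smul_eq_mul,
    vertexMatrix_joinConfig_false, vertexMatrix_joinConfig_true, Finset.sum_add_distrib]
  split_ifs <;> simp <;> ring

end OneSided

end LevinWen

end

noncomputable section

namespace LevinWen

universe v u

open UnitaryFusionCategory SimpleObjects HalfGraph Matrix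

/-! ### Invariance of the cone and reflection positivity -/

section Positivity

variable {C : Type u} [Category.{v} C] [Abelian C] [Linear ℂ C] [MonoidalCategory C]
  [MonoidalPreadditive C] [MonoidalLinear ℂ C] [UnitaryFusionCategory C]
  {S : SimpleObjects C} {V E₀ E₁ : Type*} {Γ : HalfGraph V E₀ E₁}
  [Fintype V] [Fintype E₀] [Fintype E₁] {β : ∀ v, HomONB (S.tens (Γ.double.link v))}

theorem iota_adjoint_tmul_apply (x : HalfSpace S Γ β false) (y : HalfSpace S Γ β true)
    (c : Config (fun v => (β v).n) (E₀ ⊕ E₁ × Bool) S.Irr) :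
    (iota S Γ β).adjoint (x ⊗ₜ[ℂ] y) c =
      x (restrictConfig S Γ β false c) * y (restrictConfig S Γ β true c) := by
  classical
  have h := LinearMap.adjoint_inner_right (iota S Γ β) (EuclideanSpace.single c (1 : ℂ)) (x ⊗ₜ[ℂ] y)
  have hi : iota S Γ β (EuclideanSpace.single c (1 : ℂ)) =
      EuclideanSpace.single (restrictConfig S Γ β false c) (1 : ℂ) ⊗ₜ[ℂ]
        EuclideanSpace.single (restrictConfig S Γ β true c) (1 : ℂ) := by
    unfold iota
    convert Module.Basis.constr_basis _ _ _ c using 2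
    simp
  rw [hi, TensorProduct.inner_tmul] at h
  simpa [EuclideanSpace.inner_single_left] using h

omit [Fintype E₀] [Fintype E₁] in
open Classical in
theorem reflection_apply (h : HalfSpace S Γ β true)
    (c : Config (fun v : V => (β (v, false)).n) (E₀ ⊕ E₁) S.Irr) :
    reflection S Γ β h c = ∑ b : ∀ v, Fin (β (v, true)).n, star (h ⟨b, c.edge⟩) *
      ∏ v, HomONB.conjMatrix (S.tensPair Γ (Γ.link v)) (β (v, true)) (β (v, false))
        (c.vert v) (b v) :=
  Finset.sum_congr rfl fun _ _ => congrArg _ (Finset.prod_congr rfl fun v _ =>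
    congrArg (homInner _) (conjVertex_eq S Γ (Γ.link v) _))

/-- For fixed crossing labels the slice has entries `θ(h)(m) h(q)`. It is `Θ` applied to the matrix
with entries `star (h q') * h q`, which is positive semidefinite of rank at most one. -/
theorem iota_adjoint_mem (h : HalfSpace S Γ β true) :
    (iota S Γ β).adjoint (reflection S Γ β h ⊗ₜ[ℂ] h) ∈
      reflectionCone (joinConfig β) (sideReflection β) := by
  classical
  intro i
  refine ⟨vecMulVec (star fun q : SideConfig β true => h ⟨q.vert, Sum.elim i q.edge⟩)
    (fun q : SideConfig β true => h ⟨q.vert, Sum.elim i q.edge⟩),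
    posSemidef_vecMulVec_star_self _, ?_⟩
  have hr : ∀ (m : SideConfig β false) (q : SideConfig β true) (b : Bool),
      (restrictConfig S Γ β b (joinConfig β (i, m, q))).edge =
        Sum.elim i (bif b then q.edge else m.edge) := by
    intro m q b
    funext e
    rcases e with e | e <;> cases b <;> rfl
  ext m q
  simp only [slice, Matrix.of_apply, iota_adjoint_tmul_apply]
  have h1 : restrictConfig S Γ β true (joinConfig β (i, m, q)) = ⟨q.vert, Sum.elim i q.edge⟩ :=
    Config.ext' rfl (hr m q true)
  rw [h1, Matrix.mul_apply, sum_config, Finset.sum_eq_single m.edge]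
  · rw [reflection_apply, hr, Finset.sum_mul]
    refine Finset.sum_congr rfl fun b _ => ?_
    simp only [sideReflection, diagTensor, Matrix.of_apply, if_true, vecMulVec_apply, Pi.star_apply,
      cond_false]
    change star _ * (∏ v, HomONB.conjMatrix _ _ _ (m.vert v) (b v)) * _ = _
    exact (mul_assoc _ _ _).trans (mul_left_comm _ _ _)
  · intro l _ hl
    simp [sideReflection, diagTensor, hl.symm]
  · simp

theorem hamiltonian_eq (Φ : S.FusionONB) (r s t lamP lamV : ℝ) :
    hamiltonian Γ.double β Φ r s t lamP lamV =
      ((lamP * Γ.double.plaquettes.card + lamV * Fintype.card (V × Bool) : ℝ) : ℂ) •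
        (1 : Space S Γ.double β →L[ℂ] Space S Γ.double β) -
      toEuclideanCLM (𝕜 := ℂ)
        ((lamP : ℂ) • ∑ p ∈ Γ.double.plaquettes, plaquetteMatrix Γ.double β Φ r s t p +
        (lamV : ℂ) • ∑ v, vertexMatrix S Γ.double β v) := by
  classical
  rw [hamiltonian, ← map_one (toEuclideanCLM (𝕜 := ℂ)), ← map_smul, ← map_sub]
  congr 1
  simp only [Finset.sum_sub_distrib, Finset.sum_const, Finset.card_univ]
  push_cast
  rw [← Nat.cast_smul_eq_nsmul ℂ, ← Nat.cast_smul_eq_nsmul ℂ]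
  module

theorem exp_hamiltonian_mem (hΓ : Γ.double.IsRegular) (Φ : S.FusionONB) (r s t : ℝ)
    {lamP lamV : ℝ} (hP : 0 ≤ lamP) {b : ℝ} (hb : 0 ≤ b) {F : Space S Γ.double β}
    (hF : F ∈ reflectionCone (joinConfig β) (sideReflection β)) :
    NormedSpace.exp (-(b : ℂ) • hamiltonian Γ.double β Φ r s t lamP lamV) F ∈
      reflectionCone (joinConfig β) (sideReflection β) := by
  classical
  let _ : NormedAlgebra ℚ (Space S Γ.double β →L[ℂ] Space S Γ.double β) :=
    NormedAlgebra.restrictScalars ℚ ℂ (Space S Γ.double β →L[ℂ] Space S Γ.double β)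
  set κ : ℝ := lamP * Γ.double.plaquettes.card + lamV * Fintype.card (V × Bool) with hκ
  set T := toEuclideanCLM (𝕜 := ℂ)
        ((lamP : ℂ) • ∑ p ∈ Γ.double.plaquettes, plaquetteMatrix Γ.double β Φ r s t p +
        (lamV : ℂ) • ∑ v, vertexMatrix S Γ.double β v) with hT
  have h := exp_toEuclideanCLM_mem_reflectionCone (sideReflection_isometry β)
    (crossInteraction_mem hΓ hP (Φ := Φ) (r := r) (s := s) (t := t))
    (sideInteraction_intertwine hΓ r s t lamP lamV)
    (interaction_joinConfig r s t lamP lamV) hb hF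
  -- The constants in the terms `1 - H_p` and `1 - H_v` add up to `κ` and only contribute the
  -- positive factor `exp (-b κ)`.
  have e : -(b : ℂ) • hamiltonian Γ.double β Φ r s t lamP lamV =
      algebraMap ℂ _ ((-(b * κ) : ℝ) : ℂ) + (b : ℂ) • T := by
    rw [hamiltonian_eq, Algebra.algebraMap_eq_smul_one]
    rw [hκ]
    push_cast
    module
  rw [e, NormedSpace.exp_add_of_commute (Algebra.commutes _ _), ← NormedSpace.algebraMap_exp_comm,
    ← Complex.exp_eq_exp_ℂ, Algebra.algebraMap_eq_smul_one, ← Complex.ofReal_exp]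
  exact smul_mem_reflectionCone (Real.exp_pos _).le h

end Positivity

end LevinWen

end

theorem theorem3p1 {C : Type*} [Category C] [Abelian C] [Linear ℂ C] [MonoidalCategory C]
    [MonoidalPreadditive C] [MonoidalLinear ℂ C] [LevinWen.UnitaryFusionCategory C]
    (S : LevinWen.SimpleObjects C) (Φ : S.FusionONB)
    {V E₀ E₁ : Type*} [Fintype V] [Fintype E₀] [Fintype E₁]
    (Γ : LevinWen.HalfGraph V E₀ E₁) (hΓ : Γ.double.IsRegular)
    (β : ∀ v, LevinWen.HomONB (S.tens (Γ.double.link v)))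
    (r s t lamP lamV : ℝ) (hP : 0 ≤ lamP) (hV : 0 ≤ lamV)
    (h Ω : LevinWen.HalfSpace S Γ β true) (b : ℝ) (hb : 0 ≤ b) :
    0 ≤ inner ℂ
      (NormedSpace.exp (-(b : ℂ) • LevinWen.hamiltonian Γ.double β Φ r s t lamP lamV)
        ((LevinWen.iota S Γ β).adjoint (LevinWen.reflection S Γ β h ⊗ₜ[ℂ] h)))
      ((LevinWen.iota S Γ β).adjoint (LevinWen.reflection S Γ β Ω ⊗ₜ[ℂ] Ω)) := by
  classical
  exact LevinWen.inner_nonneg_of_mem_reflectionCone (LevinWen.sideReflection_isometry β)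
    (LevinWen.exp_hamiltonian_mem hΓ Φ r s t hP hb (LevinWen.iota_adjoint_mem h))
    (LevinWen.iota_adjoint_mem Ω)
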